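/- Let $G$ be a finite connected graph (loops and multiple edges are allowed) whose fundamental group is free of rank $n\geq 2$, and assume that every vertex of $G$ has valence at least $3$, where a loop counts twice towards the valence of its vertex. Let $\mathrm{cX}(G)$ be the poset, ordered by inclusion, of all proper connected subgraphs of $G$ whose fundamental group is non-trivial (equivalently, that are not trees). Then the geometric realisation of the order complex of $\mathrm{cX}(G)$ (the simplicial complex whose simplices are the finite non-empty chains of $\mathrm{cX}(G)$) is homotopy equivalent to a wedge of finitely many, and at least one, spheres of dimension $n-2$. -/

import Mathlib

open scoped Graph

/-! ### Graphs

Finite graphs, possibly with loops and multiple edges, are terms of Mathlib's `Graph α β`; a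
subgraph of `G` is a graph `H ≤ G`. -/

namespace Graph

variable {α β : Type*}

/-- A graph is connected if it has a vertex and any two vertices are joined by an edge path. -/
def IsConnected (G : Graph α β) : Prop :=
  V(G).Nonempty ∧ ∀ x ∈ V(G), ∀ y ∈ V(G), Relation.ReflTransGen G.Adj x y

/-- The valence of a vertex: the number of incident edges, where loops are counted twice. -/
noncomputable def valence (G : Graph α β) (x : α) : ℕ :=
  (G.incidenceSet x).ncard + (G.loopSet x).ncard

/-- The initial vertex of an edge, for an arbitrarily chosen orientation of the edges. -/
noncomputable def edgeSource (G : Graph α β) (e : E(G)) : α :=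
  (G.exists_isLink_of_mem_edgeSet e.2).choose

/-- The terminal vertex of an edge, for the same orientation as in `edgeSource`. -/
noncomputable def edgeTarget (G : Graph α β) (e : E(G)) : α :=
  (G.exists_isLink_of_mem_edgeSet e.2).choose_spec.choose

theorem isLink_edgeSource_edgeTarget (G : Graph α β) (e : E(G)) :
    G.IsLink e (G.edgeSource e) (G.edgeTarget e) :=
  (G.exists_isLink_of_mem_edgeSet e.2).choose_spec.choose_spec

/-- The quiver on the vertices of `G` in which every edge of `G`, loop or not, is exactly one arrow,
pointing in its chosen direction. -/
noncomputable instance quiverVertexSet (G : Graph α β) : Quiver V(G) where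
  Hom x y := {e : E(G) // G.edgeSource e = x ∧ G.edgeTarget e = y}

/-- The fundamental groupoid of a graph `G`: its objects are the vertices, its morphisms are the edge
paths (running along the edges in either direction) up to insertion and deletion of backtracks.
Up to isomorphism this does not depend on the orientation. -/
abbrev FundamentalGroupoid (G : Graph α β) := Quiver.FreeGroupoid V(G)

/-- The fundamental group `π₁(G, v)`: closed edge paths at `v` modulo backtracking. -/
abbrev FundamentalGroup (G : Graph α β) (v : V(G)) :=
  CategoryTheory.End ((Quiver.FreeGroupoid.of V(G)).obj v : G.FundamentalGroupoid)

/-- The fundamental group of `G` (at some vertex, and so at every vertex if `G` is connected) is a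
free group of rank `n`. -/
def HasRank (G : Graph α β) (n : ℕ) : Prop :=
  ∃ v : V(G), Nonempty (G.FundamentalGroup v ≃* FreeGroup (Fin n))

/-- The poset `cX(G)`, ordered by inclusion, of all proper connected subgraphs of `G` that have a
non-trivial fundamental group, that is, that are not trees. (Such a subgraph has no isolated vertex,
so it is determined by its set of edges.) -/
def cX (G : Graph α β) : Type _ :=
  {H : Graph α β //
    H ≤ G ∧ H ≠ G ∧ H.IsConnected ∧ ∃ v : V(H), Nontrivial (H.FundamentalGroup v)}

instance (G : Graph α β) : PartialOrder G.cX :=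
  inferInstanceAs (PartialOrder {H : Graph α β //
    H ≤ G ∧ H ≠ G ∧ H.IsConnected ∧ ∃ v : V(H), Nontrivial (H.FundamentalGroup v)})

theorem finite_cX (G : Graph α β) [Finite V(G)] [Finite E(G)] : Finite G.cX := by
  let f : G.cX → {s : Set α // s ⊆ V(G)} × {s : Set β // s ⊆ E(G)} := fun H =>
    (⟨V(H.1), H.2.1.vertexSet_mono⟩, ⟨E(H.1), H.2.1.edgeSet_mono⟩)
  have h1 : Finite {s : Set α // s ⊆ V(G)} := (Set.toFinite V(G)).finite_subsets
  have h2 : Finite {s : Set β // s ⊆ E(G)} := (Set.toFinite E(G)).finite_subsets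
  refine Finite.of_injective f fun H K h => Subtype.ext ?_
  have hV : V(H.1) = V(K.1) := congrArg (fun p => p.1.1) h
  have hE : E(H.1) = E(K.1) := congrArg (fun p => p.2.1) h
  exact Compatible.ext hV hE (Compatible.of_le_le H.2.1 K.2.1)

noncomputable instance (G : Graph α β) [Finite V(G)] [Finite E(G)] : Fintype G.cX :=
  have := G.finite_cX
  Fintype.ofFinite _

end Graph

/-! ### Order complexes and their realisations -/

/-- The order complex `Δ(P)` of a poset: its simplices are the finite non-empty chains of `P`. -/
def orderComplex (P : Type*) [PartialOrder P] : AbstractSimplicialComplex P where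
  faces := {s | s.Nonempty ∧ IsChain (· ≤ ·) (s : Set P)}
  isRelLowerSet_faces := fun _ hs =>
    ⟨hs.1, fun _ hts ht => ⟨ht, hs.2.mono (Finset.coe_subset.2 hts)⟩⟩
  singleton_mem := fun v => ⟨Finset.singleton_nonempty v, by simp⟩

/-- The geometric realisation of a simplicial complex with finitely many vertices: the union, in the
standard simplex spanned by the vertices, of the closed faces that belong to the complex. -/
def AbstractSimplicialComplex.realisation {ι : Type*} [Fintype ι]
    (K : AbstractSimplicialComplex ι) : Set (ι → ℝ) :=
  {w | w ∈ stdSimplex ℝ ι ∧ ∃ s ∈ K.faces, Function.support w ⊆ (s : Set ι)}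

/-- The realisation of a finite poset, a subspace of `P → ℝ`. -/
abbrev PosetRealisation (P : Type*) [PartialOrder P] [Fintype P] : Type _ :=
  (orderComplex P).realisation

/-! ### Wedges of spheres -/

/-- The relation that identifies all the base points in a disjoint union of pointed spaces. -/
inductive WedgeRel {ι : Type*} (X : ι → Type*) (x : ∀ i, X i) : (Σ i, X i) → (Σ i, X i) → Prop
  | base (i j : ι) : WedgeRel X x ⟨i, x i⟩ ⟨j, x j⟩

/-- The wedge of a non-empty family of pointed spaces: the disjoint union with all base points
identified, with the quotient topology. -/
abbrev Wedge {ι : Type*} (X : ι → Type*) (x : ∀ i, X i) : Type _ := Quot (WedgeRel X x)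

/-- The unit sphere of dimension `d` in `ℝ^(d+1)`. -/
abbrev UnitSphere (d : ℕ) : Type := Metric.sphere (0 : EuclideanSpace ℝ (Fin (d + 1))) 1

/-- The base point `(1, 0, …, 0)` of the sphere. -/
noncomputable def UnitSphere.base (d : ℕ) : UnitSphere d :=
  ⟨EuclideanSpace.single 0 1, by simp⟩

/-- A space is homotopy equivalent to a wedge of finitely many, and at least one, `d`-spheres. -/
def IsWedgeOfSpheres (T : Type*) [TopologicalSpace T] (d : ℕ) : Prop :=
  ∃ m : ℕ, 1 ≤ m ∧ Nonempty (ContinuousMap.HomotopyEquiv T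
    (Wedge (fun _ : Fin m => UnitSphere d) (fun _ => UnitSphere.base d)))

/-!
The theorem reduces to a statement about edge sets, which is proved by induction, and to some
elementary topology of simplicial complexes.

*From subgraphs to cores.* A finite connected graph is not a tree if and only if pruning its
leaves leaves a non-empty core, its largest subgraph without vertices of valence one. Sending a
subgraph to its core is a monotone map below the identity, and it fixes the connected core graphs,
so the realisation of `cX(G)` is homotopy equivalent to that of the poset of proper connected core
subgraphs (`realisationHomotopyEquiv`). The latter are encoded as sets of edges (`properCores`).
The fundamental group enters only through a count: functors from the fundamental groupoid to a
finite group are labellings of the edges (`Graph.IsConnected.card_pow`), which gives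
`|E| - |V| = n - 1` for rank `n`, and through the fact that the fundamental group is trivial if all
labellings are coboundaries.

*Deletion and contraction.* By `exists_isSpherical_properCores`, the order complex of the proper
connected core subgraphs of a connected core graph of rank `n` has dimension `n - 2` and becomes
collapsible after a positive number of simplices of dimension `n - 2` is removed. Choose an edge
`a`, not a loop if possible. The core subgraphs, other than the complement of `a`, that contain
`a` whenever they contain both its ends correspond to the proper core subgraphs of the graph with
`a` contracted (`image_erase_closedCores`); if all edges are loops, they form a cone with apex
`{a}`. Adding `a` where both its ends are present is a closure operator onto them, so that the
remaining core subgraphs change nothing. If the complement of `a` is itself a core graph, it is a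
maximal element, and it attaches the cone over the complex of its own proper core subgraphs, which
is known by induction, of dimension one less. The dimensions are controlled by the fact that the
rank strictly increases along inclusions of connected core graphs (`IsCore.excess_lt`).

*From collapses to spheres.* A collapsible complex is contractible. If a complex becomes
contractible after the removal of `m` facets of dimension `d`, then the contraction extends to the
whole complex (`IsFacetFamily.exists_homotopy_extension`). Hence the complex is homotopy
equivalent to the quotient that collapses everything but the interiors of these facets, and an
explicit stereographic formula identifies each facet modulo its boundary with a sphere
(`IsFacetFamily.nonempty_homotopyEquiv_wedge`).
-/

/-! ### Realisations of families of faces -/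

section Realisation

variable {V : Type*}

theorem support_subset_of_forall {w : V → ℝ} {s : Finset V} (h : ∀ x, x ∉ s → w x = 0) :
    Function.support w ⊆ (s : Set V) := fun x hx => by
  by_contra hxs
  exact hx (h x hxs)

theorem apply_eq_zero_of_support_subset {w : V → ℝ} {s : Finset V}
    (h : Function.support w ⊆ (s : Set V)) {x : V} (hx : x ∉ s) : w x = 0 := by
  by_contra hne
  exact hx (h hne)

variable [Fintype V]

/-- The union, in the standard simplex spanned by `V`, of the closed faces belonging to the family
`K`. The family is not required to be closed under subsets. -/
def facesRealisation (K : Set (Finset V)) : Set (V → ℝ) :=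
  {w | w ∈ stdSimplex ℝ V ∧ ∃ s ∈ K, Function.support w ⊆ (s : Set V)}

theorem facesRealisation.continuous_apply {K : Set (Finset V)} (x : V) :
    Continuous fun w : facesRealisation K => w.1 x :=
  (_root_.continuous_apply x).comp continuous_subtype_val

theorem facesRealisation_mono {K L : Set (Finset V)} (h : K ⊆ L) :
    facesRealisation K ⊆ facesRealisation L :=
  fun _ hw => ⟨hw.1, hw.2.imp fun _ hs => ⟨h hs.1, hs.2⟩⟩

/-- Two maps are homotopic by straight lines if every point has its two images in a common face. -/
theorem homotopic_of_common_face {X : Type*} [TopologicalSpace X] {K : Set (Finset V)}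
    (f g : C(X, facesRealisation K))
    (h : ∀ x, ∃ s ∈ K, Function.support (f x).1 ⊆ (s : Set V) ∧
      Function.support (g x).1 ⊆ (s : Set V)) : f.Homotopic g := by
  refine ⟨⟨⟨fun p => ⟨(1 - (p.1 : ℝ)) • (f p.2).1 + (p.1 : ℝ) • (g p.2).1, ?_, ?_⟩, ?_⟩, ?_, ?_⟩⟩
  · exact convex_stdSimplex ℝ V (f p.2).2.1 (g p.2).2.1 (by linarith [p.1.2.2]) p.1.2.1 (by ring)
  · obtain ⟨s, hs, hf, hg⟩ := h p.2
    refine ⟨s, hs, support_subset_of_forall fun x hx => ?_⟩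
    simp [apply_eq_zero_of_support_subset hf hx, apply_eq_zero_of_support_subset hg hx]
  · apply Continuous.subtype_mk
    fun_prop
  · intro x
    ext
    simp
  · intro x
    ext
    simp

/-- The inclusion between the realisations of two families of faces. -/
def facesInclusion {K L : Set (Finset V)} (h : K ⊆ L) :
    C(facesRealisation K, facesRealisation L) :=
  ⟨Set.inclusion (facesRealisation_mono h), by fun_prop⟩

end Realisation

/-! ### Collapsible complexes -/

section Collapsible

variable {V : Type*} [DecidableEq V]

/-- Collapsible simplicial complexes (given by their non-empty faces): those obtained from a point
by elementary expansions, each of which adds a simplex `insert v σ` together with its facet `σ`, all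
other faces of the simplex being already there. -/
inductive Collapsible : Set (Finset V) → Prop
  | point (v : V) : Collapsible {{v}}
  | expand {K : Set (Finset V)} {σ : Finset V} {v : V} (hK : Collapsible K) (hσ : σ.Nonempty)
      (hσK : σ ∉ K) (hv : v ∉ σ)
      (hfaces : ∀ τ ⊆ insert v σ, τ.Nonempty → ¬ σ ⊆ τ → τ ∈ K) :
      Collapsible (insert σ (insert (insert v σ) K))

theorem eq_or_eq_insert_of_subset {σ τ : Finset V} {v : V} (h1 : σ ⊆ τ) (h2 : τ ⊆ insert v σ) :
    τ = σ ∨ τ = insert v σ := by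
  by_cases hv : v ∈ τ
  · exact Or.inr (h2.antisymm (Finset.insert_subset hv h1))
  · refine Or.inl (Finset.Subset.antisymm (fun x hx => ?_) h1)
    rcases Finset.mem_insert.1 (h2 hx) with rfl | h
    · exact absurd hx hv
    · exact h

theorem Collapsible.mem_of_subset {K : Set (Finset V)} (hK : Collapsible K) :
    ∀ s ∈ K, ∀ t ⊆ s, t.Nonempty → t ∈ K := by
  induction hK with
  | point v =>
    rintro s rfl t ht hne
    exact (Finset.subset_singleton_iff.1 ht).resolve_left hne.ne_empty
  | @expand K σ v hK hσ hσK hv hfaces ih =>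
    have key : ∀ t ⊆ insert v σ, t.Nonempty → t ∈ insert σ (insert (insert v σ) K) := by
      intro t ht hne
      by_cases hst : σ ⊆ t
      · rcases eq_or_eq_insert_of_subset hst ht with h | h
        · exact Or.inl h
        · exact Or.inr (Or.inl h)
      · exact Or.inr (Or.inr (hfaces t ht hne hst))
    rintro s (rfl | rfl | hs) t ht hne
    · exact key t (ht.trans (Finset.subset_insert _ _)) hne
    · exact key t ht hne
    · exact Or.inr (Or.inr (ih s hs t ht hne))

/-- The effect of an elementary collapse: push the mass of the free face `σ` to the vertex `v` until
one of the coordinates in `σ` vanishes. -/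
noncomputable def collapseMap (σ : Finset V) (hσ : σ.Nonempty) (v : V) (w : V → ℝ) : V → ℝ :=
  fun x => w x + (if x = v then σ.card * σ.inf' hσ w else 0) - (if x ∈ σ then σ.inf' hσ w else 0)

theorem continuous_collapseMap (σ : Finset V) (hσ : σ.Nonempty) (v : V) :
    Continuous (collapseMap σ hσ v) := by
  have h : Continuous fun w : V → ℝ => σ.inf' hσ w := by
    exact Continuous.finset_inf'_apply hσ fun i _ => continuous_apply i
  refine continuous_pi fun x => ?_
  refine ((continuous_apply x).add ?_).sub ?_ <;> split_ifs <;> fun_prop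

variable [Fintype V]

theorem collapseMap_mem_stdSimplex {σ : Finset V} {hσ : σ.Nonempty} {v : V} {w : V → ℝ}
    (hw : w ∈ stdSimplex ℝ V) : collapseMap σ hσ v w ∈ stdSimplex ℝ V := by
  have h0 : 0 ≤ σ.inf' hσ w := Finset.le_inf' hσ w fun x _ => hw.1 x
  constructor
  · intro x
    unfold collapseMap
    have h1 : 0 ≤ if x = v then (σ.card : ℝ) * σ.inf' hσ w else 0 := by split_ifs <;> positivity
    have h2 : (if x ∈ σ then σ.inf' hσ w else 0) ≤ w x := by
      split_ifs with h
      · exact Finset.inf'_le w h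
      · exact hw.1 x
    linarith
  · unfold collapseMap
    rw [Finset.sum_sub_distrib, Finset.sum_add_distrib, hw.2]
    simp

/-- Every elementary expansion is a homotopy equivalence, the inverse being `collapseMap`. -/
theorem Collapsible.contractibleSpace {K : Set (Finset V)} (hK : Collapsible K) :
    ContractibleSpace (facesRealisation K) := by
  induction hK with
  | point v =>
    have hmem : (Pi.single v 1 : V → ℝ) ∈ facesRealisation ({{v}} : Set (Finset V)) :=
      ⟨single_mem_stdSimplex ℝ v, {v}, rfl, support_subset_of_forall fun x hx => by
        simp [Finset.mem_singleton.not.1 hx]⟩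
    have : Subsingleton (facesRealisation ({{v}} : Set (Finset V))) := by
      refine ⟨fun a b => ?_⟩
      have key : ∀ c : facesRealisation ({{v}} : Set (Finset V)), c = ⟨_, hmem⟩ := by
        rintro ⟨c, hc, s, rfl, hs⟩
        ext x
        have h1 : ∀ y, y ≠ v → c y = 0 := fun y hy =>
          apply_eq_zero_of_support_subset hs (by simpa using hy)
        have h2 : c v = 1 := by
          rw [← hc.2]
          exact (Finset.sum_eq_single v (fun y _ hy => h1 y hy) (by simp)).symm
        by_cases hx : x = v
        · subst hx; simp [h2]
        · simp [h1 x hx, hx]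
      rw [key a, key b]
    have : Nonempty (facesRealisation ({{v}} : Set (Finset V))) := ⟨⟨_, hmem⟩⟩
    have : Unique (facesRealisation ({{v}} : Set (Finset V))) :=
      Nonempty.some ((unique_iff_subsingleton_and_nonempty _).2 ⟨‹_›, ‹_›⟩)
    exact (Homeomorph.homeomorphOfUnique _ Unit).contractibleSpace
  | @expand K σ v hK hσ hσK hv hfaces ih =>
    have hsub : K ⊆ insert σ (insert (insert v σ) K) := fun s hs => Or.inr (Or.inr hs)
    have hfix : ∀ w ∈ facesRealisation K, collapseMap σ hσ v w = w := by
      rintro w ⟨hw, s, hs, hws⟩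
      obtain ⟨x, hxσ, hxs⟩ : ∃ x ∈ σ, x ∉ s := by
        by_contra! hcon
        exact hσK (hK.mem_of_subset s hs σ hcon hσ)
      have h0 : σ.inf' hσ w = 0 := by
        refine le_antisymm ?_ (Finset.le_inf' hσ w fun x _ => hw.1 x)
        rw [← apply_eq_zero_of_support_subset hws hxs]
        exact Finset.inf'_le w hxσ
      ext y
      simp [collapseMap, h0]
    -- A point of the new faces loses one of its coordinates in `σ`, a point of the old faces stays.
    have hmap : ∀ w ∈ facesRealisation (insert σ (insert (insert v σ) K)),
        collapseMap σ hσ v w ∈ facesRealisation K ∧ ∃ s ∈ insert σ (insert (insert v σ) K),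
          Function.support w ⊆ (s : Set V) ∧
          Function.support (collapseMap σ hσ v w) ⊆ (s : Set V) := by
      intro w hw
      by_cases hwK : w ∈ facesRealisation K
      · obtain ⟨s, hs⟩ := hw.2
        rw [hfix w hwK]
        exact ⟨hwK, s, hs.1, hs.2, hs.2⟩
      have hws : Function.support w ⊆ ((insert v σ : Finset V) : Set V) := by
        obtain ⟨hw1, s, (rfl | rfl | hs), hws⟩ := hw
        · exact hws.trans (by simp)
        · exact hws
        · exact absurd ⟨hw1, s, hs, hws⟩ hwK
      have hsupp : Function.support (collapseMap σ hσ v w) ⊆ ((insert v σ : Finset V) : Set V) := by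
        refine support_subset_of_forall fun x hx => ?_
        have h1 := apply_eq_zero_of_support_subset hws hx
        rw [Finset.mem_insert, not_or] at hx
        simp [collapseMap, h1, hx.1, hx.2]
      obtain ⟨x, hxσ, hx⟩ := Finset.exists_mem_eq_inf' hσ w
      have hxv : x ≠ v := fun h => hv (h ▸ hxσ)
      refine ⟨⟨collapseMap_mem_stdSimplex hw.1, (insert v σ).erase x, ?_, ?_⟩,
        insert v σ, by simp, hws, hsupp⟩
      · refine hfaces _ (Finset.erase_subset _ _) ⟨v, by simp [hxv.symm]⟩ fun h => ?_
        simpa using h hxσ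
      · refine support_subset_of_forall fun y hy => ?_
        by_cases hyx : y = x
        · subst hyx
          simp [collapseMap, hxv, hxσ, hx]
        · exact apply_eq_zero_of_support_subset hsupp fun h => hy (Finset.mem_erase.2 ⟨hyx, h⟩)
    let r : C(facesRealisation (insert σ (insert (insert v σ) K)), facesRealisation K) :=
      ⟨fun w => ⟨_, (hmap w.1 w.2).1⟩,
        ((continuous_collapseMap σ hσ v).comp continuous_subtype_val).subtype_mk _⟩
    let e : ContinuousMap.HomotopyEquiv (facesRealisation (insert σ (insert (insert v σ) K)))
        (facesRealisation K) :=
      { toFun := r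
        invFun := facesInclusion hsub
        left_inv := by
          refine homotopic_of_common_face _ _ fun w => ?_
          obtain ⟨s, hs, h1, h2⟩ := (hmap w.1 w.2).2
          exact ⟨s, hs, h2, h1⟩
        right_inv := by
          have : r.comp (facesInclusion hsub) = ContinuousMap.id _ := by
            ext w x
            exact congrFun (hfix w.1 w.2) x
          rw [this] }
    exact e.contractibleSpace

end Collapsible

/-! ### Homotopy equivalences between order complexes -/

section OrderComplex

/-- The chains of a partial order, that is, the faces of its order complex. -/
def chainFaces (P : Type*) [PartialOrder P] : Set (Finset P) := (orderComplex P).faces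

variable {P Q : Type*} [PartialOrder P] [PartialOrder Q] [Fintype P] [Fintype Q]

/-- The linear extension of a map between vertex sets. -/
noncomputable def pushForward (f : P → Q) (w : P → ℝ) : Q → ℝ :=
  open Classical in fun q => ∑ p, if f p = q then w p else 0

theorem pushForward_comp {P Q R : Type*} [Fintype P] [Fintype Q] (g : Q → R) (f : P → Q)
    (w : P → ℝ) : pushForward g (pushForward f w) = pushForward (g ∘ f) w := by
  classical
  ext r
  unfold pushForward
  have : ∀ q, (if g q = r then ∑ p, (if f p = q then w p else 0) else 0) =
      ∑ p, if f p = q then (if g (f p) = r then w p else 0) else 0 := fun q => by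
    split_ifs with h
    · refine Finset.sum_congr rfl fun p _ => ?_
      split_ifs with h1
      · rfl
      · exact absurd (h1 ▸ h) ‹_›
      · rfl
    · refine (Finset.sum_eq_zero fun p _ => ?_).symm
      split_ifs with h1 h2
      · exact absurd (h1 ▸ h2) h
      · rfl
      · rfl
  simp_rw [this]
  rw [Finset.sum_comm]
  simp

theorem pushForward_id {P : Type*} [Fintype P] (w : P → ℝ) : pushForward id w = w := by
  classical
  ext r
  simp [pushForward]

theorem pushForward_mem (f : P →o Q) {w : P → ℝ} (hw : w ∈ facesRealisation (chainFaces P)) :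
    pushForward f w ∈ facesRealisation (chainFaces Q) := by
  classical
  obtain ⟨hw, s, ⟨hne, hs⟩, hws⟩ := hw
  refine ⟨⟨fun q => Finset.sum_nonneg fun p _ => ?_, ?_⟩, s.image f, ⟨hne.image _, ?_⟩,
    support_subset_of_forall fun q hq => Finset.sum_eq_zero fun p _ => ?_⟩
  · split_ifs
    · exact hw.1 p
    · exact le_rfl
  · unfold pushForward
    rw [Finset.sum_comm, ← hw.2]
    simp
  · rw [Finset.coe_image]
    rintro _ ⟨x, hx, rfl⟩ _ ⟨y, hy, rfl⟩ _
    rcases hs.total hx hy with h | h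
    · exact Or.inl (f.monotone h)
    · exact Or.inr (f.monotone h)
  · split_ifs with h
    · exact apply_eq_zero_of_support_subset hws fun hp => hq (h ▸ Finset.mem_image_of_mem f hp)
    · rfl

/-- The map between realisations of order complexes induced by a monotone map. -/
noncomputable def realisationMap (f : P →o Q) :
    C(facesRealisation (chainFaces P), facesRealisation (chainFaces Q)) :=
  ⟨fun w => ⟨_, pushForward_mem f w.2⟩, by
    refine Continuous.subtype_mk (continuous_pi fun q => continuous_finsetSum _ fun p _ => ?_) _
    split_ifs
    · exact facesRealisation.continuous_apply p
    · exact continuous_const⟩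

theorem realisationMap_comp {R : Type*} [PartialOrder R] [Fintype R]
    (g : Q →o R) (f : P →o Q) :
    (realisationMap g).comp (realisationMap f) = realisationMap (g.comp f) := by
  ext1 w
  exact Subtype.ext (pushForward_comp g f w.1)

theorem realisationMap_id : realisationMap (OrderHom.id : P →o P) = ContinuousMap.id _ := by
  ext1 w
  exact Subtype.ext (pushForward_id w.1)

/-- The part of the mass of `p` that has been moved at time `t`, when the mass `w` is moved starting
with the lowest elements. -/
noncomputable def movedMass (w : P → ℝ) (t : ℝ) (p : P) : ℝ :=
  open Classical in min (w p) (max 0 (t - ∑ q, if q < p then w q else 0))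

theorem continuous_movedMass (p : P) :
    Continuous fun x : (P → ℝ) × ℝ => movedMass x.1 x.2 p := by
  unfold movedMass
  refine Continuous.min (by fun_prop) (continuous_const.max (continuous_snd.sub
    (continuous_finsetSum _ fun q _ => ?_)))
  split_ifs <;> fun_prop

/-- Of two comparable elements, the upper one does not start to lose mass before the lower one has
lost all of it. -/
theorem le_of_movedMass {w : P → ℝ} (hw : ∀ p, 0 ≤ w p) {t : ℝ} {p q : P}
    (hp : 0 < movedMass w t p) (hq : movedMass w t q < w q) (hpq : p ≤ q ∨ q ≤ p) : p ≤ q := by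
  classical
  refine hpq.elim id fun hqp => ?_
  rcases hqp.eq_or_lt with rfl | hlt
  · exact le_rfl
  exfalso
  have h1 : ∑ r, (if r < p then w r else 0) < t := by
    by_contra! h
    unfold movedMass at hp
    rw [max_eq_left (by linarith)] at hp
    exact absurd hp (by simp)
  have h2 : t < (∑ r, if r < q then w r else 0) + w q := by
    unfold movedMass at hq
    have := (min_lt_iff.1 hq).resolve_left (lt_irrefl _)
    have := (max_lt_iff.1 this).2
    linarith
  have h3 : (∑ r, if r < q then w r else 0) + w q ≤ ∑ r, (if r < p then w r else 0) := by
    have : w q = ∑ r, if r = q then w q else 0 := by simp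
    rw [this, ← Finset.sum_add_distrib]
    refine Finset.sum_le_sum fun r _ => ?_
    by_cases hr : r = q
    · subst hr; simp [hlt]
    · by_cases hrq : r < q
      · simp [hr, hrq, hrq.trans hlt]
      · simp only [hr, hrq, if_false, add_zero]
        split_ifs
        · exact hw r
        · exact le_rfl
  linarith

theorem movedMass_nonneg {w : P → ℝ} (hw : ∀ p, 0 ≤ w p) (t : ℝ) (p : P) :
    0 ≤ movedMass w t p := le_min (hw p) (le_max_left _ _)

theorem movedMass_le (w : P → ℝ) (t : ℝ) (p : P) : movedMass w t p ≤ w p := min_le_left _ _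

theorem movedMass_zero {w : P → ℝ} (hw : ∀ p, 0 ≤ w p) (p : P) : movedMass w 0 p = 0 := by
  classical
  unfold movedMass
  rw [max_eq_left, min_eq_right (hw p)]
  have : 0 ≤ ∑ q, if q < p then w q else 0 := Finset.sum_nonneg fun q _ => by
    split_ifs
    · exact hw q
    · exact le_rfl
  convert sub_nonpos.2 this using 3

theorem movedMass_one {w : P → ℝ} (hw : w ∈ stdSimplex ℝ P) (p : P) : movedMass w 1 p = w p := by
  classical
  unfold movedMass
  refine min_eq_left (le_max_of_le_right ?_)
  have : w p + ∑ q, (if q < p then w q else 0) ≤ ∑ q, w q := by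
    have : w p = ∑ r, if r = p then w p else 0 := by simp
    rw [this, ← Finset.sum_add_distrib]
    refine Finset.sum_le_sum fun r _ => ?_
    by_cases hr : r = p
    · subst hr; simp
    · simp only [hr, if_false, zero_add]
      split_ifs
      · exact le_rfl
      · exact hw.1 r
  rw [hw.2] at this
  linarith

/-- A monotone self-map below the identity induces a map homotopic to the identity: the mass is
moved from `p` to `f p` one element after the other, from the bottom up, so that the support stays a
chain. -/
theorem realisationMap_homotopic_id (f : P →o P) (hf : ∀ p, f p ≤ p) :
    (ContinuousMap.id _).Homotopic (realisationMap f) := by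
  classical
  let F : (P → ℝ) → ℝ → P → ℝ := fun w t =>
    w - movedMass w t + pushForward f (movedMass w t)
  have hF : ∀ w ∈ facesRealisation (chainFaces P), ∀ t,
      F w t ∈ facesRealisation (chainFaces P) := by
    rintro w ⟨hw, s, ⟨hne, hs⟩, hws⟩ t
    have hpn : ∀ p, 0 ≤ pushForward f (movedMass w t) p := fun p => by
      refine Finset.sum_nonneg fun q _ => ?_
      split_ifs
      · exact movedMass_nonneg hw.1 t q
      · exact le_rfl
    have hstd : F w t ∈ stdSimplex ℝ P := by
      refine ⟨fun p => ?_, ?_⟩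
      · have := movedMass_le w t p
        have := hpn p
        simp only [F, Pi.add_apply, Pi.sub_apply]
        linarith
      · have : ∑ p, pushForward f (movedMass w t) p = ∑ p, movedMass w t p := by
          unfold pushForward
          rw [Finset.sum_comm]
          simp
        simp [F, Finset.sum_add_distrib, this, hw.2]
    refine ⟨hstd, Finset.univ.filter fun p => F w t p ≠ 0, ⟨?_, ?_⟩, fun p hp => by simpa using hp⟩
    · by_contra! h
      have h0 : ∑ p, F w t p = 0 := Finset.sum_eq_zero fun p _ => by
        by_contra hne
        have : p ∈ Finset.univ.filter fun p => F w t p ≠ 0 := by simpa using hne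
        rw [h] at this
        simp at this
      rw [hstd.2] at h0
      exact one_ne_zero h0
    · have hin : ∀ p, 0 < w p → p ∈ s := fun p hp => hws hp.ne'
      -- The support consists of elements not yet exhausted and of images of elements losing mass.
      have key : ∀ p, F w t p ≠ 0 →
          movedMass w t p < w p ∨ ∃ q, f q = p ∧ 0 < movedMass w t q := by
        intro p hp
        by_contra! hcon
        refine hp ?_
        have h1 : movedMass w t p = w p := le_antisymm (movedMass_le w t p) hcon.1
        have h2 : pushForward f (movedMass w t) p = 0 := Finset.sum_eq_zero fun q _ => by
          split_ifs with h
          · exact le_antisymm (hcon.2 q h) (movedMass_nonneg hw.1 t q)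
          · rfl
        simp [F, h1, h2]
      have hpos : ∀ {p}, movedMass w t p < w p → 0 < w p := fun h =>
        (movedMass_nonneg hw.1 t _).trans_lt h
      have hpos' : ∀ {p}, 0 < movedMass w t p → 0 < w p := fun h => h.trans_le (movedMass_le w t _)
      have tot : ∀ {p q}, 0 < w p → 0 < w q → p ≤ q ∨ q ≤ p := fun hp hq =>
        hs.total (hin _ hp) (hin _ hq)
      have mixed : ∀ {p q}, movedMass w t p < w p → 0 < movedMass w t q → f q ≤ p := fun hp hq =>
        (hf _).trans (le_of_movedMass hw.1 hq hp (tot (hpos' hq) (hpos hp)))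
      intro x hx y hy _
      rcases key x (by simpa using hx) with hx | ⟨p, rfl, hp⟩ <;>
        rcases key y (by simpa using hy) with hy | ⟨q, rfl, hq⟩
      · exact tot (hpos hx) (hpos hy)
      · exact Or.inr (mixed hx hq)
      · exact Or.inl (mixed hy hp)
      · exact (tot (hpos' hp) (hpos' hq)).imp (fun h => f.monotone h) fun h => f.monotone h
  have hcont : Continuous fun x : (P → ℝ) × ℝ => F x.1 x.2 := by
    refine continuous_pi fun p => ?_
    refine (((continuous_apply p).comp continuous_fst).sub (continuous_movedMass p)).add
      (continuous_finsetSum _ fun q _ => ?_)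
    split_ifs
    · exact continuous_movedMass q
    · exact continuous_const
  refine ⟨⟨⟨fun x => ⟨F x.2.1 x.1, hF _ x.2.2 _⟩, ?_⟩, fun w => ?_, fun w => ?_⟩⟩
  · exact (hcont.comp (by fun_prop :
      Continuous fun x : unitInterval × facesRealisation (chainFaces P) => (x.2.1, (x.1 : ℝ)))
      ).subtype_mk _
  · ext p
    have : movedMass w.1 0 = 0 := funext (movedMass_zero w.2.1.1)
    simp [F, this, pushForward]
  · ext p
    have : movedMass w.1 1 = w.1 := funext (movedMass_one w.2.1)
    change w.1 p - movedMass w.1 1 p + pushForward f (movedMass w.1 1) p = pushForward f w.1 p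
    rw [this, sub_self, zero_add]

/-- A monotone map with a monotone section that is, up to a decreasing comparison, also an inverse
on the other side induces a homotopy equivalence of realisations. -/
noncomputable def realisationHomotopyEquiv (f : P →o Q) (g : Q →o P) (hgf : ∀ p, g (f p) ≤ p)
    (hfg : ∀ q, f (g q) = q) :
    ContinuousMap.HomotopyEquiv (facesRealisation (chainFaces P))
      (facesRealisation (chainFaces Q)) where
  toFun := realisationMap f
  invFun := realisationMap g
  left_inv := by
    rw [realisationMap_comp]
    exact (realisationMap_homotopic_id (g.comp f) hgf).symm
  right_inv := by
    rw [realisationMap_comp, show f.comp g = OrderHom.id from OrderHom.ext _ _ (funext hfg),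
      realisationMap_id]

end OrderComplex

/-! ### Cones and collapsibility -/

section Cones

variable {V : Type*} [DecidableEq V]

/-- A complex stays collapsible when a cone over a collapsible subcomplex is attached. -/
theorem Collapsible.union_cone {Y Z : Set (Finset V)} {p : V} (hY : Collapsible Y)
    (hZ : Collapsible Z) (hZY : Z ⊆ Y) (hp : ∀ s ∈ Y, p ∉ s) :
    Collapsible (Y ∪ insert {p} (insert p '' Z)) := by
  induction hZ with
  | point v =>
    have hv : v ≠ p := fun h => hp {v} (hZY rfl) (by simp [h])
    have := hY.expand (σ := {p}) (v := v) (by simp) (fun h => hp _ h (by simp)) (by simpa using hv)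
      (fun τ hτ hne hpτ => by
        have hpτ : p ∉ τ := by simpa using hpτ
        have : τ ⊆ {v} := fun x hx => by
          rcases Finset.mem_insert.1 (hτ hx) with rfl | h
          · simp
          · rw [Finset.mem_singleton] at h
            exact absurd (h ▸ hx) hpτ
        rw [(Finset.subset_singleton_iff.1 this).resolve_left hne.ne_empty]
        exact hZY rfl)
    convert this using 1
    ext s
    simp [Finset.pair_comm p v]
  | @expand K σ v hK hσ hσK hv hfaces ih =>
    have hKY : K ⊆ Y := fun s hs => hZY (Or.inr (Or.inr hs))
    have hσY : σ ∈ Y := hZY (Or.inl rfl)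
    have hvσY : insert v σ ∈ Y := hZY (Or.inr (Or.inl rfl))
    have hpσ : p ∉ σ := hp _ hσY
    have hpv : v ≠ p := fun h => hp _ hvσY (by simp [h])
    have := (ih hKY).expand (σ := insert p σ) (v := v) (by simp) ?_ ?_ ?_
    · convert this using 1
      ext s
      simp [Set.image_insert_eq, Finset.insert_comm p v]
      tauto
    · rintro (h | h | ⟨t, ht, h⟩)
      · exact hp _ h (by simp)
      · obtain ⟨x, hx⟩ := hσ
        have : x ∈ ({p} : Finset V) := h ▸ Finset.mem_insert_of_mem hx
        exact hpσ (Finset.mem_singleton.1 this ▸ hx)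
      · have : t = σ := by
          rw [← Finset.erase_insert (hp _ (hKY ht)), h, Finset.erase_insert hpσ]
        exact hσK (this ▸ ht)
    · simp [hpv, hv]
    · intro τ hτ hne hστ
      by_cases hpτ : p ∈ τ
      · refine Or.inr ?_
        rcases (τ.erase p).eq_empty_or_nonempty with h | h
        · left
          rw [← Finset.insert_erase hpτ, h]
          rfl
        · refine Or.inr ⟨τ.erase p, hfaces _ (fun x hx => ?_) h fun h => hστ ?_,
            Finset.insert_erase hpτ⟩
          · have h1 := hτ (Finset.mem_of_mem_erase hx)
            have h2 := Finset.ne_of_mem_erase hx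
            simp only [Finset.mem_insert, h2, false_or] at h1
            simpa using h1
          · exact Finset.insert_subset hpτ (h.trans (Finset.erase_subset _ _))
      · refine Or.inl (hY.mem_of_subset _ hvσY τ (fun x hx => ?_) hne)
        have h1 := hτ hx
        have h2 : x ≠ p := fun h => hpτ (h ▸ hx)
        simp only [Finset.mem_insert, h2, false_or] at h1
        simpa using h1

theorem Collapsible.image {W : Type*} [DecidableEq W] {K : Set (Finset V)} (hK : Collapsible K)
    {A : Finset V} (hA : ∀ s ∈ K, s ⊆ A) {f : V → W} (hf : Set.InjOn f A) :
    Collapsible (Finset.image f '' K) := by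
  induction hK with
  | point v => simpa using Collapsible.point (f v)
  | @expand K σ v hK hσ hσK hv hfaces ih =>
    have hKA : ∀ s ∈ K, s ⊆ A := fun s hs => hA s (Or.inr (Or.inr hs))
    have hvA : insert v σ ⊆ A := hA _ (Or.inr (Or.inl rfl))
    have hσA : σ ⊆ A := hA _ (Or.inl rfl)
    have inj : ∀ {s t : Finset V}, s ⊆ A → t ⊆ A → s.image f = t.image f → s = t := by
      intro s t hs ht h
      have := congrArg (fun u : Finset W => (u : Set W)) h
      simp only [Finset.coe_image] at this
      exact Finset.coe_injective ((hf.image_eq_image_iff (by simpa using hs) (by simpa using ht)).1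
        this)
    have := (ih hKA).expand (σ := σ.image f) (v := f v) (hσ.image f) ?_ ?_ ?_
    · simpa only [Set.image_insert_eq, Finset.image_insert] using this
    · rintro ⟨t, ht, h⟩
      exact hσK (inj (hKA t ht) hσA h ▸ ht)
    · intro h
      obtain ⟨x, hx, hxv⟩ := Finset.mem_image.1 h
      exact hv (hf (hσA hx) (hvA (Finset.mem_insert_self _ _)) hxv ▸ hx)
    · intro τ hτ hne hστ
      rw [← Finset.image_insert] at hτ
      obtain ⟨t, ht, rfl⟩ := Finset.subset_image_iff.1 hτ
      exact ⟨t, hfaces t (by simpa using ht) (Finset.image_nonempty.1 hne)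
        fun h => hστ (Finset.image_subset_image h), rfl⟩

end Cones

/-! ### Spherical sets of poset elements -/

section Spherical

variable {P : Type*} [PartialOrder P]

/-- The non-empty chains contained in a finite set `A`. -/
def chainsIn (A : Finset P) : Set (Finset P) :=
  {s | s.Nonempty ∧ s ⊆ A ∧ IsChain (· ≤ ·) (s : Set P)}

/-- The order complex of `A` has dimension at most `k - 1`, and it becomes collapsible when a
suitable set of `m` simplices of dimension `k - 1` is taken out. -/
def IsSpherical (k m : ℕ) (A : Finset P) : Prop :=
  (∀ s ∈ chainsIn A, s.card ≤ k) ∧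
    ∃ C : Finset (Finset P), C.card = m ∧ (∀ s ∈ C, s ∈ chainsIn A ∧ s.card = k) ∧
      open Classical in Collapsible (chainsIn A \ C)

theorem chainsIn_mono {A B : Finset P} (h : A ⊆ B) : chainsIn A ⊆ chainsIn B :=
  fun _ hs => ⟨hs.1, hs.2.1.trans h, hs.2.2⟩

theorem filter_comparable_of_maximal {A : Finset P} {p : P} (hp : p ∉ A) (hmax : ∀ x ∈ A, ¬ p ≤ x)
    [DecidablePred fun x => x ≤ p ∨ p ≤ x] [DecidablePred fun x => x < p] :
    (A.filter fun x => x ≤ p ∨ p ≤ x) = A.filter fun x => x < p := by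
  refine Finset.filter_congr fun x hx => ?_
  have hne : x ≠ p := fun h => hp (h ▸ hx)
  constructor
  · rintro (h | h)
    · exact lt_of_le_of_ne h hne
    · exact absurd h (hmax x hx)
  · exact fun h => Or.inl h.le

theorem chainsIn_empty : chainsIn (∅ : Finset P) = ∅ := by
  ext s
  simp only [Set.mem_empty_iff_false, iff_false]
  rintro ⟨hne, hs, -⟩
  exact hne.ne_empty (Finset.subset_empty.1 hs)

variable [DecidableEq P]

/-- The definition does not depend on the decidability instance that is used. -/
theorem IsSpherical.iff_decidable {k m : ℕ} {A : Finset P} : IsSpherical k m A ↔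
    (∀ s ∈ chainsIn A, s.card ≤ k) ∧
    ∃ C : Finset (Finset P), C.card = m ∧ (∀ s ∈ C, s ∈ chainsIn A ∧ s.card = k) ∧
      Collapsible (chainsIn A \ C) := by
  unfold IsSpherical
  convert Iff.rfl

open Classical in
/-- Adding `p` attaches the cone with apex `p` over the complex of the elements comparable to `p`.
-/
theorem chainsIn_insert {A : Finset P} {p : P} :
    chainsIn (insert p A) =
      chainsIn A ∪ insert {p} (insert p '' chainsIn (A.filter fun x => x ≤ p ∨ p ≤ x)) := by
  ext s
  constructor
  · rintro ⟨hne, hs, hc⟩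
    by_cases hps : p ∈ s
    · right
      rcases (s.erase p).eq_empty_or_nonempty with h | h
      · left
        rw [← Finset.insert_erase hps, h]
        rfl
      · refine Or.inr ⟨s.erase p, ⟨h, fun x hx => ?_, hc.mono (by simp)⟩,
          by convert Finset.insert_erase hps⟩
        have hx' := Finset.mem_of_mem_erase hx
        have hxp := Finset.ne_of_mem_erase hx
        exact Finset.mem_filter.2 ⟨(Finset.mem_insert.1 (hs hx')).resolve_left hxp,
          hc hx' hps hxp⟩
    · exact Or.inl ⟨hne, fun x hx => (Finset.mem_insert.1 (hs hx)).resolve_left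
        fun h => hps (h ▸ hx), hc⟩
  · rintro (h | rfl | ⟨t, ⟨hne, ht, hc⟩, rfl⟩)
    · exact chainsIn_mono (Finset.subset_insert _ _) h
    · exact ⟨by simp, by simp, by simp⟩
    · refine ⟨by simp, Finset.insert_subset_insert _ (ht.trans (Finset.filter_subset _ _)), ?_⟩
      rw [Finset.coe_insert]
      exact hc.insert fun x hx _ => ((Finset.mem_filter.1 (ht hx)).2).symm

/-- The order complex of a poset with an element comparable to all others is a cone. -/
theorem collapsible_chainsIn_of_comparable {c : P} (A : Finset P) (hc : c ∈ A)
    (h : ∀ x ∈ A, x ≤ c ∨ c ≤ x) : Collapsible (chainsIn A) := by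
  classical
  induction A using Finset.strongInduction with
  | H A ih =>
    by_cases hA : A = {c}
    · subst hA
      convert Collapsible.point c
      ext s
      constructor
      · rintro ⟨hne, hs, -⟩
        exact (Finset.subset_singleton_iff.1 hs).resolve_left hne.ne_empty
      · rintro rfl
        exact ⟨by simp, by simp, by simp⟩
    · obtain ⟨p, hp, hpc⟩ : ∃ p ∈ A, p ≠ c := by
        by_contra! hcon
        exact hA (Finset.eq_singleton_iff_unique_mem.2 ⟨hc, hcon⟩)
      have hlt := Finset.erase_ssubset hp
      have h1 := ih (A.erase p) hlt (Finset.mem_erase.2 ⟨hpc.symm, hc⟩)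
        fun x hx => h x (Finset.mem_of_mem_erase hx)
      have h2 := ih ((A.erase p).filter fun x => x ≤ p ∨ p ≤ x)
        ((Finset.filter_subset _ _).trans_ssubset hlt)
        (Finset.mem_filter.2 ⟨Finset.mem_erase.2 ⟨hpc.symm, hc⟩, (h p hp).symm⟩)
        fun x hx => h x (Finset.mem_of_mem_erase (Finset.mem_of_mem_filter x hx))
      have := h1.union_cone h2 (chainsIn_mono (Finset.filter_subset _ _))
        (fun s hs hps => Finset.notMem_erase p A (hs.2.1 hps))
      rw [← Finset.insert_erase hp]
      convert this using 1
      convert chainsIn_insert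

theorem isSpherical_of_comparable {k : ℕ} {c : P} {A : Finset P} (hc : c ∈ A)
    (h : ∀ x ∈ A, x ≤ c ∨ c ≤ x) (hk : ∀ s ∈ chainsIn A, s.card ≤ k) : IsSpherical k 0 A := by
  classical
  exact IsSpherical.iff_decidable.2
    ⟨hk, ∅, rfl, by simp, by simpa using collapsible_chainsIn_of_comparable A hc h⟩

/-- Adding an element `p` such that the elements above it have a minimum does not change anything:
the link of `p` is a cone. -/
theorem IsSpherical.insert_of_min {k m : ℕ} {A : Finset P} {p c : P} (hA : IsSpherical k m A)
    (hp : p ∉ A) (hc : c ∈ A) (hpc : p ≤ c) (hmin : ∀ x ∈ A, p ≤ x → c ≤ x)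
    (hk : ∀ s ∈ chainsIn (insert p A), s.card ≤ k) : IsSpherical k m (insert p A) := by
  classical
  obtain ⟨-, C, hCm, hC, hcoll⟩ := IsSpherical.iff_decidable.1 hA
  refine IsSpherical.iff_decidable.2 ⟨hk, C, hCm,
    fun s hs => ⟨chainsIn_mono (Finset.subset_insert _ _) (hC s hs).1, (hC s hs).2⟩, ?_⟩
  have hlink : Collapsible (chainsIn (A.filter fun x => x ≤ p ∨ p ≤ x)) := by
    refine collapsible_chainsIn_of_comparable (c := c) _ (by simp [hc, hpc]) fun x hx => ?_
    obtain ⟨hxA, h | h⟩ := Finset.mem_filter.1 hx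
    · exact Or.inl (h.trans hpc)
    · exact Or.inr (hmin x hxA h)
  have hpC : ∀ s ∈ C, p ∉ s := fun s hs hps => hp ((hC s hs).1.2.1 hps)
  have := hcoll.union_cone hlink (p := p) (fun s hs => ⟨chainsIn_mono (Finset.filter_subset _ _) hs,
    fun hsC => ?_⟩) (fun s hs hps => hp (hs.1.2.1 hps))
  · convert this using 1
    rw [chainsIn_insert]
    ext s
    constructor
    · rintro ⟨h | h, h'⟩
      · exact Or.inl ⟨h, h'⟩
      · exact Or.inr (by convert h)
    · rintro (h | h)
      · exact ⟨Or.inl h.1, h.2⟩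
      · refine ⟨Or.inr (by convert h), fun hsC => hpC s hsC ?_⟩
        rcases h with rfl | ⟨t, -, rfl⟩ <;> simp
  -- The cone over a top-dimensional simplex would exceed the dimension.
  · have h1 : insert p s ∈ chainsIn (insert p A) := by
      rw [chainsIn_insert]
      exact Or.inr (Or.inr ⟨s, hs, by congr⟩)
    have h2 := hk _ h1
    rw [Finset.card_insert_of_notMem (hpC s hsC), (hC s hsC).2] at h2
    omega

/-- Adding a maximal element with spherical link, of one dimension less. The link avoids the top
dimensional simplices that were taken out, for reasons of dimension, so that the cone over the
collapsible part of the link can be attached to the collapsible part of `A`. -/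
theorem IsSpherical.insert_of_maximal {k m m' : ℕ} {A L : Finset P} {p : P}
    (hA : IsSpherical (k + 1) m A) (hp : p ∉ A) (hmax : ∀ x ∈ A, ¬ p ≤ x)
    (hL : ∀ x, x ∈ L ↔ x ∈ A ∧ x < p) (hLs : IsSpherical k m' L) :
    IsSpherical (k + 1) (m + m') (insert p A) := by
  classical
  obtain ⟨hAk, C, hCm, hC, hcoll⟩ := IsSpherical.iff_decidable.1 hA
  obtain ⟨hLk, D, hDm, hD, hcollL⟩ := IsSpherical.iff_decidable.1 hLs
  have hL' : (A.filter fun x => x ≤ p ∨ p ≤ x) = L := by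
    rw [filter_comparable_of_maximal hp hmax]
    ext x
    simp [hL]
  have hLA : L ⊆ A := fun x hx => ((hL x).1 hx).1
  have hins := chainsIn_insert (A := A) (p := p)
  rw [hL'] at hins
  have hpL : ∀ s ∈ chainsIn L, p ∉ s := fun s hs hps => hp (hLA (hs.2.1 hps))
  have hpA : ∀ s ∈ chainsIn A, p ∉ s := fun s hs hps => hp (hs.2.1 hps)
  have hinj : ∀ s t : Finset P, p ∉ s → p ∉ t → insert p s = insert p t → s = t :=
    fun s t hs ht h => by rw [← Finset.erase_insert hs, h, Finset.erase_insert ht]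
  refine IsSpherical.iff_decidable.2 ⟨?_, C ∪ D.image (insert p), ?_, ?_, ?_⟩
  · rw [hins]
    rintro s (h | rfl | ⟨t, ht, rfl⟩)
    · exact hAk s h
    · simp
    · have := hLk t ht
      have h2 := Finset.card_insert_le p t
      have h3 : (insert p t).card ≤ k + 1 := by omega
      convert h3
  · rw [Finset.card_union_of_disjoint, hCm, Finset.card_image_of_injOn, hDm]
    · intro s hs t ht h
      exact hinj s t (hpL s (hD s hs).1) (hpL t (hD t ht).1) h
    · rw [Finset.disjoint_left]
      intro s hs hs'
      obtain ⟨t, -, rfl⟩ := Finset.mem_image.1 hs'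
      exact hpA _ (hC _ hs).1 (by simp)
  · intro s hs
    rcases Finset.mem_union.1 hs with h | h
    · exact ⟨chainsIn_mono (Finset.subset_insert _ _) (hC s h).1, (hC s h).2⟩
    · obtain ⟨t, ht, rfl⟩ := Finset.mem_image.1 h
      refine ⟨?_, ?_⟩
      · rw [hins]
        exact Or.inr (Or.inr ⟨t, (hD t ht).1, by congr⟩)
      · rw [Finset.card_insert_of_notMem (hpL t (hD t ht).1), (hD t ht).2]
  · have := hcoll.union_cone hcollL (p := p) (fun s hs => ⟨chainsIn_mono hLA hs.1, fun hsC => ?_⟩)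
      (fun s hs => hpA s hs.1)
    · convert this using 1
      rw [hins]
      ext s
      constructor
      · rintro ⟨h | h | ⟨t, ht, h⟩, h'⟩
        · exact Or.inl ⟨h, fun h2 => h' (by simp [Finset.mem_coe.1 h2])⟩
        · exact Or.inr (Or.inl h)
        · replace h : insert p t = s := by convert h
          refine Or.inr (Or.inr ⟨t, ⟨ht, fun htD => h' ?_⟩, h⟩)
          rw [← h]
          exact Finset.mem_coe.2 (Finset.mem_union_right _ (Finset.mem_image_of_mem _ htD))
      · rintro (h | rfl | ⟨t, ht, rfl⟩)
        · refine ⟨Or.inl h.1, fun h2 => ?_⟩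
          rcases Finset.mem_union.1 (Finset.mem_coe.1 h2) with h3 | h3
          · exact h.2 h3
          · obtain ⟨t, -, rfl⟩ := Finset.mem_image.1 h3
            exact hpA _ h.1 (by simp)
        · refine ⟨Or.inr (Or.inl rfl), fun h2 => ?_⟩
          rcases Finset.mem_union.1 (Finset.mem_coe.1 h2) with h3 | h3
          · exact hpA _ (hC _ h3).1 (by simp)
          · obtain ⟨t, htD, h⟩ := Finset.mem_image.1 h3
            obtain ⟨x, hx⟩ := (hD t htD).1.1
            have : x ∈ ({p} : Finset P) := h ▸ Finset.mem_insert_of_mem hx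
            exact hpL t (hD t htD).1 (Finset.mem_singleton.1 this ▸ hx)
        · refine ⟨Or.inr (Or.inr ⟨t, ht.1, by congr⟩), fun h2 => ?_⟩
          rcases Finset.mem_union.1 (Finset.mem_coe.1 h2) with h3 | h3
          · exact hpA _ (hC _ h3).1 (by simp)
          · obtain ⟨t', htD, h⟩ := Finset.mem_image.1 h3
            exact ht.2 (hinj t' t (hpL _ (hD t' htD).1) (hpL t ht.1) h ▸ htD)
    · have h1 := hLk s hs.1
      have h2 := (hC s hsC).2
      omega

/-- Adding an isolated point to a discrete set. -/
theorem IsSpherical.insert_isolated {m : ℕ} {A : Finset P} {p : P} (hA : IsSpherical 1 m A)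
    (hp : p ∉ A) (hinc : ∀ x ∈ A, ¬ (x ≤ p ∨ p ≤ x)) : IsSpherical 1 (m + 1) (insert p A) := by
  classical
  obtain ⟨hAk, C, hCm, hC, hcoll⟩ := IsSpherical.iff_decidable.1 hA
  have hins := chainsIn_insert (A := A) (p := p)
  rw [Finset.filter_eq_empty_iff.2 fun x hx => hinc x hx, chainsIn_empty, Set.image_empty] at hins
  have hpC : ({p} : Finset P) ∉ C := fun h => hp ((hC _ h).1.2.1 (by simp))
  refine IsSpherical.iff_decidable.2 ⟨?_, insert {p} C, ?_, ?_, ?_⟩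
  · rw [hins]
    rintro s (h | rfl | h)
    · exact hAk s h
    · simp
    · exact h.elim
  · rw [Finset.card_insert_of_notMem hpC, hCm]
  · intro s hs
    rw [hins]
    rcases Finset.mem_insert.1 hs with rfl | h
    · exact ⟨Or.inr (Or.inl rfl), by simp⟩
    · exact ⟨Or.inl (hC s h).1, (hC s h).2⟩
  · convert hcoll using 1
    rw [hins]
    ext s
    constructor
    · rintro ⟨h | h | h, h'⟩
      · exact ⟨h, fun h2 => h' (by simp [Finset.mem_coe.1 h2])⟩
      · exact absurd h fun h => h' (by simp [h])
      · exact h.elim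
    · rintro ⟨h, h'⟩
      refine ⟨Or.inl h, fun h2 => ?_⟩
      rcases Finset.mem_insert.1 (Finset.mem_coe.1 h2) with rfl | h3
      · exact hp (h.2.1 (by simp))
      · exact h' h3

theorem IsSpherical.image {Q : Type*} [PartialOrder Q] [DecidableEq Q] {k m : ℕ} {A : Finset P}
    (hA : IsSpherical k m A) (f : P → Q) (hf : ∀ x ∈ A, ∀ y ∈ A, f x ≤ f y ↔ x ≤ y) :
    IsSpherical k m (A.image f) := by
  obtain ⟨hAk, C, hCm, hC, hcoll⟩ := IsSpherical.iff_decidable.1 hA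
  have hinj : Set.InjOn f A := fun x hx y hy h =>
    le_antisymm ((hf x hx y hy).1 h.le) ((hf y hy x hx).1 h.ge)
  have inj : ∀ {s t : Finset P}, s ⊆ A → t ⊆ A → s.image f = t.image f → s = t := by
    intro s t hs ht h
    have := congrArg (fun u : Finset Q => (u : Set Q)) h
    simp only [Finset.coe_image] at this
    exact Finset.coe_injective ((hinj.image_eq_image_iff (by simpa using hs) (by simpa using ht)).1
      this)
  have hchains : chainsIn (A.image f) = Finset.image f '' chainsIn A := by
    ext s
    constructor
    · rintro ⟨hne, hs, hc⟩
      obtain ⟨t, ht, rfl⟩ := Finset.subset_image_iff.1 hs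
      have ht : t ⊆ A := by simpa using ht
      refine ⟨t, ⟨Finset.image_nonempty.1 hne, ht, fun x hx y hy hxy => ?_⟩, rfl⟩
      exact (hc.total (Finset.mem_coe.2 (Finset.mem_image_of_mem f hx))
        (Finset.mem_coe.2 (Finset.mem_image_of_mem f hy))).imp
        (hf x (ht hx) y (ht hy)).1 (hf y (ht hy) x (ht hx)).1
    · rintro ⟨t, ⟨hne, ht, hc⟩, rfl⟩
      refine ⟨hne.image f, Finset.image_subset_image ht, ?_⟩
      rw [Finset.coe_image]
      rintro _ ⟨x, hx, rfl⟩ _ ⟨y, hy, rfl⟩ _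
      exact (hc.total hx hy).imp (hf x (ht hx) y (ht hy)).2 (hf y (ht hy) x (ht hx)).2
  have hcard : ∀ s ⊆ A, (s.image f).card = s.card := fun s hs =>
    Finset.card_image_of_injOn (hinj.mono (by simpa using hs))
  refine IsSpherical.iff_decidable.2 ⟨?_, C.image (Finset.image f), ?_, ?_, ?_⟩
  · rw [hchains]
    rintro _ ⟨t, ht, rfl⟩
    rw [hcard t ht.2.1]
    exact hAk t ht
  · rw [Finset.card_image_of_injOn, hCm]
    exact fun s hs t ht h => inj (hC s hs).1.2.1 (hC t ht).1.2.1 h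
  · intro s hs
    obtain ⟨t, ht, rfl⟩ := Finset.mem_image.1 hs
    rw [hchains, hcard t (hC t ht).1.2.1]
    exact ⟨⟨t, (hC t ht).1, rfl⟩, (hC t ht).2⟩
  · convert hcoll.image (fun s hs => hs.1.2.1) hinj using 1
    rw [hchains]
    ext s
    constructor
    · rintro ⟨⟨t, ht, rfl⟩, h⟩
      exact ⟨t, ⟨ht, fun h2 => h (Finset.mem_coe.2 (Finset.mem_image_of_mem _ h2))⟩, rfl⟩
    · rintro ⟨t, ⟨ht, h⟩, rfl⟩
      refine ⟨⟨t, ht, rfl⟩, fun h2 => h ?_⟩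
      obtain ⟨u, hu, hut⟩ := Finset.mem_image.1 (Finset.mem_coe.1 h2)
      exact inj (hC u hu).1.2.1 ht.2.1 hut ▸ hu

theorem IsSpherical.of_image {Q : Type*} [PartialOrder Q] [DecidableEq Q] {k m : ℕ} {A : Finset P}
    {f : P → Q} (hf : ∀ x ∈ A, ∀ y ∈ A, f x ≤ f y ↔ x ≤ y) (hA : IsSpherical k m (A.image f)) :
    IsSpherical k m A := by
  rcases isEmpty_or_nonempty P with hP | hP
  · obtain rfl : A = ∅ := Subsingleton.elim _ _
    obtain ⟨-, C, -, -, hcoll⟩ := hA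
    rw [Finset.image_empty, chainsIn_empty, Set.empty_sdiff] at hcoll
    generalize hK : (∅ : Set (Finset Q)) = K at hcoll
    cases hcoll with
    | point v => exact absurd hK (Set.singleton_ne_empty _).symm
    | expand => exact absurd hK.symm (Set.insert_nonempty _ _).ne_empty
  have hinj : Set.InjOn f A := fun x hx y hy h =>
    le_antisymm ((hf x hx y hy).1 h.le) ((hf y hy x hx).1 h.ge)
  have hg : ∀ x ∈ A, Function.invFunOn f A (f x) = x := fun x hx => hinj.leftInvOn_invFunOn hx
  have := hA.image (Function.invFunOn f A) (by
    intro x' hx' y' hy'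
    obtain ⟨x, hx, rfl⟩ := Finset.mem_image.1 hx'
    obtain ⟨y, hy, rfl⟩ := Finset.mem_image.1 hy'
    rw [hg x hx, hg y hy, hf x hx y hy])
  convert this
  rw [Finset.image_image]
  ext x
  constructor
  · exact fun hx => Finset.mem_image.2 ⟨x, hx, hg x hx⟩
  · intro hx
    obtain ⟨y, hy, rfl⟩ := Finset.mem_image.1 hx
    simp only [Function.comp_apply, hg y hy, hy]

end Spherical

/-! ### Connected leafless edge sets -/

section EdgeSets

variable {ε α : Type*} [DecidableEq α] (s t : ε → α)

/-- The vertices touched by a set of edges, where the edge `e` runs from `s e` to `t e`. -/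
def edgeVerts (S : Finset ε) : Finset α := S.image s ∪ S.image t

/-- The valence of a vertex with respect to a set of edges; loops count twice. -/
def edgeValence (S : Finset ε) (x : α) : ℕ :=
  (S.filter fun e => s e = x).card + (S.filter fun e => t e = x).card

/-- A set of edges is connected if every property of vertices that is invariant along its edges
holds for all or for none of its vertices. The empty set is included. -/
def EdgeConnected (S : Finset ε) : Prop :=
  ∀ f : α → Prop, (∀ e ∈ S, f (s e) ↔ f (t e)) → ∀ e ∈ S, ∀ e' ∈ S, f (s e) → f (s e')

/-- No vertex has valence one. -/
def Leafless (S : Finset ε) : Prop := ∀ x, edgeValence s t S x ≠ 1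

/-- The edge sets of the connected core graphs: connected, without leaves and non-empty. -/
structure IsCore (S : Finset ε) : Prop where
  nonempty : S.Nonempty
  connected : EdgeConnected s t S
  leafless : Leafless s t S

/-- The number of edges minus the number of vertices. -/
def edgeExcess (S : Finset ε) : ℤ := S.card - (edgeVerts s t S).card

open Classical in
/-- The proper connected core subgraphs of the graph with edge set `E`. -/
noncomputable def properCores (E : Finset ε) : Finset (Finset ε) :=
  E.powerset.filter fun S => S ≠ E ∧ IsCore s t S

variable {s t} {S T E : Finset ε} {a : ε} {x : α}

theorem mem_properCores : S ∈ properCores s t E ↔ S ⊆ E ∧ S ≠ E ∧ IsCore s t S := by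
  simp [properCores]

theorem source_mem_edgeVerts {e : ε} (he : e ∈ S) : s e ∈ edgeVerts s t S :=
  Finset.mem_union_left _ (Finset.mem_image_of_mem s he)

theorem target_mem_edgeVerts {e : ε} (he : e ∈ S) : t e ∈ edgeVerts s t S :=
  Finset.mem_union_right _ (Finset.mem_image_of_mem t he)

theorem mem_edgeVerts : x ∈ edgeVerts s t S ↔ ∃ e ∈ S, s e = x ∨ t e = x := by
  simp only [edgeVerts, Finset.mem_union, Finset.mem_image]
  constructor
  · rintro (⟨e, he, h⟩ | ⟨e, he, h⟩)
    · exact ⟨e, he, Or.inl h⟩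
    · exact ⟨e, he, Or.inr h⟩
  · rintro ⟨e, he, h | h⟩
    · exact Or.inl ⟨e, he, h⟩
    · exact Or.inr ⟨e, he, h⟩

theorem edgeVerts_mono (h : S ⊆ T) : edgeVerts s t S ⊆ edgeVerts s t T :=
  Finset.union_subset_union (Finset.image_subset_image h) (Finset.image_subset_image h)

theorem edgeValence_eq_zero_iff : edgeValence s t S x = 0 ↔ x ∉ edgeVerts s t S := by
  rw [mem_edgeVerts]
  simp only [edgeValence, Nat.add_eq_zero_iff, Finset.card_eq_zero, Finset.filter_eq_empty_iff]
  push Not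
  exact ⟨fun h e he => ⟨h.1 he, h.2 he⟩, fun h => ⟨fun e he => (h e he).1, fun e he => (h e he).2⟩⟩

theorem sum_edgeValence {W : Finset α} (h : edgeVerts s t S ⊆ W) :
    ∑ x ∈ W, edgeValence s t S x = 2 * S.card := by
  unfold edgeValence
  rw [Finset.sum_add_distrib, ← Finset.card_eq_sum_card_fiberwise,
    ← Finset.card_eq_sum_card_fiberwise]
  · omega
  · exact fun e he => h (target_mem_edgeVerts he)
  · exact fun e he => h (source_mem_edgeVerts he)

theorem EdgeConnected.of_mem_edgeVerts (h : EdgeConnected s t S) {f : α → Prop}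
    (hf : ∀ e ∈ S, f (s e) ↔ f (t e)) {x y : α} (hx : x ∈ edgeVerts s t S)
    (hy : y ∈ edgeVerts s t S) (hfx : f x) : f y := by
  obtain ⟨e, he, hex⟩ := mem_edgeVerts.1 hx
  obtain ⟨e', he', hey⟩ := mem_edgeVerts.1 hy
  have h1 : f (s e) := by
    rcases hex with rfl | rfl
    · exact hfx
    · exact (hf e he).2 hfx
  have h2 := h f hf e he e' he' h1
  rcases hey with rfl | rfl
  · exact h2
  · exact (hf e' he').1 h2

theorem Leafless.two_le (h : Leafless s t S) (hx : x ∈ edgeVerts s t S) :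
    2 ≤ edgeValence s t S x := by
  have h1 := h x
  have h2 : edgeValence s t S x ≠ 0 := fun h0 => edgeValence_eq_zero_iff.1 h0 hx
  omega

theorem Leafless.excess_nonneg (h : Leafless s t S) : 0 ≤ edgeExcess s t S := by
  have h1 := sum_edgeValence (s := s) (t := t) (Finset.Subset.refl (edgeVerts s t S))
  have h2 := Finset.card_nsmul_le_sum (edgeVerts s t S) (fun x => edgeValence s t S x) 2
    fun x hx => h.two_le hx
  unfold edgeExcess
  rw [smul_eq_mul] at h2
  omega

theorem edgeVerts_contract (f : α → α) :
    edgeVerts (f ∘ s) (f ∘ t) S = (edgeVerts s t S).image f := by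
  unfold edgeVerts
  rw [Finset.image_union, Finset.image_image, Finset.image_image]

variable [DecidableEq ε]

theorem edgeValence_insert (ha : a ∉ S) : edgeValence s t (insert a S) x =
    edgeValence s t S x + ((if s a = x then 1 else 0) + (if t a = x then 1 else 0)) := by
  unfold edgeValence
  rw [Finset.filter_insert, Finset.filter_insert]
  split_ifs <;> simp [ha] <;> omega

theorem edgeValence_sdiff (h : S ⊆ T) :
    edgeValence s t T x = edgeValence s t S x + edgeValence s t (T \ S) x := by
  have key : ∀ p : ε → Prop, [DecidablePred p] →
      (T.filter p).card = (S.filter p).card + ((T \ S).filter p).card := fun p _ => by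
    rw [← Finset.card_union_of_disjoint
      (Finset.disjoint_filter_filter Finset.disjoint_sdiff), ← Finset.filter_union,
      Finset.union_sdiff_of_subset h]
  unfold edgeValence
  rw [key, key (fun e => t e = x)]
  omega

/-- The excess of a connected core graph exceeds that of every proper non-empty subgraph: the edges
outside the subgraph have at least two ends at each new vertex and at least one end in the
subgraph. -/
theorem IsCore.excess_lt (hS : S.Nonempty) (hT : IsCore s t T) (h : S ⊂ T) :
    edgeExcess s t S < edgeExcess s t T := by
  have hsub := edgeVerts_mono (s := s) (t := t) h.1
  have h1 := sum_edgeValence (s := s) (t := t) (S := T \ S)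
    (edgeVerts_mono (T := T) Finset.sdiff_subset)
  rw [← Finset.sum_sdiff hsub] at h1
  have h2 := Finset.card_nsmul_le_sum (edgeVerts s t T \ edgeVerts s t S)
    (fun x => edgeValence s t (T \ S) x) 2 fun x hx => by
      obtain ⟨hxT, hxS⟩ := Finset.mem_sdiff.1 hx
      have := hT.leafless.two_le hxT
      rw [edgeValence_sdiff h.1, edgeValence_eq_zero_iff.2 hxS] at this
      omega
  obtain ⟨x, hxS, hxD⟩ : ∃ x ∈ edgeVerts s t S, x ∈ edgeVerts s t (T \ S) := by
    by_contra! hcon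
    obtain ⟨e, he⟩ := hS
    obtain ⟨e', he', heS'⟩ := Finset.exists_of_ssubset h
    have := hT.connected (fun x => x ∈ edgeVerts s t S) (fun d hd => ?_) e (h.1 he) e' he'
      (source_mem_edgeVerts he)
    · exact hcon _ this (source_mem_edgeVerts (Finset.mem_sdiff.2 ⟨he', heS'⟩))
    · by_cases hdS : d ∈ S
      · exact ⟨fun _ => target_mem_edgeVerts hdS, fun _ => source_mem_edgeVerts hdS⟩
      · have hd' := Finset.mem_sdiff.2 ⟨hd, hdS⟩
        exact ⟨fun h => absurd (source_mem_edgeVerts hd') (hcon _ h),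
          fun h => absurd (target_mem_edgeVerts hd') (hcon _ h)⟩
  have h3 : 1 ≤ ∑ x ∈ edgeVerts s t S, edgeValence s t (T \ S) x := by
    have h4 := Finset.single_le_sum (f := edgeValence s t (T \ S)) (fun _ _ => Nat.zero_le _) hxS
    have h5 : edgeValence s t (T \ S) x ≠ 0 := fun h0 => edgeValence_eq_zero_iff.1 h0 hxD
    omega
  rw [smul_eq_mul, Finset.card_sdiff_of_subset hsub] at h2
  rw [Finset.card_sdiff_of_subset h.1] at h1
  have h6 := Finset.card_le_card hsub
  have h7 := Finset.card_le_card h.1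
  unfold edgeExcess
  omega

/-- The excess strictly increases along chains of connected core graphs, which bounds their
length. -/
theorem card_le_of_mem_chainsIn_properCores {k : ℕ} (hE : IsCore s t E)
    (hk : edgeExcess s t E = k) {A : Finset (Finset ε)} (hA : A ⊆ properCores s t E) :
    ∀ c ∈ chainsIn A, c.card ≤ k := by
  rintro c ⟨-, hcA, hc⟩
  have hcore : ∀ S ∈ c, IsCore s t S := fun S hS => (mem_properCores.1 (hA (hcA hS))).2.2
  have := Finset.card_le_card_of_injOn (s := c) (t := Finset.Ico (0 : ℤ) k) (edgeExcess s t)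
    (fun S hS => ?_) (fun S hS T hT h => ?_)
  · simpa using this
  · obtain ⟨h1, h2, h3⟩ := mem_properCores.1 (hA (hcA hS))
    rw [Finset.mem_coe, Finset.mem_Ico, ← hk]
    exact ⟨h3.leafless.excess_nonneg, hE.excess_lt h3.nonempty (h1.ssubset_of_ne h2)⟩
  · by_contra hne
    rcases hc hS hT hne with h' | h'
    · exact ((hcore T hT).excess_lt (hcore S hS).nonempty (h'.ssubset_of_ne hne)).ne h
    · exact ((hcore S hS).excess_lt (hcore T hT).nonempty (h'.ssubset_of_ne (Ne.symm hne))).ne' h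

/-- The removal of an edge from a core graph with other edges does not remove any vertex. -/
theorem IsCore.ends_mem_erase (hS : IsCore s t S) (ha : a ∈ S) (hne : (S.erase a).Nonempty) :
    s a ∈ edgeVerts s t (S.erase a) ∧ t a ∈ edgeVerts s t (S.erase a) := by
  have hval : ∀ x, edgeValence s t S x = edgeValence s t (S.erase a) x +
      ((if s a = x then 1 else 0) + (if t a = x then 1 else 0)) := fun x => by
    rw [← edgeValence_insert (Finset.notMem_erase a S), Finset.insert_erase ha]
  by_cases hst : s a = t a
  · rw [← hst, and_self]
    obtain ⟨e, he⟩ := hne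
    refine hS.connected (fun x => x ∈ edgeVerts s t (S.erase a)) (fun d hd => ?_) e
      (Finset.mem_of_mem_erase he) a ha (source_mem_edgeVerts he)
    by_cases hda : d = a
    · rw [hda, hst]
    · have hd' := Finset.mem_erase.2 ⟨hda, hd⟩
      exact ⟨fun _ => target_mem_edgeVerts hd', fun _ => source_mem_edgeVerts hd'⟩
  · constructor <;> by_contra hcon
    · have := hval (s a)
      rw [edgeValence_eq_zero_iff.2 hcon] at this
      exact hS.leafless (s a) (by simpa [Ne.symm hst] using this)
    · have := hval (t a)
      rw [edgeValence_eq_zero_iff.2 hcon] at this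
      exact hS.leafless (t a) (by simpa [hst] using this)

theorem edgeVerts_erase (hS : IsCore s t S) (ha : a ∈ S) (hne : (S.erase a).Nonempty) :
    edgeVerts s t (S.erase a) = edgeVerts s t S := by
  refine (edgeVerts_mono (Finset.erase_subset _ _)).antisymm fun x hx => ?_
  obtain ⟨e, he, hex⟩ := mem_edgeVerts.1 hx
  by_cases hea : e = a
  · subst hea
    rcases hex with rfl | rfl
    · exact (hS.ends_mem_erase he hne).1
    · exact (hS.ends_mem_erase he hne).2
  · exact mem_edgeVerts.2 ⟨e, Finset.mem_erase.2 ⟨hea, he⟩, hex⟩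

theorem edgeExcess_erase (hS : IsCore s t S) (ha : a ∈ S) (hne : (S.erase a).Nonempty) :
    edgeExcess s t (S.erase a) = edgeExcess s t S - 1 := by
  unfold edgeExcess
  rw [edgeVerts_erase hS ha hne, Finset.card_erase_of_mem ha]
  have := Finset.card_pos.2 ⟨a, ha⟩
  omega

theorem IsCore.insert_edge (hS : IsCore s t S) (h1 : s a ∈ edgeVerts s t S)
    (h2 : t a ∈ edgeVerts s t S) : IsCore s t (insert a S) := by
  by_cases ha : a ∈ S
  · rwa [Finset.insert_eq_of_mem ha]
  refine ⟨by simp, fun f hf e he e' he' hfe => ?_, fun x hx => ?_⟩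
  · have key : ∀ d ∈ insert a S, s d ∈ edgeVerts s t S := fun d hd => by
      rcases Finset.mem_insert.1 hd with rfl | hd
      · exact h1
      · exact source_mem_edgeVerts hd
    exact hS.connected.of_mem_edgeVerts (fun d hd => hf d (Finset.mem_insert_of_mem hd))
      (key e he) (key e' he') hfe
  · rw [edgeValence_insert ha] at hx
    by_cases hxS : x ∈ edgeVerts s t S
    · have := hS.leafless.two_le hxS
      omega
    · rw [edgeValence_eq_zero_iff.2 hxS, if_neg (fun h : s a = x => hxS (h ▸ h1)),
        if_neg (fun h : t a = x => hxS (h ▸ h2))] at hx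
      omega

/-! ### Deletion of an edge -/

open Classical in
/-- The proper core subgraphs, other than the complement of the edge `a`, that contain `a` if they
contain both ends of `a`. They correspond to the proper core subgraphs of the graph obtained by
contracting `a`, when `a` is not a loop. -/
noncomputable def closedCores (s t : ε → α) (E : Finset ε) (a : ε) : Finset (Finset ε) :=
  (properCores s t E).filter fun S => S ≠ E.erase a ∧
    (s a ∈ edgeVerts s t S → t a ∈ edgeVerts s t S → a ∈ S)

theorem mem_closedCores : S ∈ closedCores s t E a ↔ S ∈ properCores s t E ∧ S ≠ E.erase a ∧
    (s a ∈ edgeVerts s t S → t a ∈ edgeVerts s t S → a ∈ S) := by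
  simp [closedCores]

/-- Adding `a` is a closure operator on the proper core subgraphs other than the complement of `a`,
so that those which are not closed can be added without changing the homotopy type. -/
theorem isSpherical_erase_of_closedCores {k m : ℕ} (hE : IsCore s t E)
    (hk : edgeExcess s t E = k) (ha : a ∈ E) (hC : IsSpherical k m (closedCores s t E a)) :
    IsSpherical k m ((properCores s t E).erase (E.erase a)) := by
  classical
  set N := (properCores s t E).erase (E.erase a) \ closedCores s t E a with hN
  have hCsub : closedCores s t E a ⊆ (properCores s t E).erase (E.erase a) := fun S hS =>
    Finset.mem_erase.2 ⟨(mem_closedCores.1 hS).2.1, (mem_closedCores.1 hS).1⟩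
  suffices h : ∀ M : Finset (Finset ε), M ⊆ N → IsSpherical k m (M ∪ closedCores s t E a) by
    have := h N (Finset.Subset.refl _)
    rwa [hN, Finset.sdiff_union_of_subset hCsub] at this
  intro M
  -- The sets that are not closed are added in the order of increasing size.
  refine Finset.induction_on_max_value
    (motive := fun M => M ⊆ N → IsSpherical k m (M ∪ closedCores s t E a)) Finset.card M
    (fun _ => by simpa using hC) fun S M hSM hmax ih hsub => ?_
  have hMN : M ⊆ N := fun x hx => hsub (Finset.mem_insert_of_mem hx)
  have hSN : S ∈ N := hsub (Finset.mem_insert_self _ _)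
  obtain ⟨hS1, hS2⟩ := Finset.mem_sdiff.1 hSN
  obtain ⟨hSne, hSP⟩ := Finset.mem_erase.1 hS1
  obtain ⟨hSE, hSE', hScore⟩ := mem_properCores.1 hSP
  have hcl : s a ∈ edgeVerts s t S ∧ t a ∈ edgeVerts s t S ∧ a ∉ S := by
    by_contra! hcon
    exact hS2 (mem_closedCores.2 ⟨hSP, hSne, hcon⟩)
  rw [Finset.insert_union]
  refine (ih hMN).insert_of_min (c := insert a S) ?_ ?_ (Finset.subset_insert _ _) ?_ ?_
  · rw [Finset.mem_union, not_or]
    exact ⟨hSM, hS2⟩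
  · refine Finset.mem_union_right _ (mem_closedCores.2 ⟨mem_properCores.2
      ⟨Finset.insert_subset ha hSE, fun h => hSne ?_, hScore.insert_edge hcl.1 hcl.2.1⟩,
      fun h => ?_, fun _ _ => Finset.mem_insert_self _ _⟩)
    · rw [← h, Finset.erase_insert hcl.2.2]
    · have : a ∈ E.erase a := h ▸ Finset.mem_insert_self _ _
      simp at this
  · intro T hT hST
    rcases Finset.mem_union.1 hT with hTM | hTC
    · have := Finset.eq_of_subset_of_card_le hST (hmax T hTM)
      exact absurd (this ▸ hTM) hSM
    · exact Finset.insert_subset ((mem_closedCores.1 hTC).2.2 (edgeVerts_mono hST hcl.1)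
        (edgeVerts_mono hST hcl.2.1)) hST
  · refine card_le_of_mem_chainsIn_properCores hE hk ?_
    refine Finset.insert_subset hSP (Finset.union_subset (fun x hx => ?_) fun x hx => ?_)
    · exact Finset.mem_of_mem_erase (Finset.mem_sdiff.1 (hMN hx)).1
    · exact (mem_closedCores.1 hx).1

/-- The complement of `a`, if it is a core graph, is a maximal element whose link consists of its
own proper core subgraphs. This link is empty if `k = 0`; then the complement is an isolated
point. -/
theorem isSpherical_properCores_of_erase {k m m' : ℕ} (hE : IsCore s t E)
    (hk : edgeExcess s t E = (k + 1 : ℕ)) (ha : a ∈ E)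
    (hC : IsSpherical (k + 1) m (closedCores s t E a)) (hcore : IsCore s t (E.erase a))
    (hD : 1 ≤ k → IsSpherical k m' (properCores s t (E.erase a))) :
    ∃ m'', (m'' = m' ∨ m'' = 1) ∧ IsSpherical (k + 1) (m + m'') (properCores s t E) := by
  have hP := isSpherical_erase_of_closedCores hE hk ha hC
  have hmem : E.erase a ∈ properCores s t E := mem_properCores.2
    ⟨Finset.erase_subset _ _, (Finset.erase_ssubset ha).ne, hcore⟩
  have hmax : ∀ x ∈ (properCores s t E).erase (E.erase a), ¬ E.erase a ≤ x := fun x hx h => by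
    obtain ⟨hne, hx⟩ := Finset.mem_erase.1 hx
    obtain ⟨h1, h2, -⟩ := mem_properCores.1 hx
    by_cases hax : a ∈ x
    · refine h2 (h1.antisymm ?_)
      rw [← Finset.insert_erase ha]
      exact Finset.insert_subset hax h
    · exact hne (Finset.Subset.antisymm (Finset.subset_erase.2 ⟨h1, hax⟩) h)
  have hlink : ∀ x, x ∈ properCores s t (E.erase a) ↔
      x ∈ (properCores s t E).erase (E.erase a) ∧ x < E.erase a := fun x => by
    rw [Finset.mem_erase, mem_properCores, mem_properCores]
    constructor
    · rintro ⟨h1, h2, h3⟩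
      have h4 := h1.ssubset_of_ne h2
      exact ⟨⟨h2, h1.trans (Finset.erase_subset _ _),
        (h4.trans (Finset.erase_ssubset ha)).ne, h3⟩, h4⟩
    · rintro ⟨⟨-, -, -, h3⟩, h4⟩
      exact ⟨h4.1, h4.ne, h3⟩
  rw [← Finset.insert_erase hmem]
  rcases Nat.eq_zero_or_pos k with rfl | hpos
  · refine ⟨1, Or.inr rfl, hP.insert_isolated (Finset.notMem_erase _ _) ?_⟩
    rintro x hx (h | h)
    · have hlt := lt_of_le_of_ne h (Finset.ne_of_mem_erase hx)
      have hx' := (mem_properCores.1 (Finset.mem_of_mem_erase hx)).2.2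
      have h1 := hcore.excess_lt hx'.nonempty hlt
      have h2 := hx'.leafless.excess_nonneg
      rw [edgeExcess_erase hE ha hcore.nonempty, hk] at h1
      omega
    · exact hmax x hx h
  · exact ⟨m', Or.inl rfl, hP.insert_of_maximal (Finset.notMem_erase _ _) hmax hlink (hD hpos)⟩

theorem isSpherical_properCores_of_not_isCore_erase {k m : ℕ} (hE : IsCore s t E)
    (hk : edgeExcess s t E = k) (ha : a ∈ E) (hC : IsSpherical k m (closedCores s t E a))
    (hcore : ¬ IsCore s t (E.erase a)) : IsSpherical k m (properCores s t E) := by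
  have := isSpherical_erase_of_closedCores hE hk ha hC
  rwa [Finset.erase_eq_of_notMem fun h => hcore (mem_properCores.1 h).2.2] at this

/-! ### Contraction of an edge -/

/-- The map on vertices that identifies `v` with `u`. -/
def contractVertex (u v x : α) : α := if x = v then u else x

section Contraction

variable {u v : α}

theorem edgeValence_contract (huv : u ≠ v) : edgeValence (contractVertex u v ∘ s)
    (contractVertex u v ∘ t) T x = if x = v then 0 else if x = u then
      edgeValence s t T u + edgeValence s t T v else edgeValence s t T x := by
  have key : ∀ r : ε → α, (T.filter fun e => (contractVertex u v ∘ r) e = x).card =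
      if x = v then 0 else if x = u then (T.filter fun e => r e = u).card +
        (T.filter fun e => r e = v).card else (T.filter fun e => r e = x).card := by
    intro r
    split_ifs with h1 h2
    · rw [Finset.card_eq_zero, Finset.filter_eq_empty_iff]
      intro e _ h
      simp only [contractVertex, Function.comp_apply] at h
      split_ifs at h with h3
      · exact huv (h.trans h1)
      · exact h3 (h.trans h1)
    · rw [← Finset.card_union_of_disjoint, ← Finset.filter_or]
      · congr 1
        refine Finset.filter_congr fun e _ => ?_
        simp only [contractVertex, Function.comp_apply, h2]
        split_ifs with h3
        · simp [h3]
        · simp [h3]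
      · rw [Finset.disjoint_filter]
        exact fun e _ h3 h4 => huv (h3.symm.trans h4)
    · congr 1
      refine Finset.filter_congr fun e _ => ?_
      simp only [contractVertex, Function.comp_apply]
      split_ifs with h3
      · simp [h3, Ne.symm h1, Ne.symm h2]
      · rfl
  unfold edgeValence
  rw [key, key]
  split_ifs <;> omega

variable (hst : s a ≠ t a)
include hst

theorem IsCore.erase_nonempty (hS : IsCore s t S) : (S.erase a).Nonempty := by
  by_contra hcon
  rw [Finset.not_nonempty_iff_eq_empty, Finset.erase_eq_empty_iff] at hcon
  rcases hcon with h | h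
  · exact hS.nonempty.ne_empty h
  · refine hS.leafless (s a) ?_
    rw [h, ← insert_empty_eq, edgeValence_insert (Finset.notMem_empty a)]
    simp [edgeValence, Ne.symm hst]

theorem IsCore.contract_of_mem (hS : IsCore s t S) (ha : a ∈ S) :
    IsCore (contractVertex (s a) (t a) ∘ s) (contractVertex (s a) (t a) ∘ t) (S.erase a) := by
  have hne := hS.erase_nonempty hst
  have hends := hS.ends_mem_erase ha hne
  refine ⟨hne, fun f hf e he e' he' => ?_, fun x => ?_⟩
  · refine hS.connected (f ∘ contractVertex (s a) (t a)) (fun d hd => ?_) e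
      (Finset.mem_of_mem_erase he) e' (Finset.mem_of_mem_erase he')
    by_cases hda : d = a
    · simp [hda, contractVertex]
    · exact hf d (Finset.mem_erase.2 ⟨hda, hd⟩)
  · rw [edgeValence_contract hst]
    have h1 : edgeValence s t (S.erase a) (s a) ≠ 0 := fun h => edgeValence_eq_zero_iff.1 h hends.1
    have h2 : edgeValence s t (S.erase a) (t a) ≠ 0 := fun h => edgeValence_eq_zero_iff.1 h hends.2
    split_ifs with h3 h4
    · omega
    · omega
    · have := hS.leafless x
      rw [← Finset.insert_erase ha, edgeValence_insert (Finset.notMem_erase a S),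
        if_neg (Ne.symm h4), if_neg (Ne.symm h3)] at this
      simpa using this

theorem IsCore.contract_of_notMem (hS : IsCore s t S)
    (hends : s a ∉ edgeVerts s t S ∨ t a ∉ edgeVerts s t S) :
    IsCore (contractVertex (s a) (t a) ∘ s) (contractVertex (s a) (t a) ∘ t) S := by
  refine ⟨hS.nonempty, fun f hf e he e' he' => ?_, fun x => ?_⟩
  · exact hS.connected (f ∘ contractVertex (s a) (t a)) hf e he e' he'
  · rw [edgeValence_contract hst]
    have h1 := hS.leafless (s a)
    have h2 := hS.leafless (t a)
    split_ifs
    · omega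
    · rcases hends with h | h
      · rw [edgeValence_eq_zero_iff.2 h]
        omega
      · rw [edgeValence_eq_zero_iff.2 h]
        omega
    · exact hS.leafless x

theorem IsCore.insert_of_contract (haT : a ∉ T) (hT : IsCore (contractVertex (s a) (t a) ∘ s)
      (contractVertex (s a) (t a) ∘ t) T)
    (h1 : s a ∈ edgeVerts s t T) (h2 : t a ∈ edgeVerts s t T) : IsCore s t (insert a T) := by
  refine ⟨by simp, fun f hf e he e' he' hfe => ?_, fun x => ?_⟩
  · have hfa := hf a (Finset.mem_insert_self _ _)
    have hπ : ∀ x, f (contractVertex (s a) (t a) x) ↔ f x := fun x => by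
      unfold contractVertex
      split_ifs with h
      · rw [h, hfa]
      · rfl
    have hmem : ∀ x ∈ edgeVerts s t T, contractVertex (s a) (t a) x ∈
        edgeVerts (contractVertex (s a) (t a) ∘ s) (contractVertex (s a) (t a) ∘ t) T :=
      fun x hx => by
        rw [edgeVerts_contract]
        exact Finset.mem_image_of_mem _ hx
    have key : ∀ d ∈ insert a T, s d ∈ edgeVerts s t T := fun d hd => by
      rcases Finset.mem_insert.1 hd with rfl | hd
      · exact h1
      · exact source_mem_edgeVerts hd
    rw [← hπ] at hfe ⊢
    refine hT.connected.of_mem_edgeVerts (fun d hd => ?_) (hmem _ (key e he)) (hmem _ (key e' he'))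
      hfe
    simp only [Function.comp_apply, hπ]
    exact hf d (Finset.mem_insert_of_mem hd)
  · have h3 : edgeValence s t T (s a) ≠ 0 := fun h => edgeValence_eq_zero_iff.1 h h1
    have h4 : edgeValence s t T (t a) ≠ 0 := fun h => edgeValence_eq_zero_iff.1 h h2
    have h5 := hT.leafless x
    rw [edgeValence_contract hst] at h5
    rw [edgeValence_insert haT]
    by_cases hx1 : x = s a
    · subst hx1
      simp only [if_true]
      omega
    · by_cases hx2 : x = t a
      · subst hx2
        simp only [if_true]
        omega
      · rw [if_neg hx2, if_neg hx1] at h5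
        rwa [if_neg (Ne.symm hx1), if_neg (Ne.symm hx2)]

theorem IsCore.of_contract (hT : IsCore (contractVertex (s a) (t a) ∘ s)
      (contractVertex (s a) (t a) ∘ t) T)
    (hends : s a ∉ edgeVerts s t T ∨ t a ∉ edgeVerts s t T) : IsCore s t T := by
  refine ⟨hT.nonempty, fun f hf e he e' he' hfe => ?_, fun x => ?_⟩
  -- A property of vertices of `T` is transported to the contracted graph. Its value at the merged
  -- vertex is the one at the end of `a` that may belong to `T`.
  · obtain ⟨g, hg⟩ : ∃ g : α → Prop, ∀ x ∈ edgeVerts s t T,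
        g (contractVertex (s a) (t a) x) ↔ f x := by
      rcases hends with h | h
      · refine ⟨fun y => if y = s a then f (t a) else f y, fun x hx => ?_⟩
        have hxs : x ≠ s a := fun h' => h (h' ▸ hx)
        by_cases hxt : x = t a
        · simp [contractVertex, hxt]
        · simp [contractVertex, hxt, hxs]
      · refine ⟨f, fun x hx => ?_⟩
        have hxt : x ≠ t a := fun h' => h (h' ▸ hx)
        simp [contractVertex, hxt]
    have := hT.connected g (fun d hd => ?_) e he e' he' ((hg _ (source_mem_edgeVerts he)).2 hfe)
    · exact (hg _ (source_mem_edgeVerts he')).1 this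
    · exact (hg _ (source_mem_edgeVerts hd)).trans
        ((hf d hd).trans (hg _ (target_mem_edgeVerts hd)).symm)
  · have h5 := hT.leafless x
    have h6 := hT.leafless (s a)
    rw [edgeValence_contract hst] at h5 h6
    rw [if_neg hst, if_pos rfl] at h6
    by_cases hx1 : x = s a
    · rw [hx1]
      rcases hends with h | h
      · rw [edgeValence_eq_zero_iff.2 h]
        omega
      · rw [edgeValence_eq_zero_iff.2 h] at h6
        omega
    · by_cases hx2 : x = t a
      · rw [hx2]
        rcases hends with h | h
        · rw [edgeValence_eq_zero_iff.2 h] at h6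
          omega
        · rw [edgeValence_eq_zero_iff.2 h]
          omega
      · rwa [if_neg hx2, if_neg hx1] at h5

theorem edgeExcess_contract (hE : IsCore s t E) (ha : a ∈ E) :
    edgeExcess (contractVertex (s a) (t a) ∘ s) (contractVertex (s a) (t a) ∘ t) (E.erase a) =
      edgeExcess s t E := by
  have himg : (edgeVerts s t E).image (contractVertex (s a) (t a)) =
      (edgeVerts s t E).erase (t a) := by
    ext x
    rw [Finset.mem_image, Finset.mem_erase]
    constructor
    · rintro ⟨y, hy, rfl⟩
      unfold contractVertex
      split_ifs with h
      · exact ⟨hst, source_mem_edgeVerts ha⟩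
      · exact ⟨h, hy⟩
    · rintro ⟨h1, h2⟩
      exact ⟨x, h2, by simp [contractVertex, h1]⟩
  unfold edgeExcess
  rw [edgeVerts_contract, edgeVerts_erase hE ha (hE.erase_nonempty hst), himg,
    Finset.card_erase_of_mem ha, Finset.card_erase_of_mem (target_mem_edgeVerts ha)]
  have h1 := Finset.card_pos.2 ⟨a, ha⟩
  have h2 := Finset.card_pos.2 ⟨_, target_mem_edgeVerts (s := s) (t := t) ha⟩
  omega

/-- Contraction of `a` maps the closed core subgraphs onto the proper core subgraphs of the
contracted graph; the inverse adds `a` whenever both its ends are present. -/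
theorem image_erase_closedCores (ha : a ∈ E) :
    (closedCores s t E a).image (fun S => S.erase a) =
      properCores (contractVertex (s a) (t a) ∘ s) (contractVertex (s a) (t a) ∘ t)
        (E.erase a) := by
  ext T
  rw [Finset.mem_image, mem_properCores]
  constructor
  · rintro ⟨S, hS, rfl⟩
    obtain ⟨hSP, hSne, hcl⟩ := mem_closedCores.1 hS
    obtain ⟨hSE, hSE', hScore⟩ := mem_properCores.1 hSP
    refine ⟨Finset.erase_subset_erase a hSE, fun h => ?_, ?_⟩
    · by_cases haS : a ∈ S
      · exact hSE' (by rw [← Finset.insert_erase haS, h, Finset.insert_erase ha])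
      · exact hSne (by rw [← h, Finset.erase_eq_of_notMem haS])
    · by_cases haS : a ∈ S
      · exact hScore.contract_of_mem hst haS
      · rw [Finset.erase_eq_of_notMem haS]
        refine hScore.contract_of_notMem hst ?_
        by_contra! hcon
        exact haS (hcl hcon.1 hcon.2)
  · rintro ⟨hTE, hTne, hT⟩
    have haT : a ∉ T := fun h => Finset.notMem_erase a E (hTE h)
    have hTE' : T ⊆ E := hTE.trans (Finset.erase_subset _ _)
    by_cases hends : s a ∈ edgeVerts s t T ∧ t a ∈ edgeVerts s t T
    · refine ⟨insert a T, mem_closedCores.2 ⟨mem_properCores.2 ⟨Finset.insert_subset ha hTE',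
        fun h => hTne ?_, IsCore.insert_of_contract hst haT hT hends.1 hends.2⟩, fun h => ?_,
        fun _ _ => Finset.mem_insert_self _ _⟩, Finset.erase_insert haT⟩
      · rw [← h, Finset.erase_insert haT]
      · exact Finset.notMem_erase a E (h ▸ Finset.mem_insert_self a T)
    · refine ⟨T, mem_closedCores.2 ⟨mem_properCores.2 ⟨hTE', fun h => haT (h ▸ ha),
        IsCore.of_contract hst hT (by tauto)⟩, hTne, fun h1 h2 => absurd ⟨h1, h2⟩ hends⟩,
        Finset.erase_eq_of_notMem haT⟩

theorem erase_le_erase_iff_of_closedCores {S T : Finset ε} (hS : S ∈ closedCores s t E a)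
    (hT : T ∈ closedCores s t E a) : S.erase a ≤ T.erase a ↔ S ≤ T := by
  refine ⟨fun h => ?_, fun h => Finset.erase_subset_erase a h⟩
  have h' : S.erase a ⊆ T := Finset.Subset.trans h (Finset.erase_subset _ _)
  by_cases haS : a ∈ S
  · have hScore := (mem_properCores.1 (mem_closedCores.1 hS).1).2.2
    have hends := hScore.ends_mem_erase haS (hScore.erase_nonempty hst)
    have haT := (mem_closedCores.1 hT).2.2 (edgeVerts_mono h' hends.1) (edgeVerts_mono h' hends.2)
    have : insert a (S.erase a) ⊆ T := Finset.insert_subset haT h'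
    rwa [Finset.insert_erase haS] at this
  · rwa [Finset.erase_eq_of_notMem haS] at h'

end Contraction

/-! ### The complex of proper core subgraphs -/

/-- When all edges are loops, at the same vertex, the closed subgraphs form a cone with apex
`{a}`. -/
theorem isSpherical_closedCores_of_loops {k : ℕ} (hE : IsCore s t E)
    (hk : edgeExcess s t E = (k + 1 : ℕ)) (hloop : ∀ e ∈ E, s e = t e) (ha : a ∈ E) :
    IsSpherical (k + 1) 0 (closedCores s t E a) ∧ IsCore s t (E.erase a) := by
  have hall : ∀ e ∈ E, s e = s a := fun e he =>
    hE.connected (fun x => x = s a) (fun d hd => by rw [hloop d hd]) a ha e he rfl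
  have hcore : ∀ S ⊆ E, S.Nonempty → IsCore s t S := fun S hS hne => by
    refine ⟨hne, fun f _ e he e' he' hf => ?_, fun x hx => ?_⟩
    · rwa [hall e' (hS he'), ← hall e (hS he)]
    · have : (S.filter fun e => t e = x) = S.filter fun e => s e = x :=
        Finset.filter_congr fun e he => by rw [hloop e (hS he)]
      rw [edgeValence, this] at hx
      omega
  have hverts : edgeVerts s t E = {s a} := by
    ext x
    rw [mem_edgeVerts, Finset.mem_singleton]
    constructor
    · rintro ⟨e, he, rfl | rfl⟩
      · exact hall e he
      · rw [← hloop e he, hall e he]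
    · rintro rfl
      exact ⟨a, ha, Or.inl rfl⟩
  have hcard : 2 ≤ E.card := by
    unfold edgeExcess at hk
    rw [hverts, Finset.card_singleton] at hk
    omega
  have hne : (E.erase a).Nonempty := by
    rw [← Finset.card_pos, Finset.card_erase_of_mem ha]
    omega
  refine ⟨isSpherical_of_comparable (c := {a}) (mem_closedCores.2 ⟨mem_properCores.2
    ⟨by simpa using ha, fun h => ?_, hcore _ (by simpa using ha) (by simp)⟩, fun h => ?_,
    fun _ _ => by simp⟩) (fun S hS => Or.inr ?_) ?_, hcore _ (Finset.erase_subset _ _) hne⟩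
  · rw [← h] at hcard
    simp at hcard
  · exact Finset.notMem_erase a E (h ▸ Finset.mem_singleton_self a)
  · obtain ⟨hSP, -, hcl⟩ := mem_closedCores.1 hS
    obtain ⟨hSE, -, hScore⟩ := mem_properCores.1 hSP
    obtain ⟨e, he⟩ := hScore.nonempty
    have h1 : s a ∈ edgeVerts s t S := hall e (hSE he) ▸ source_mem_edgeVerts he
    exact Finset.singleton_subset_iff.2 (hcl h1 (hloop a ha ▸ h1))
  · exact card_le_of_mem_chainsIn_properCores hE hk fun x hx => (mem_closedCores.1 hx).1

/-- The proper core subgraphs of a connected core graph of rank `k + 2` form a poset of dimension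
`k`, with a positive number of spheres, by deletion and contraction of an edge. -/
theorem exists_isSpherical_properCores (N : ℕ) : ∀ (s t : ε → α) (E : Finset ε) (k : ℕ),
    E.card = N → IsCore s t E → edgeExcess s t E = (k + 1 : ℕ) →
    ∃ m, 1 ≤ m ∧ IsSpherical (k + 1) m (properCores s t E) := by
  induction N using Nat.strong_induction_on with
  | _ N ih =>
    intro s t E k hN hE hk
    obtain ⟨a, ha, m, hC, hm⟩ : ∃ a ∈ E, ∃ m, IsSpherical (k + 1) m (closedCores s t E a) ∧
        (1 ≤ m ∨ IsCore s t (E.erase a)) := by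
      by_cases hloop : ∀ e ∈ E, s e = t e
      · obtain ⟨a, ha⟩ := hE.nonempty
        have h := isSpherical_closedCores_of_loops hE hk hloop ha
        exact ⟨a, ha, 0, h.1, Or.inr h.2⟩
      · push Not at hloop
        obtain ⟨a, ha, hst⟩ := hloop
        obtain ⟨m, hm, h⟩ := ih (E.erase a).card (hN ▸ Finset.card_erase_lt_of_mem ha) _ _
          (E.erase a) k rfl (hE.contract_of_mem hst ha) ((edgeExcess_contract hst hE ha).trans hk)
        rw [← image_erase_closedCores hst ha] at h
        exact ⟨a, ha, m, h.of_image fun S hS T hT => erase_le_erase_iff_of_closedCores hst hS hT,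
          Or.inl hm⟩
    -- If the contraction has contributed no sphere, the complement of `a` provides one.
    by_cases hcore : IsCore s t (E.erase a)
    · have hex := edgeExcess_erase hE ha hcore.nonempty
      obtain ⟨m', hm', hD⟩ : ∃ m', 1 ≤ m' ∧
          (1 ≤ k → IsSpherical k m' (properCores s t (E.erase a))) := by
        rcases k with _ | k
        · exact ⟨1, le_rfl, fun h => absurd h (by omega)⟩
        · obtain ⟨m', h1, h2⟩ := ih (E.erase a).card (hN ▸ Finset.card_erase_lt_of_mem ha) s t
            (E.erase a) k rfl hcore (by rw [hex, hk]; push_cast; ring)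
          exact ⟨m', h1, fun _ => h2⟩
      obtain ⟨m'', h1, h2⟩ := isSpherical_properCores_of_erase hE hk ha hC hcore hD
      exact ⟨m + m'', by omega, h2⟩
    · exact ⟨m, hm.resolve_right hcore,
        isSpherical_properCores_of_not_isCore_erase hE hk ha hC hcore⟩

end EdgeSets

/-! ### The core of an edge set -/

section Core

variable {ε α : Type*} [DecidableEq ε] [DecidableEq α] (s t : ε → α)

open Classical in
/-- The core of a set of edges: its largest leafless subset. -/
noncomputable def edgeCore (S : Finset ε) : Finset ε :=
  (S.powerset.filter fun T => Leafless s t T).biUnion id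

variable {s t} {S T : Finset ε}

theorem mem_edgeCore {e : ε} : e ∈ edgeCore s t S ↔ ∃ T ⊆ S, Leafless s t T ∧ e ∈ T := by
  simp [edgeCore, and_assoc]

theorem edgeCore_subset : edgeCore s t S ⊆ S := fun e he => by
  obtain ⟨T, hT, -, heT⟩ := mem_edgeCore.1 he
  exact hT heT

theorem subset_edgeCore (hTS : T ⊆ S) (hT : Leafless s t T) : T ⊆ edgeCore s t S :=
  fun _ he => mem_edgeCore.2 ⟨T, hTS, hT, he⟩

theorem edgeCore_mono (h : S ⊆ T) : edgeCore s t S ⊆ edgeCore s t T := fun e he => by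
  obtain ⟨U, hU, hU', heU⟩ := mem_edgeCore.1 he
  exact mem_edgeCore.2 ⟨U, hU.trans h, hU', heU⟩

theorem edgeValence_mono (h : S ⊆ T) (x : α) : edgeValence s t S x ≤ edgeValence s t T x := by
  rw [edgeValence_sdiff h]
  omega

theorem leafless_edgeCore : Leafless s t (edgeCore s t S) := fun x hx => by
  have hmem : x ∈ edgeVerts s t (edgeCore s t S) := by
    by_contra h
    rw [edgeValence_eq_zero_iff.2 h] at hx
    exact zero_ne_one hx
  obtain ⟨e, he, hex⟩ := mem_edgeVerts.1 hmem
  obtain ⟨T, hTS, hT, heT⟩ := mem_edgeCore.1 he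
  have h1 := hT.two_le (mem_edgeVerts.2 ⟨e, heT, hex⟩)
  have h2 := edgeValence_mono (s := s) (t := t) (subset_edgeCore hTS hT) x
  omega

theorem edgeCore_eq_self (hS : Leafless s t S) : edgeCore s t S = S :=
  edgeCore_subset.antisymm (subset_edgeCore (Finset.Subset.refl S) hS)

/-- A leaf: an end `x` of an edge `e` that no other edge touches. -/
theorem exists_leaf (hS : ¬ Leafless s t S) : ∃ e ∈ S, ∃ x, x ∉ edgeVerts s t (S.erase e) ∧
    (s e = x ∧ t e ≠ x ∨ t e = x ∧ s e ≠ x) := by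
  unfold Leafless at hS
  push Not at hS
  obtain ⟨x, hx⟩ := hS
  have hmem : x ∈ edgeVerts s t S := by
    by_contra h
    rw [edgeValence_eq_zero_iff.2 h] at hx
    exact zero_ne_one hx
  obtain ⟨e, he, hex⟩ := mem_edgeVerts.1 hmem
  refine ⟨e, he, x, ?_⟩
  rw [← Finset.insert_erase he, edgeValence_insert (Finset.notMem_erase e S)] at hx
  rw [← edgeValence_eq_zero_iff]
  by_cases h1 : s e = x <;> by_cases h2 : t e = x <;> simp [h1, h2] at hx hex ⊢ <;> omega

theorem EdgeConnected.erase_leaf (hS : EdgeConnected s t S) {e : ε} {x : α}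
    (hx : x ∉ edgeVerts s t (S.erase e)) (hex : s e = x ∧ t e ≠ x ∨ t e = x ∧ s e ≠ x) :
    EdgeConnected s t (S.erase e) := by
  intro f hf d hd d' hd' hfd
  -- The property `f` is changed at the leaf so that it becomes invariant along `e`.
  obtain ⟨g, hg, hge⟩ : ∃ g : α → Prop, (∀ y, y ≠ x → g y = f y) ∧ g (s e) = g (t e) := by
    rcases hex with ⟨h1, h2⟩ | ⟨h1, h2⟩
    · exact ⟨Function.update f x (f (t e)), fun y hy => by simp [hy], by simp [h1, h2]⟩
    · exact ⟨Function.update f x (f (s e)), fun y hy => by simp [hy], by simp [h1, h2]⟩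
  have hs : ∀ c ∈ S.erase e, g (s c) = f (s c) := fun c hc =>
    hg _ fun h => hx (h ▸ source_mem_edgeVerts hc)
  have ht : ∀ c ∈ S.erase e, g (t c) = f (t c) := fun c hc =>
    hg _ fun h => hx (h ▸ target_mem_edgeVerts hc)
  rw [← hs d' hd']
  refine hS g (fun c hc => ?_) d (Finset.mem_of_mem_erase hd) d' (Finset.mem_of_mem_erase hd')
    ((hs d hd).symm ▸ hfd)
  by_cases hce : c = e
  · rw [hce, hge]
  · have hc' := Finset.mem_erase.2 ⟨hce, hc⟩
    rw [hs c hc', ht c hc']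
    exact hf c hc'

theorem Leafless.subset_erase_leaf (hT : Leafless s t T) (hTS : T ⊆ S) {e : ε} {x : α}
    (hx : x ∉ edgeVerts s t (S.erase e)) (hex : s e = x ∧ t e ≠ x ∨ t e = x ∧ s e ≠ x) :
    T ⊆ S.erase e := by
  refine Finset.subset_erase.2 ⟨hTS, fun he => hT x ?_⟩
  have h1 : x ∉ edgeVerts s t (T.erase e) := fun h =>
    hx (edgeVerts_mono (Finset.erase_subset_erase e hTS) h)
  rw [← Finset.insert_erase he, edgeValence_insert (Finset.notMem_erase e T),
    edgeValence_eq_zero_iff.2 h1]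
  rcases hex with ⟨h1, h2⟩ | ⟨h1, h2⟩ <;> simp [h1, h2]

theorem EdgeConnected.edgeCore (hS : EdgeConnected s t S) :
    EdgeConnected s t (edgeCore s t S) := by
  induction S using Finset.strongInduction with
  | H S ih =>
    by_cases hl : Leafless s t S
    · rwa [edgeCore_eq_self hl]
    · obtain ⟨e, he, x, hx, hex⟩ := exists_leaf hl
      have : _root_.edgeCore s t S = _root_.edgeCore s t (S.erase e) :=
        (subset_edgeCore (leafless_edgeCore.subset_erase_leaf edgeCore_subset hx hex)
          leafless_edgeCore).antisymm (edgeCore_mono (Finset.erase_subset _ _))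
      rw [this]
      exact ih _ (Finset.erase_ssubset he) (hS.erase_leaf hx hex)

/-- On a forest, every labelling of the edges by elements of a group is the coboundary of a function
on the vertices. -/
theorem exists_coboundary_of_edgeCore_eq_empty {A : Type*} [Group A] (lab : ε → A)
    (hS : edgeCore s t S = ∅) : ∃ c : α → A, ∀ e ∈ S, lab e = (c (s e))⁻¹ * c (t e) := by
  induction S using Finset.strongInduction with
  | H S ih =>
    rcases S.eq_empty_or_nonempty with rfl | hne
    · exact ⟨1, by simp⟩
    · have hl : ¬ Leafless s t S := fun h => hne.ne_empty ((edgeCore_eq_self h).symm.trans hS)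
      obtain ⟨e, he, x, hx, hex⟩ := exists_leaf hl
      obtain ⟨c, hc⟩ := ih _ (Finset.erase_ssubset he) (Finset.subset_empty.1
        (hS ▸ edgeCore_mono (Finset.erase_subset e S)))
      obtain ⟨g, hg, hge⟩ : ∃ g : α → A, (∀ y, y ≠ x → g y = c y) ∧
          lab e = (g (s e))⁻¹ * g (t e) := by
        rcases hex with ⟨h1, h2⟩ | ⟨h1, h2⟩
        · exact ⟨Function.update c x (c (t e) * (lab e)⁻¹), fun y hy => by simp [hy],
            by simp [h1, h2]⟩
        · exact ⟨Function.update c x (c (s e) * lab e), fun y hy => by simp [hy],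
            by simp [h1, h2]⟩
      refine ⟨g, fun d hd => ?_⟩
      by_cases hde : d = e
      · rw [hde, hge]
      · have hd' := Finset.mem_erase.2 ⟨hde, hd⟩
        rw [hg _ fun h => hx (h ▸ source_mem_edgeVerts hd'),
          hg _ fun h => hx (h ▸ target_mem_edgeVerts hd')]
        exact hc d hd'

end Core

/-! ### Fundamental groups of graphs -/

section FreeGroupoid

open CategoryTheory

universe w

variable {V : Type*} [Quiver V] {A : Type w} [Group A]

theorem exists_functor_of_labelling (lab : ∀ {x y : V}, (x ⟶ y) → A) :
    ∃ F : Quiver.FreeGroupoid V ⥤ SingleObj A,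
      ∀ {x y : V} (e : x ⟶ y), F.map ((Quiver.FreeGroupoid.of V).map e) = lab e := by
  let φ : V ⥤q SingleObj A := { obj := fun _ => SingleObj.star A, map := fun e => lab e }
  refine ⟨Quiver.FreeGroupoid.lift φ, fun {x y} e => ?_⟩
  exact congrArg (fun ψ : V ⥤q SingleObj A => (show A from ψ.map e))
    (Quiver.FreeGroupoid.lift_spec φ)

theorem functor_ext_of_labelling {F F' : Quiver.FreeGroupoid V ⥤ SingleObj A}
    (h : ∀ {x y : V} (e : x ⟶ y), (show A from F.map ((Quiver.FreeGroupoid.of V).map e)) =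
      (show A from F'.map ((Quiver.FreeGroupoid.of V).map e))) : F = F' := by
  rw [Quiver.FreeGroupoid.lift_unique _ F rfl, Quiver.FreeGroupoid.lift_unique _ F' rfl]
  congr 1
  refine Prefunctor.ext (fun _ => rfl) fun x y e => ?_
  exact h e

/-- The functor to a group determined by a homomorphism on the vertex group at `v` and by the values
`c` on chosen morphisms `p` from `v` to all objects. -/
noncomputable def functorOfHom {𝒢 : Type*} [Groupoid 𝒢] {v : 𝒢} (p : ∀ x, v ⟶ x)
    (φ : End v →* A) (c : 𝒢 → A) : 𝒢 ⥤ SingleObj A where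
  obj _ := SingleObj.star A
  map {x y} g := c y * φ (p x ≫ g ≫ inv (p y)) * (c x)⁻¹
  map_id x := by
    have : (p x ≫ 𝟙 x ≫ inv (p x) : End v) = 1 := by simp
    rw [this, map_one, mul_one, mul_inv_cancel]
    rfl
  map_comp {x y z} f g := by
    have : (p x ≫ (f ≫ g) ≫ inv (p z) : End v) =
        (show End v from p y ≫ g ≫ inv (p z)) * (show End v from p x ≫ f ≫ inv (p y)) := by
      change p x ≫ (f ≫ g) ≫ inv (p z) = (p x ≫ f ≫ inv (p y)) ≫ p y ≫ g ≫ inv (p z)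
      simp
    rw [this, map_mul, SingleObj.comp_as_mul]
    generalize φ (show End v from p y ≫ g ≫ inv (p z)) = a
    generalize φ (show End v from p x ≫ f ≫ inv (p y)) = b
    change c z * (a * b) * (c x)⁻¹ = (c z * a * (c y)⁻¹) * (c y * b * (c x)⁻¹)
    group

/-- The restriction of a functor to a vertex group. -/
def homOfFunctor {𝒢 : Type*} [Groupoid 𝒢] (F : 𝒢 ⥤ SingleObj A) (v : 𝒢) : End v →* A where
  toFun g := F.map g
  map_one' := F.map_id v
  map_mul' f g := F.map_comp g f

theorem functorOfHom_homOfFunctor {𝒢 : Type*} [Groupoid 𝒢] {v : 𝒢} (p : ∀ x, v ⟶ x)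
    (F : 𝒢 ⥤ SingleObj A) {x y : 𝒢} (g : x ⟶ y) :
    (show A from (functorOfHom p (homOfFunctor F v) fun x => F.map (p x)).map g) = F.map g := by
  have h : F.map g = inv (F.map (p x)) ≫ F.map (p x ≫ g ≫ inv (p y)) ≫ F.map (p y) := by
    simp
  refine Eq.trans ?_ h.symm
  rw [SingleObj.comp_as_mul, SingleObj.comp_as_mul, SingleObj.inv_as_inv]
  rfl

theorem homOfFunctor_functorOfHom {𝒢 : Type*} [Groupoid 𝒢] {v : 𝒢} (p : ∀ x, v ⟶ x)
    (hp : p v = 𝟙 v) (φ : End v →* A) (c : 𝒢 → A) (hc : c v = 1) :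
    homOfFunctor (functorOfHom p φ c) v = φ := by
  ext g
  change c v * φ (p v ≫ g ≫ inv (p v)) * (c v)⁻¹ = φ g
  rw [hc, hp]
  simp

theorem functorOfHom_map_base {𝒢 : Type*} [Groupoid 𝒢] {v : 𝒢} (p : ∀ x, v ⟶ x)
    (hp : p v = 𝟙 v) (φ : End v →* A) (c : 𝒢 → A) (hc : c v = 1) (x : 𝒢) :
    (show A from (functorOfHom p φ c).map (p x)) = c x := by
  change c x * φ (p v ≫ p x ≫ inv (p x)) * (c v)⁻¹ = c x
  have : (p v ≫ p x ≫ inv (p x) : End v) = 1 := by simp [hp]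
  rw [hc, this, map_one]
  simp

end FreeGroupoid

namespace Graph

open CategoryTheory

variable {α β : Type*} {H : Graph α β}

/-- The object of the fundamental groupoid given by a vertex. -/
noncomputable abbrev groupoidObj (H : Graph α β) (x : V(H)) : H.FundamentalGroupoid :=
  (Quiver.FreeGroupoid.of V(H)).obj x

/-- The vertex underlying an object of the fundamental groupoid. -/
def vertexOf {H : Graph α β} (x : H.FundamentalGroupoid) : V(H) := x.as

theorem groupoidObj_vertexOf (x : H.FundamentalGroupoid) : H.groupoidObj (vertexOf x) = x := rfl

/-- The source of an edge, as a vertex. -/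
noncomputable def sourceVertex (H : Graph α β) (e : E(H)) : V(H) :=
  ⟨H.edgeSource e, (H.isLink_edgeSource_edgeTarget e).left_mem⟩

/-- The target of an edge, as a vertex. -/
noncomputable def targetVertex (H : Graph α β) (e : E(H)) : V(H) :=
  ⟨H.edgeTarget e, (H.isLink_edgeSource_edgeTarget e).right_mem⟩

/-- The arrow of the quiver of a graph given by an edge. -/
noncomputable def edgeArrow (H : Graph α β) (e : E(H)) : H.sourceVertex e ⟶ H.targetVertex e :=
  ⟨e, rfl, rfl⟩

/-- The morphism of the fundamental groupoid given by an edge. -/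
noncomputable def edgeHom (H : Graph α β) (e : E(H)) :
    H.groupoidObj (H.sourceVertex e) ⟶ H.groupoidObj (H.targetVertex e) :=
  (Quiver.FreeGroupoid.of V(H)).map (H.edgeArrow e)

theorem arrow_induction {motive : ∀ {x y : V(H)}, (x ⟶ y) → Prop}
    (h : ∀ e, motive (H.edgeArrow e)) {x y : V(H)} (f : x ⟶ y) : motive f := by
  obtain ⟨e, h1, h2⟩ := f
  obtain rfl : H.sourceVertex e = x := Subtype.ext h1
  obtain rfl : H.targetVertex e = y := Subtype.ext h2
  exact h e

theorem exists_functor {A : Type*} [Group A] (lab : E(H) → A) :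
    ∃ F : H.FundamentalGroupoid ⥤ SingleObj A, ∀ e, (show A from F.map (H.edgeHom e)) = lab e := by
  obtain ⟨F, hF⟩ := exists_functor_of_labelling (V := V(H)) (A := A)
    fun {x y} (f : {e : E(H) // H.edgeSource e = x ∧ H.edgeTarget e = y}) => lab f.1
  exact ⟨F, fun e => hF (H.edgeArrow e)⟩

theorem functor_ext {A : Type*} [Group A] {F F' : H.FundamentalGroupoid ⥤ SingleObj A}
    (h : ∀ e, (show A from F.map (H.edgeHom e)) = (show A from F'.map (H.edgeHom e))) : F = F' :=
  functor_ext_of_labelling fun f => arrow_induction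
    (motive := fun f => (show A from F.map ((Quiver.FreeGroupoid.of V(H)).map f)) =
      (show A from F'.map ((Quiver.FreeGroupoid.of V(H)).map f))) h f

theorem IsConnected.nonempty_hom (hH : H.IsConnected) (x y : V(H)) :
    Nonempty (H.groupoidObj x ⟶ H.groupoidObj y) := by
  have key : ∀ b, Relation.ReflTransGen H.Adj x.1 b → ∃ hb : b ∈ V(H),
      Nonempty (H.groupoidObj x ⟶ H.groupoidObj ⟨b, hb⟩) := by
    intro b hb
    induction hb with
    | refl => exact ⟨x.2, ⟨𝟙 _⟩⟩
    | @tail b c _ hbc ih =>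
      obtain ⟨hb, ⟨g⟩⟩ := ih
      obtain ⟨e, he⟩ := hbc
      refine ⟨he.right_mem, ⟨g ≫ Nonempty.some ?_⟩⟩
      have f := H.edgeHom ⟨e, he.edge_mem⟩
      unfold sourceVertex targetVertex at f
      rcases (H.isLink_edgeSource_edgeTarget ⟨e, he.edge_mem⟩).eq_and_eq_or_eq_and_eq he with h | h
      · simp only [h.1, h.2] at f
        exact ⟨f⟩
      · simp only [h.1, h.2] at f
        exact ⟨inv f⟩
  exact (key y.1 (hH.2 x.1 x.2 y.1 y.2)).2

/-- In a connected graph, there is a choice of morphisms from a base vertex to all vertices. -/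
theorem IsConnected.exists_homs (hH : H.IsConnected) (v : V(H)) :
    ∃ p : ∀ x : H.FundamentalGroupoid, H.groupoidObj v ⟶ x, p (H.groupoidObj v) = 𝟙 _ := by
  classical
  refine ⟨fun x => if h : H.groupoidObj v = x then eqToHom h else
    (hH.nonempty_hom v (vertexOf x)).some, by simp⟩

/-- Counting functors from the fundamental groupoid to a finite group: they correspond to the
labellings of the edges, and to pairs of a homomorphism on the fundamental group and a labelling of
the vertices other than the base point. -/
theorem IsConnected.card_pow (hH : H.IsConnected) [Finite V(H)] [Finite E(H)] (v : V(H))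
    (A : Type*) [Group A] :
    Nat.card A ^ Nat.card E(H) =
      Nat.card (H.FundamentalGroup v →* A) * Nat.card A ^ (Nat.card V(H) - 1) := by
  classical
  obtain ⟨p, hp⟩ := hH.exists_homs v
  choose F hF using fun lab : E(H) → A => exists_functor lab
  let Φ : (E(H) → A) → (H.FundamentalGroup v →* A) × ({x : V(H) // x ≠ v} → A) := fun lab =>
    (homOfFunctor (F lab) _, fun x => (F lab).map (p (H.groupoidObj x)))
  have hΦ : Function.Bijective Φ := by
    constructor
    · intro lab lab' h
      obtain ⟨h1, h2⟩ := Prod.ext_iff.1 h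
      have h3 : (fun x => (show A from (F lab).map (p x))) = fun x => (F lab').map (p x) := by
        funext x
        by_cases hx : vertexOf x = v
        · obtain rfl : x = H.groupoidObj v := by rw [← hx, groupoidObj_vertexOf]
          rw [hp]
          exact ((F lab).map_id _).trans ((F lab').map_id _).symm
        · exact congrFun h2 ⟨vertexOf x, hx⟩
      ext e
      rw [← hF lab e, ← hF lab' e]
      have h4 := functorOfHom_homOfFunctor p (F lab) (H.edgeHom e)
      have h5 := functorOfHom_homOfFunctor p (F lab') (H.edgeHom e)
      rw [← h4, ← h5]
      change homOfFunctor (F lab) _ = homOfFunctor (F lab') _ at h1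
      rw [h1, h3]
    · rintro ⟨φ, c⟩
      let c' : H.FundamentalGroupoid → A := fun x =>
        if h : vertexOf x = v then 1 else c ⟨vertexOf x, h⟩
      have hc' : c' (H.groupoidObj v) = 1 := dif_pos rfl
      refine ⟨fun e => (functorOfHom p φ c').map (H.edgeHom e), ?_⟩
      have hFG : F (fun e => (functorOfHom p φ c').map (H.edgeHom e)) = functorOfHom p φ c' :=
        functor_ext fun e => hF _ e
      refine Prod.ext ?_ (funext fun x => ?_)
      · change homOfFunctor (F _) _ = φ
        rw [hFG, homOfFunctor_functorOfHom p hp φ c' hc']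
      · change (show A from (F _).map (p (H.groupoidObj x))) = c x
        rw [hFG]
        exact (functorOfHom_map_base p hp φ c' hc' _).trans (dif_neg x.2)
  have := Nat.card_congr (Equiv.ofBijective Φ hΦ)
  have := Fintype.ofFinite V(H)
  have := Fintype.ofFinite E(H)
  have hV : Nat.card {x : V(H) // x ≠ v} = Nat.card V(H) - 1 := by
    rw [Nat.card_eq_fintype_card, Nat.card_eq_fintype_card, Fintype.card_subtype_compl,
      Fintype.card_subtype_eq]
  rw [← hV, ← Nat.card_fun, ← Nat.card_fun, ← Nat.card_prod]
  assumption

theorem card_multiplicative_zmod_two : Nat.card (Multiplicative (ZMod 2)) = 2 := by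
  rw [Nat.card_congr Multiplicative.toAdd, Nat.card_zmod]

/-- The rank of the fundamental group is one plus the number of edges minus that of vertices. It is
read off from the number of homomorphisms to a group with two elements. -/
theorem IsConnected.card_of_hasRank (hH : H.IsConnected) [Finite V(H)] [Finite E(H)] {n : ℕ}
    (hn : H.HasRank n) : Nat.card E(H) + 1 = n + Nat.card V(H) := by
  obtain ⟨v, ⟨f⟩⟩ := hn
  have h := hH.card_pow v (Multiplicative (ZMod 2))
  have h1 : Nat.card (H.FundamentalGroup v →* Multiplicative (ZMod 2)) = 2 ^ n := by
    rw [Nat.card_congr (f.monoidHomCongrLeftEquiv.trans FreeGroup.lift.symm), Nat.card_fun,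
      card_multiplicative_zmod_two, Nat.card_fin]
  rw [h1, card_multiplicative_zmod_two, ← pow_add] at h
  have h2 := Nat.pow_right_injective le_rfl h
  have : Nonempty V(H) := ⟨v⟩
  have h3 : 0 < Nat.card V(H) := Nat.card_pos
  omega

/-- If the fundamental group is trivial, counting functors to a group with two elements shows that
there is one edge less than there are vertices. -/
theorem IsConnected.nontrivial_fundamentalGroup (hH : H.IsConnected) [Finite V(H)] [Finite E(H)]
    (hcard : Nat.card V(H) ≤ Nat.card E(H)) (v : V(H)) : Nontrivial (H.FundamentalGroup v) := by
  by_contra hcon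
  rw [not_nontrivial_iff_subsingleton] at hcon
  have h := hH.card_pow v (Multiplicative (ZMod 2))
  have h1 : Nat.card (H.FundamentalGroup v →* Multiplicative (ZMod 2)) = 1 := by
    have : Subsingleton (H.FundamentalGroup v →* Multiplicative (ZMod 2)) :=
      ⟨fun f g => MonoidHom.ext fun x => by rw [Subsingleton.elim x 1, map_one, map_one]⟩
    exact Nat.card_unique
  rw [h1, card_multiplicative_zmod_two, one_mul] at h
  have h2 := Nat.pow_right_injective le_rfl h
  have : Nonempty V(H) := ⟨v⟩
  have h3 : 0 < Nat.card V(H) := Nat.card_pos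
  omega

/-- If all labellings of the edges are coboundaries, the fundamental group is trivial: apply this to
the labelling that defines a functor restricting to the identity of the fundamental group. -/
theorem IsConnected.subsingleton_fundamentalGroup (hH : H.IsConnected) (v : V(H))
    (h : ∀ lab : E(H) → H.FundamentalGroup v, ∃ c : α → H.FundamentalGroup v,
      ∀ e, lab e = c (H.edgeTarget e) * (c (H.edgeSource e))⁻¹) :
    Subsingleton (H.FundamentalGroup v) := by
  obtain ⟨p, hp⟩ := hH.exists_homs v
  let F := functorOfHom p (MonoidHom.id (H.FundamentalGroup v)) 1
  obtain ⟨c, hc⟩ := h fun e => F.map (H.edgeHom e)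
  let F' : H.FundamentalGroupoid ⥤ SingleObj (H.FundamentalGroup v) :=
    functorOfHom p 1 fun x => c (vertexOf x)
  have hFF' : F = F' := functor_ext fun e => by
    refine (hc e).trans ?_
    change _ = c (H.edgeTarget e) * 1 * (c (H.edgeSource e))⁻¹
    rw [mul_one]
  refine subsingleton_of_forall_eq 1 fun g => ?_
  have h1 := homOfFunctor_functorOfHom p hp (MonoidHom.id (H.FundamentalGroup v)) 1 rfl
  have h2 : homOfFunctor F (H.groupoidObj v) g = g := DFunLike.congr_fun h1 g
  rw [hFF'] at h2
  rw [← h2]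
  change c v * 1 * (c v)⁻¹ = 1
  simp

end Graph

/-! ### Collapsing a contractible subspace -/

section Collapse

open unitInterval

theorem Wedge.mk_base_eq {ι : Type*} {X : ι → Type*} {x : ∀ i, X i} (i j : ι) :
    (Quot.mk _ ⟨i, x i⟩ : Wedge X x) = Quot.mk _ ⟨j, x j⟩ :=
  Quot.sound (WedgeRel.base i j)

/-- Let a compact space be covered by closed subspaces `Z i` that meet pairwise in `Y`, such that
collapsing `Y` turns each `Z i` into a copy of the pointed space `S`. If the space can be deformed
so that `Y` stays in `Y` and ends up in one point, then it is homotopy equivalent to the wedge of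
the copies of `S`. Both the end of the deformation and its composition with the collapse descend
to the wedge, where they give the homotopy inverse and the second homotopy. -/
theorem nonempty_homotopyEquiv_wedge {X S ι : Type*} [TopologicalSpace X] [CompactSpace X]
    [TopologicalSpace S] [T2Space S] [Finite ι] [Nonempty ι] (b : S) (Y : Set X) (Z : ι → Set X)
    (hclosed : ∀ i, IsClosed (Z i)) (hcover : ∀ x, ∃ i, x ∈ Z i)
    (hinter : ∀ i j x, x ∈ Z i → x ∈ Z j → i ≠ j → x ∈ Y)
    (q : ι → X → S) (hq : ∀ i, Continuous (q i)) (hqY : ∀ i, ∀ x ∈ Z i, q i x = b ↔ x ∈ Y)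
    (hinj : ∀ i, ∀ x ∈ Z i, ∀ x' ∈ Z i, x ∉ Y → q i x = q i x' → x = x')
    (hsurj : ∀ i z, ∃ x ∈ Z i, q i x = z) (H : C(I × X, X)) (H0 : ∀ x, H (0, x) = x)
    (HY : ∀ t, ∀ y ∈ Y, H (t, y) ∈ Y) (y₀ : X) (H1 : ∀ y ∈ Y, H (1, y) = y₀) :
    Nonempty (ContinuousMap.HomotopyEquiv X (Wedge (fun _ : ι => S) fun _ => b)) := by
  choose idx hidx using hcover
  let W := Wedge (fun _ : ι => S) fun _ => b
  let mk : ι → S → W := fun i z => Quot.mk _ ⟨i, z⟩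
  have hmk : ∀ i, Continuous (mk i) := fun i => continuous_quot_mk.comp continuous_sigmaMk
  have hmkb : ∀ i j, mk i b = mk j b := fun i j => Wedge.mk_base_eq i j
  let Q₀ : X → W := fun x => mk (idx x) (q (idx x) x)
  have hQ₀ : ∀ i, ∀ x ∈ Z i, Q₀ x = mk i (q i x) := by
    intro i x hx
    by_cases h : idx x = i
    · simp only [Q₀, h]
    · have hY := hinter _ _ x (hidx x) hx h
      simp only [Q₀]
      rw [(hqY _ x (hidx x)).2 hY, (hqY i x hx).2 hY]
      exact hmkb _ _
  have hQ₀c : Continuous Q₀ := by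
    refine (locallyFinite_of_finite Z).continuous
      (Set.eq_univ_of_forall fun x => Set.mem_iUnion.2 ⟨_, hidx x⟩) hclosed fun i => ?_
    exact ((hmk i).comp (hq i)).continuousOn.congr fun x hx => hQ₀ i x hx
  let Q : C(X, W) := ⟨Q₀, hQ₀c⟩
  let π : ∀ i, C(Z i, S) := fun i => ⟨fun x => q i x, (hq i).comp continuous_subtype_val⟩
  have hπ : ∀ i, Topology.IsQuotientMap (π i) := fun i => by
    have : CompactSpace (Z i) := isCompact_iff_compactSpace.1 (hclosed i).isCompact
    exact (π i).continuous.isClosedMap.isQuotientMap (π i).continuous fun z => by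
      obtain ⟨x, hx, hxz⟩ := hsurj i z
      exact ⟨⟨x, hx⟩, hxz⟩
  -- Two points of `Z i` with the same image are equal or both in `Y`.
  have hfib : ∀ i (x x' : Z i), π i x = π i x' → x.1 = x'.1 ∨ x.1 ∈ Y ∧ x'.1 ∈ Y := by
    intro i x x' h
    by_cases hx : x.1 ∈ Y
    · exact Or.inr ⟨hx, (hqY i _ x'.2).1 (h.symm.trans ((hqY i _ x.2).2 hx))⟩
    · exact Or.inl (hinj i _ x.2 _ x'.2 hx h)
  let inc : ∀ i, C(Z i, X) := fun i => ⟨Subtype.val, continuous_subtype_val⟩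
  let end₁ : C(X, X) := ⟨fun x => H (1, x), by fun_prop⟩
  have hgi : ∀ i (x x' : Z i), π i x = π i x' → end₁.comp (inc i) x = end₁.comp (inc i) x' := by
    intro i x x' h
    rcases hfib i x x' h with h | ⟨h, h'⟩
    · exact congrArg end₁ h
    · exact (H1 _ h).trans (H1 _ h').symm
  let g : ∀ i, C(S, X) := fun i => (hπ i).lift (end₁.comp (inc i)) (hgi i)
  have hg : ∀ i (x : X) (hx : x ∈ Z i), g i (q i x) = H (1, x) := fun i x hx =>
    DFunLike.congr_fun ((hπ i).lift_comp (end₁.comp (inc i)) (hgi i)) ⟨x, hx⟩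
  have hgb : ∀ i, g i b = y₀ := fun i => by
    obtain ⟨x, hx, hxb⟩ := hsurj i b
    rw [← hxb, hg i x hx, H1 x ((hqY i x hx).1 hxb)]
  let G : C(W, X) := ⟨Quot.lift (fun p => g p.1 p.2) (by
      rintro _ _ ⟨i, j⟩
      exact (hgb i).trans (hgb j).symm),
    continuous_quot_lift _ (continuous_sigma fun i => (g i).continuous)⟩
  let k₀ : C(X, C(I, W)) := ContinuousMap.curry ⟨fun p : X × I => Q (H (p.2, p.1)), by fun_prop⟩
  have hkY : ∀ y ∈ Y, ∀ t i, k₀ y t = mk i b := fun y hy t i => by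
    have h1 := HY t y hy
    have h2 := hidx (H (t, y))
    change Q₀ (H (t, y)) = _
    rw [hQ₀ _ _ h2, (hqY _ _ h2).2 h1]
    exact hmkb _ _
  have hki : ∀ i (x x' : Z i), π i x = π i x' → k₀.comp (inc i) x = k₀.comp (inc i) x' := by
    intro i x x' h
    rcases hfib i x x' h with h | ⟨h, h'⟩
    · exact congrArg k₀ h
    · ext1 t
      exact (hkY _ h t i).trans (hkY _ h' t i).symm
  let k : ∀ i, C(S, C(I, W)) := fun i => (hπ i).lift (k₀.comp (inc i)) (hki i)
  have hk : ∀ i (x : X) (hx : x ∈ Z i), k i (q i x) = k₀ x := fun i x hx =>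
    DFunLike.congr_fun ((hπ i).lift_comp (k₀.comp (inc i)) (hki i)) ⟨x, hx⟩
  have hkb : ∀ i, ∀ x ∈ Z i, q i x = b → k i b = k₀ x := fun i x hx hxb =>
    (congrArg (k i) hxb).symm.trans (hk i x hx)
  let K : C(W, C(I, W)) := ⟨Quot.lift (fun p => k p.1 p.2) (by
      rintro _ _ ⟨i, j⟩
      change k i b = k j b
      obtain ⟨x, hx, hxb⟩ := hsurj i b
      obtain ⟨x', hx', hxb'⟩ := hsurj j b
      ext1 t
      rw [hkb i x hx hxb, hkb j x' hx' hxb']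
      exact (hkY x ((hqY i x hx).1 hxb) t i).trans (hkY x' ((hqY j x' hx').1 hxb') t i).symm),
    continuous_quot_lift _ (continuous_sigma fun i => (k i).continuous)⟩
  have hsurjW : ∀ w : W, ∃ i, ∃ x ∈ Z i, w = mk i (q i x) := by
    rintro ⟨i, z⟩
    obtain ⟨x, hx, rfl⟩ := hsurj i z
    exact ⟨i, x, hx, rfl⟩
  refine ⟨⟨Q, G, ?_, ?_⟩⟩
  · refine ContinuousMap.Homotopic.symm ⟨⟨H, H0, fun x => ?_⟩⟩
    exact (hg _ x (hidx x)).symm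
  · refine ContinuousMap.Homotopic.symm
      ⟨⟨⟨fun p => K p.2 p.1, by fun_prop⟩, fun w => ?_, fun w => ?_⟩⟩
    · obtain ⟨i, x, hx, rfl⟩ := hsurjW w
      change k i (q i x) 0 = mk i (q i x)
      rw [hk i x hx]
      change Q₀ (H (0, x)) = _
      rw [H0, hQ₀ i x hx]
    · obtain ⟨i, x, hx, rfl⟩ := hsurjW w
      change k i (q i x) 1 = Q (g i (q i x))
      rw [hk i x hx, hg i x hx]
      rfl

end Collapse

/-! ### Collapsing the boundary of a simplex -/

section SphereMap

variable {d : ℕ}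

/-- The smallest coordinate of a vector. -/
noncomputable def minCoord (a : Fin (d + 1) → ℝ) : ℝ := Finset.univ.inf' Finset.univ_nonempty a

theorem minCoord_le (a : Fin (d + 1) → ℝ) (j : Fin (d + 1)) : minCoord a ≤ a j :=
  Finset.inf'_le a (Finset.mem_univ j)

theorem exists_minCoord_eq (a : Fin (d + 1) → ℝ) : ∃ j, minCoord a = a j := by
  obtain ⟨j, -, hj⟩ := Finset.exists_mem_eq_inf' Finset.univ_nonempty a
  exact ⟨j, hj⟩

theorem le_minCoord {a : Fin (d + 1) → ℝ} {c : ℝ} (h : ∀ j, c ≤ a j) : c ≤ minCoord a :=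
  Finset.le_inf' _ _ fun j _ => h j

theorem continuous_minCoord : Continuous (minCoord : (Fin (d + 1) → ℝ) → ℝ) :=
  Continuous.finset_inf'_apply _ fun i _ => continuous_apply i

/-- Vectors of barycentric coordinates of a point with respect to one face of a simplicial complex
that is maximal: if no coordinate vanishes, their sum is one. -/
structure IsFacetCoord (a : Fin (d + 1) → ℝ) : Prop where
  nonneg : ∀ j, 0 ≤ a j
  sum_eq_one : 0 < minCoord a → ∑ j, a j = 1

/-- The square of the distance from the barycentre, in the coordinates `a (j + 1) - a 0`, with a
correction for points outside the face. -/
noncomputable def barySq (a : Fin (d + 1) → ℝ) : ℝ :=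
  ∑ j : Fin d, (a j.succ - a 0) ^ 2 + (1 - ∑ j, a j) ^ 2

/-- Inverse stereographic projection, from the base point, of the vector with the coordinates
`(a (j + 1) - a 0) / minCoord a`. The denominators are cleared so that the boundary of the simplex,
where `minCoord a = 0`, is sent to the base point. -/
noncomputable def sphereVec (a : Fin (d + 1) → ℝ) : EuclideanSpace ℝ (Fin (d + 1)) :=
  WithLp.toLp 2 (Fin.cons ((barySq a - minCoord a ^ 2) / (barySq a + minCoord a ^ 2))
    fun j : Fin d => 2 * minCoord a * (a j.succ - a 0) / (barySq a + minCoord a ^ 2))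

theorem sphereVec_zero (a : Fin (d + 1) → ℝ) :
    sphereVec a 0 = (barySq a - minCoord a ^ 2) / (barySq a + minCoord a ^ 2) := rfl

theorem sphereVec_succ (a : Fin (d + 1) → ℝ) (j : Fin d) :
    sphereVec a j.succ = 2 * minCoord a * (a j.succ - a 0) / (barySq a + minCoord a ^ 2) := rfl

theorem barySq_nonneg (a : Fin (d + 1) → ℝ) : 0 ≤ barySq a :=
  add_nonneg (Finset.sum_nonneg fun _ _ => sq_nonneg _) (sq_nonneg _)

theorem continuous_barySq : Continuous (barySq : (Fin (d + 1) → ℝ) → ℝ) := by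
  unfold barySq
  fun_prop

theorem IsFacetCoord.minCoord_nonneg {a : Fin (d + 1) → ℝ} (ha : IsFacetCoord a) :
    0 ≤ minCoord a := le_minCoord ha.nonneg

theorem IsFacetCoord.denom_pos {a : Fin (d + 1) → ℝ} (_ha : IsFacetCoord a) :
    0 < barySq a + minCoord a ^ 2 := by
  refine lt_of_le_of_ne (add_nonneg (barySq_nonneg a) (sq_nonneg _)) fun h => ?_
  have h1 : barySq a = 0 := by linarith [barySq_nonneg a, sq_nonneg (minCoord a)]
  have h2 : minCoord a = 0 := by
    have : minCoord a ^ 2 = 0 := by linarith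
    simpa using this
  unfold barySq at h1
  have h3 : 0 ≤ ∑ j : Fin d, (a j.succ - a 0) ^ 2 := Finset.sum_nonneg fun _ _ => sq_nonneg _
  have h4 : ∑ j, a j = 1 := by
    have : (1 - ∑ j, a j) ^ 2 = 0 := by linarith [sq_nonneg (1 - ∑ j, a j)]
    have := pow_eq_zero_iff (two_ne_zero) |>.1 this
    linarith
  have h5 : ∑ j : Fin d, (a j.succ - a 0) ^ 2 = 0 := by linarith [sq_nonneg (1 - ∑ j, a j)]
  have h6 : ∀ j : Fin d, a j.succ = a 0 := fun j => by
    have := (Finset.sum_eq_zero_iff_of_nonneg fun _ _ => sq_nonneg _).1 h5 j (Finset.mem_univ j)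
    have := pow_eq_zero_iff (two_ne_zero) |>.1 this
    linarith
  have h7 : ∀ j, a j = a 0 := Fin.cases rfl h6
  obtain ⟨j, hj⟩ := exists_minCoord_eq a
  have h8 : ∀ i, a i = 0 := fun i => by rw [h7 i, ← h7 j, ← hj, h2]
  simp [h8] at h4

theorem IsFacetCoord.norm_sphereVec {a : Fin (d + 1) → ℝ} (ha : IsFacetCoord a) :
    ‖sphereVec a‖ = 1 := by
  have hpos := ha.denom_pos
  rw [EuclideanSpace.norm_eq, Real.sqrt_eq_one, Fin.sum_univ_succ]
  simp only [Real.norm_eq_abs, sq_abs, sphereVec_zero, sphereVec_succ, div_pow]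
  rw [← Finset.sum_div, ← add_div, div_eq_one_iff_eq (by positivity)]
  simp only [mul_pow]
  rw [← Finset.mul_sum]
  have h : minCoord a ^ 2 * (1 - ∑ j, a j) ^ 2 = 0 := by
    rcases ha.minCoord_nonneg.eq_or_lt with h | h
    · simp [← h]
    · simp [ha.sum_eq_one h]
  have h' : minCoord a ^ 2 * barySq a = minCoord a ^ 2 * ∑ j : Fin d, (a j.succ - a 0) ^ 2 := by
    unfold barySq
    rw [mul_add, h, add_zero]
  linear_combination -4 * h'

theorem IsFacetCoord.sphereVec_zero_eq_one_iff {a : Fin (d + 1) → ℝ} (ha : IsFacetCoord a) :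
    sphereVec a 0 = 1 ↔ minCoord a = 0 := by
  rw [sphereVec_zero, div_eq_one_iff_eq ha.denom_pos.ne']
  constructor
  · intro h
    have : minCoord a ^ 2 = 0 := by linarith
    simpa using this
  · intro h
    simp [h]

theorem eq_base_iff {z : EuclideanSpace ℝ (Fin (d + 1))} (hz : ‖z‖ = 1) :
    z = EuclideanSpace.single 0 1 ↔ z 0 = 1 := by
  constructor
  · rintro rfl
    simp
  · intro h
    rw [EuclideanSpace.norm_eq, Real.sqrt_eq_one, Fin.sum_univ_succ, h] at hz
    have h1 : ∑ j : Fin d, ‖z j.succ‖ ^ 2 = 0 := by simpa using hz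
    have h2 : ∀ j : Fin d, z j.succ = 0 := fun j => by
      have := (Finset.sum_eq_zero_iff_of_nonneg fun _ _ => sq_nonneg _).1 h1 j (Finset.mem_univ j)
      simpa using this
    ext j
    refine Fin.cases ?_ (fun i => ?_) j
    · simp [h]
    · simp [h2 i]

/-- Off the boundary of the simplex, the map to the sphere is injective. -/
theorem IsFacetCoord.sphereVec_injective {a a' : Fin (d + 1) → ℝ} (ha : IsFacetCoord a)
    (ha' : IsFacetCoord a') (hpos : 0 < minCoord a) (h : sphereVec a = sphereVec a') : a = a' := by
  have hpos' : 0 < minCoord a' := by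
    refine lt_of_le_of_ne ha'.minCoord_nonneg fun h0 => hpos.ne' ?_
    rw [← ha.sphereVec_zero_eq_one_iff, h, ha'.sphereVec_zero_eq_one_iff, ← h0]
  have hD := ha.denom_pos
  have hD' := ha'.denom_pos
  -- The stereographic coordinates agree, so that the two vectors differ by an affine substitution.
  have h1 : minCoord a ^ 2 / (barySq a + minCoord a ^ 2) =
      minCoord a' ^ 2 / (barySq a' + minCoord a' ^ 2) := by
    have h0 := congrArg (fun z : EuclideanSpace ℝ (Fin (d + 1)) => z 0) h
    simp only [sphereVec_zero] at h0
    have e : ∀ x y : ℝ, 0 < x + y → y / (x + y) = (1 - (x - y) / (x + y)) / 2 := fun x y hxy => by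
      field_simp
      ring
    rw [e _ _ hD, e _ _ hD', h0]
  have h2 : ∀ j, minCoord a' * (a j - a 0) = minCoord a * (a' j - a' 0) := by
    refine Fin.cases (by simp) fun j => ?_
    have h0 := congrArg (fun z : EuclideanSpace ℝ (Fin (d + 1)) => z j.succ) h
    simp only [sphereVec_succ] at h0
    rw [div_eq_div_iff hD.ne' hD'.ne'] at h0 h1
    have h3 : (2 * minCoord a * minCoord a' * (barySq a + minCoord a ^ 2)) *
        (minCoord a' * (a j.succ - a 0)) = (2 * minCoord a * minCoord a' *
        (barySq a + minCoord a ^ 2)) * (minCoord a * (a' j.succ - a' 0)) := by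
      linear_combination minCoord a * minCoord a * h0 - 2 * minCoord a * (a j.succ - a 0) * h1
    exact mul_left_cancel₀ (by positivity) h3
  obtain ⟨i, hi⟩ := exists_minCoord_eq a
  obtain ⟨i', hi'⟩ := exists_minCoord_eq a'
  have h4 : minCoord a' * a 0 = minCoord a * a' 0 := by
    have e1 := mul_le_mul_of_nonneg_left (minCoord_le a i') hpos'.le
    have e2 := mul_le_mul_of_nonneg_left (minCoord_le a' i) hpos.le
    have e3 := h2 i
    have e4 := h2 i'
    rw [← hi] at e3
    rw [← hi'] at e4
    nlinarith
  have h5 : ∀ j, minCoord a' * a j = minCoord a * a' j := fun j => by linarith [h2 j]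
  have h6 : minCoord a' = minCoord a := by
    have : ∑ j, minCoord a' * a j = ∑ j, minCoord a * a' j := Finset.sum_congr rfl fun j _ => h5 j
    rwa [← Finset.mul_sum, ← Finset.mul_sum, ha.sum_eq_one hpos, ha'.sum_eq_one hpos', mul_one,
      mul_one] at this
  ext j
  have := h5 j
  rw [h6] at this
  exact mul_left_cancel₀ hpos.ne' this

/-- The interior of the simplex is mapped onto the complement of the base point. -/
theorem exists_sphereVec_eq {z : EuclideanSpace ℝ (Fin (d + 1))} (hz : ‖z‖ = 1) (hz0 : z 0 ≠ 1) :
    ∃ a : Fin (d + 1) → ℝ, (∀ j, 0 ≤ a j) ∧ ∑ j, a j = 1 ∧ 0 < minCoord a ∧ sphereVec a = z := by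
  rw [EuclideanSpace.norm_eq, Real.sqrt_eq_one, Fin.sum_univ_succ] at hz
  simp only [Real.norm_eq_abs, sq_abs] at hz
  have hlt : z 0 < 1 := by
    refine lt_of_le_of_ne ?_ hz0
    have : 0 ≤ ∑ j : Fin d, z j.succ ^ 2 := Finset.sum_nonneg fun _ _ => sq_nonneg _
    nlinarith
  have hlt' : 0 < 1 - z 0 := by linarith
  -- Stereographic projection `ζ` of `z`, and the point of the simplex with these coordinates.
  let ζ : Fin (d + 1) → ℝ := Fin.cons 0 fun j => z j.succ / (1 - z 0)
  let s : ℝ := ∑ j, (1 + ζ j - minCoord ζ)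
  have hge : ∀ j, 1 ≤ 1 + ζ j - minCoord ζ := fun j => by linarith [minCoord_le ζ j]
  have hs : 0 < s := Finset.sum_pos (fun j _ => by linarith [hge j]) Finset.univ_nonempty
  let a : Fin (d + 1) → ℝ := fun j => (1 + ζ j - minCoord ζ) / s
  have hmin : minCoord a = 1 / s := by
    apply le_antisymm
    · obtain ⟨j, hj⟩ := exists_minCoord_eq ζ
      refine (minCoord_le a j).trans (le_of_eq ?_)
      simp only [a]
      rw [← hj]
      ring
    · exact le_minCoord fun j => div_le_div_of_nonneg_right (hge j) hs.le
  have hsum : ∑ j, a j = 1 := by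
    simp only [a]
    rw [← Finset.sum_div, div_self hs.ne']
  have hdiff : ∀ j : Fin d, a j.succ - a 0 = z j.succ / (1 - z 0) / s := fun j => by
    have e1 : ζ j.succ = z j.succ / (1 - z 0) := rfl
    have e2 : ζ 0 = 0 := rfl
    simp only [a, e1, e2]
    ring
  have hbary : barySq a = (1 + z 0) / (1 - z 0) / s ^ 2 := by
    unfold barySq
    rw [hsum]
    simp only [hdiff, div_pow]
    rw [← Finset.sum_div, ← Finset.sum_div]
    have : ∑ j : Fin d, z j.succ ^ 2 = (1 - z 0) * (1 + z 0) := by linarith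
    rw [this]
    field_simp
    ring
  have hden : barySq a + minCoord a ^ 2 = 2 / (1 - z 0) / s ^ 2 := by
    rw [hbary, hmin]
    field_simp
    ring
  refine ⟨a, fun j => div_nonneg (by linarith [hge j]) hs.le, hsum, ?_, ?_⟩
  · rw [hmin]
    positivity
  · ext j
    refine Fin.cases ?_ (fun i => ?_) j
    · rw [sphereVec_zero, hden, hbary, hmin]
      field_simp
      ring
    · rw [sphereVec_succ, hden, hdiff, hmin]
      field_simp

end SphereMap

/-! ### Complexes that become contractible when some facets are removed -/

section Facets

variable {V ι : Type*} {d : ℕ}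

/-- A family of distinct facets of dimension `d` of the simplicial complex `K` (given by its
non-empty faces), each with an enumeration `ν i` of its vertices. -/
structure IsFacetFamily (K : Set (Finset V)) (ν : ι → Fin (d + 1) → V) : Prop where
  mem_of_subset : ∀ s ∈ K, ∀ t ⊆ s, t.Nonempty → t ∈ K
  injective : ∀ i, Function.Injective (ν i)
  exists_mem : ∀ i, ∃ s ∈ K, ∀ j, ν i j ∈ s
  maximal : ∀ i, ∀ s ∈ K, (∀ j, ν i j ∈ s) → ∀ x ∈ s, x ∈ Set.range (ν i)
  eq_of_subset : ∀ i i', Set.range (ν i) ⊆ Set.range (ν i') → i = i'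

/-- The complex `K` without the facets enumerated by `ν`. -/
def removeFacets (K : Set (Finset V)) (ν : ι → Fin (d + 1) → V) : Set (Finset V) :=
  {s ∈ K | ∀ i, ∃ j, ν i j ∉ s}

/-- The smallest barycentric coordinate with respect to the facet `ν i`: it is positive in the
interior of that facet, and zero elsewhere. -/
noncomputable def depth (ν : ι → Fin (d + 1) → V) (i : ι) (w : V → ℝ) : ℝ := minCoord (w ∘ ν i)

theorem continuous_depth (ν : ι → Fin (d + 1) → V) (i : ι) : Continuous (depth ν i) :=
  continuous_minCoord.comp (by fun_prop)

section Cell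

variable [Fintype ι] {K : Set (Finset V)} {ν : ι → Fin (d + 1) → V} {w : V → ℝ}

open Classical in
/-- The part of `w` concentrated at the barycentre of the facet whose interior contains `w`: all its
coordinates are equal, and `w - cellPart ν w` lies over the boundary of the facet. -/
noncomputable def cellPart (ν : ι → Fin (d + 1) → V) (w : V → ℝ) (x : V) : ℝ :=
  ∑ i, ∑ j, if ν i j = x then depth ν i w else 0

/-- The total mass of `cellPart ν w`: it is one at the barycentres of the facets. -/
noncomputable def cellMass (ν : ι → Fin (d + 1) → V) (w : V → ℝ) : ℝ :=
  ∑ i, (d + 1) * depth ν i w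

theorem continuous_cellPart (ν : ι → Fin (d + 1) → V) : Continuous (cellPart ν) := by
  classical
  refine continuous_pi fun x => continuous_finsetSum _ fun i _ =>
    continuous_finsetSum _ fun j _ => ?_
  split_ifs
  · exact continuous_depth ν i
  · exact continuous_const

theorem continuous_cellMass (ν : ι → Fin (d + 1) → V) : Continuous (cellMass ν) :=
  continuous_finsetSum _ fun i _ => continuous_const.mul (continuous_depth ν i)

theorem cellPart_eq_zero (h : ∀ i, depth ν i w = 0) : cellPart ν w = 0 := by
  ext x
  simp [cellPart, h]

theorem cellMass_eq {i : ι} (h : ∀ i', i' ≠ i → depth ν i' w = 0) :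
    cellMass ν w = (d + 1) * depth ν i w := by
  unfold cellMass
  rw [Finset.sum_eq_single i (fun i' _ hi' => by rw [h i' hi', mul_zero]) (by simp)]

open Classical in
theorem IsFacetFamily.cellPart_eq (hν : IsFacetFamily K ν) {i : ι}
    (h : ∀ i', i' ≠ i → depth ν i' w = 0) (x : V) :
    cellPart ν w x = if x ∈ Set.range (ν i) then depth ν i w else 0 := by
  unfold cellPart
  rw [Finset.sum_eq_single i (fun i' _ hi' => by simp [h i' hi']) (by simp)]
  split_ifs with hx
  · obtain ⟨j, rfl⟩ := hx
    rw [Finset.sum_eq_single j (fun j' _ hj' => if_neg fun h => hj' (hν.injective i h)) (by simp),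
      if_pos rfl]
  · exact Finset.sum_eq_zero fun j _ => if_neg fun h => hx ⟨j, h⟩

end Cell

variable [Fintype V] {K : Set (Finset V)} {ν : ι → Fin (d + 1) → V} {w : V → ℝ}

theorem isClosed_facesRealisation (K : Set (Finset V)) : IsClosed (facesRealisation K) := by
  have : facesRealisation K = stdSimplex ℝ V ∩
      ⋃ s ∈ K, {w : V → ℝ | ∀ x, x ∉ s → w x = 0} := by
    ext w
    simp only [facesRealisation, Set.mem_ofPred_eq, Set.mem_inter_iff, Set.mem_iUnion, exists_prop]
    refine and_congr_right fun _ => exists_congr fun s => and_congr_right fun _ => ?_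
    exact ⟨fun h x hx => apply_eq_zero_of_support_subset h hx, support_subset_of_forall⟩
  rw [this]
  refine (isClosed_stdSimplex ℝ V).inter
    (Set.Finite.isClosed_biUnion (Set.toFinite K) fun s _ => ?_)
  simp only [Set.ofPred_forall]
  exact isClosed_iInter fun x => isClosed_iInter fun _ =>
    isClosed_eq (continuous_apply x) continuous_const

theorem depth_nonneg (hw : w ∈ facesRealisation K) (i : ι) : 0 ≤ depth ν i w :=
  le_minCoord fun _ => hw.1.1 _

theorem facesRealisation.of_apply_eq_zero {u : V → ℝ} (hw : w ∈ facesRealisation K)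
    (hu : u ∈ stdSimplex ℝ V) (h : ∀ x, w x = 0 → u x = 0) : u ∈ facesRealisation K := by
  obtain ⟨-, s, hs, hws⟩ := hw
  exact ⟨hu, s, hs, support_subset_of_forall fun x hx =>
    h x (apply_eq_zero_of_support_subset hws hx)⟩

namespace IsFacetFamily

theorem apply_eq_zero (hν : IsFacetFamily K ν) (hw : w ∈ facesRealisation K) {i : ι}
    (hi : 0 < depth ν i w) {x : V} (hx : x ∉ Set.range (ν i)) : w x = 0 := by
  obtain ⟨-, s, hs, hws⟩ := hw
  refine apply_eq_zero_of_support_subset hws fun hxs =>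
    hx (hν.maximal i s hs (fun j => hws ?_) x hxs)
  exact (hi.trans_le (minCoord_le _ j)).ne'

theorem eq_of_depth_pos (hν : IsFacetFamily K ν) (hw : w ∈ facesRealisation K) {i i' : ι}
    (hi : 0 < depth ν i w) (hi' : 0 < depth ν i' w) : i = i' := by
  refine hν.eq_of_subset i i' ?_
  rintro _ ⟨j, rfl⟩
  by_contra h
  exact (hi.trans_le (minCoord_le _ j)).ne' (hν.apply_eq_zero hw hi' h)

theorem mem_facesRealisation_removeFacets (hν : IsFacetFamily K ν) :
    w ∈ facesRealisation (removeFacets K ν) ↔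
      w ∈ facesRealisation K ∧ ∀ i, depth ν i w = 0 := by
  classical
  constructor
  · intro hw
    have hwK : w ∈ facesRealisation K := facesRealisation_mono (fun s hs => hs.1) hw
    refine ⟨hwK, fun i => le_antisymm ?_ (depth_nonneg hwK i)⟩
    obtain ⟨-, s, hs, hws⟩ := hw
    obtain ⟨j, hj⟩ := hs.2 i
    exact (minCoord_le _ j).trans (apply_eq_zero_of_support_subset hws hj).le
  · rintro ⟨⟨hw, s, hs, hws⟩, h⟩
    refine ⟨hw, Finset.univ.filter fun x => w x ≠ 0, ⟨hν.mem_of_subset s hs _ ?_ ?_, ?_⟩, ?_⟩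
    · intro x hx
      exact hws (Finset.mem_filter.1 hx).2
    · by_contra hne
      have h0 : ∀ x, w x = 0 := fun x => by
        by_contra hx
        exact hne ⟨x, by simp [hx]⟩
      have := hw.2
      simp [h0] at this
    · intro i
      by_contra! hi
      obtain ⟨j, hj⟩ := exists_minCoord_eq (w ∘ ν i)
      have := h i
      rw [depth, hj] at this
      exact (Finset.mem_filter.1 (hi j)).2 this
    · intro x hx
      simpa using hx

theorem isFacetCoord (hν : IsFacetFamily K ν) (hw : w ∈ facesRealisation K) (i : ι) :
    IsFacetCoord (w ∘ ν i) := by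
  classical
  refine ⟨fun j => hw.1.1 _, fun h => ?_⟩
  rw [← hw.1.2]
  simp only [Function.comp_apply]
  rw [← Finset.sum_image (f := w) (s := Finset.univ) (g := ν i) fun a _ b _ hab =>
    hν.injective i hab]
  refine Finset.sum_subset (Finset.subset_univ _) fun x _ hx => hν.apply_eq_zero hw h ?_
  simpa using hx

end IsFacetFamily

section Homotopy

variable [Fintype ι]

theorem sum_cellPart (ν : ι → Fin (d + 1) → V) (w : V → ℝ) :
    ∑ x, cellPart ν w x = cellMass ν w := by
  classical
  unfold cellPart cellMass
  rw [Finset.sum_comm]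
  refine Finset.sum_congr rfl fun i _ => ?_
  rw [Finset.sum_comm]
  simp

theorem cellMass_eq_zero_iff (hw : w ∈ facesRealisation K) :
    cellMass ν w = 0 ↔ ∀ i, depth ν i w = 0 := by
  unfold cellMass
  rw [Finset.sum_eq_zero_iff_of_nonneg fun i _ =>
    mul_nonneg (by positivity) (depth_nonneg hw i)]
  refine ⟨fun h i => (mul_eq_zero.1 (h i (Finset.mem_univ i))).resolve_left (by positivity),
    fun h i _ => by rw [h i, mul_zero]⟩

theorem cellMass_nonneg (hw : w ∈ facesRealisation K) : 0 ≤ cellMass ν w :=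
  Finset.sum_nonneg fun i _ => mul_nonneg (by positivity) (depth_nonneg hw i)

theorem cellPart_nonneg (hw : w ∈ facesRealisation K) (x : V) : 0 ≤ cellPart ν w x :=
  Finset.sum_nonneg fun i _ => Finset.sum_nonneg fun j _ => by
    split_ifs
    · exact depth_nonneg hw i
    · exact le_rfl

theorem sum_sub_cellPart (hw : w ∈ facesRealisation K) :
    ∑ x, (w x - cellPart ν w x) = 1 - cellMass ν w := by
  rw [Finset.sum_sub_distrib, hw.1.2, sum_cellPart]

namespace IsFacetFamily

theorem exists_depth_eq_zero [Nonempty ι] (hν : IsFacetFamily K ν) (hw : w ∈ facesRealisation K) :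
    ∃ i, ∀ i', i' ≠ i → depth ν i' w = 0 := by
  by_cases h : ∃ i, 0 < depth ν i w
  · obtain ⟨i, hi⟩ := h
    refine ⟨i, fun i' hi' => le_antisymm (not_lt.1 fun h => hi' ?_) (depth_nonneg hw i')⟩
    exact hν.eq_of_depth_pos hw h hi
  · push Not at h
    exact ⟨Classical.arbitrary ι, fun i' _ => le_antisymm (h i') (depth_nonneg hw i')⟩

theorem cellPart_le [Nonempty ι] (hν : IsFacetFamily K ν) (hw : w ∈ facesRealisation K)
    (x : V) : cellPart ν w x ≤ w x := by
  obtain ⟨i, hi⟩ := hν.exists_depth_eq_zero hw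
  rw [hν.cellPart_eq hi]
  split_ifs with hx
  · obtain ⟨j, rfl⟩ := hx
    exact minCoord_le _ j
  · exact hw.1.1 x

theorem cellPart_apply_eq_zero [Nonempty ι] (hν : IsFacetFamily K ν)
    (hw : w ∈ facesRealisation K) {x : V} (hx : w x = 0) :
    cellPart ν w x = 0 :=
  le_antisymm (hx ▸ hν.cellPart_le hw x) (cellPart_nonneg hw x)

/-- The radial projection, away from the barycentres, of the removed facets to their boundaries. -/
theorem smul_sub_cellPart_mem [Nonempty ι] (hν : IsFacetFamily K ν)
    (hw : w ∈ facesRealisation K) (h : cellMass ν w < 1) :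
    (1 - cellMass ν w)⁻¹ • (w - cellPart ν w) ∈ facesRealisation (removeFacets K ν) := by
  have hr : 0 < 1 - cellMass ν w := by linarith
  have hmem : (1 - cellMass ν w)⁻¹ • (w - cellPart ν w) ∈ facesRealisation K := by
    refine facesRealisation.of_apply_eq_zero hw ⟨fun x => ?_, ?_⟩ fun x hx => ?_
    · exact mul_nonneg (inv_nonneg.2 hr.le) (sub_nonneg.2 (hν.cellPart_le hw x))
    · simp only [Pi.smul_apply, Pi.sub_apply, smul_eq_mul]
      rw [← Finset.mul_sum, sum_sub_cellPart hw, inv_mul_cancel₀ hr.ne']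
    · simp [hx, hν.cellPart_apply_eq_zero hw hx]
  refine hν.mem_facesRealisation_removeFacets.2 ⟨hmem, fun i => ?_⟩
  refine le_antisymm ?_ (depth_nonneg hmem i)
  -- The vertex of the facet at which `w` is smallest has become zero.
  obtain ⟨j, hj⟩ := exists_minCoord_eq (w ∘ ν i)
  refine (minCoord_le _ j).trans (mul_nonpos_of_nonneg_of_nonpos (inv_nonneg.2 hr.le) ?_)
  have : depth ν i w ≤ cellPart ν w (ν i j) := by
    classical
    refine le_trans ?_ (Finset.single_le_sum (f := fun i' => ∑ j', if ν i' j' = ν i j then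
      depth ν i' w else 0) (fun i' _ => Finset.sum_nonneg fun j' _ => ?_) (Finset.mem_univ i))
    · refine le_trans ?_ (Finset.single_le_sum (f := fun j' => if ν i j' = ν i j then
        depth ν i w else 0) (fun j' _ => ?_) (Finset.mem_univ j))
      · simp
      · split_ifs
        · exact depth_nonneg hw i
        · exact le_rfl
    · split_ifs
      · exact depth_nonneg hw i'
      · exact le_rfl
  have hj' : depth ν i w = w (ν i j) := hj
  exact sub_nonpos.2 (hj' ▸ this)

end IsFacetFamily

end Homotopy

end Facets

section SphereMap

variable {V ι : Type*} {d : ℕ} [Fintype V] {K : Set (Finset V)} {ν : ι → Fin (d + 1) → V}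

namespace IsFacetFamily

/-- The map that collapses everything except the interior of the facet `ν i`, which is mapped
homeomorphically to the complement of the base point of the sphere. -/
noncomputable def sphereMap (hν : IsFacetFamily K ν) (i : ι) (w : facesRealisation K) :
    UnitSphere d :=
  ⟨sphereVec (w.1 ∘ ν i), by simpa using (hν.isFacetCoord w.2 i).norm_sphereVec⟩

theorem continuous_sphereMap (hν : IsFacetFamily K ν) (i : ι) : Continuous (hν.sphereMap i) := by
  refine Continuous.subtype_mk ?_ _
  have h1 : Continuous fun w : facesRealisation K => w.1 ∘ ν i :=
    continuous_pi fun j => facesRealisation.continuous_apply _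
  have hm := continuous_minCoord.comp h1
  have hb := continuous_barySq.comp h1
  have hne : ∀ w : facesRealisation K, barySq (w.1 ∘ ν i) + minCoord (w.1 ∘ ν i) ^ 2 ≠ 0 :=
    fun w => (hν.isFacetCoord w.2 i).denom_pos.ne'
  simp only [Function.comp_def] at hm hb hne
  refine (PiLp.continuous_toLp 2 _).comp (continuous_pi fun j => ?_)
  refine Fin.cases ?_ (fun j => ?_) j
  · exact (hb.sub (hm.pow 2)).div (hb.add (hm.pow 2)) hne
  · refine Continuous.div ?_ (hb.add (hm.pow 2)) hne
    exact (continuous_const.mul hm).mul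
      ((facesRealisation.continuous_apply _).sub (facesRealisation.continuous_apply _))

theorem sphereMap_eq_base_iff (hν : IsFacetFamily K ν) (i : ι) (w : facesRealisation K) :
    hν.sphereMap i w = UnitSphere.base d ↔ depth ν i w.1 = 0 := by
  rw [Subtype.ext_iff]
  change sphereVec (w.1 ∘ ν i) = EuclideanSpace.single 0 1 ↔ _
  have h := hν.isFacetCoord w.2 i
  rw [eq_base_iff h.norm_sphereVec, h.sphereVec_zero_eq_one_iff, depth]

theorem exists_sphereMap_eq (hν : IsFacetFamily K ν) (i : ι) {z : UnitSphere d}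
    (hz : z ≠ UnitSphere.base d) : ∃ w, hν.sphereMap i w = z ∧ 0 < depth ν i w.1 := by
  classical
  have hz1 : ‖z.1‖ = 1 := by simp
  obtain ⟨a, ha, hsum, hpos, haz⟩ := exists_sphereVec_eq hz1 fun h =>
    hz (Subtype.ext ((eq_base_iff hz1).2 h))
  let w : V → ℝ := fun x => ∑ j, if ν i j = x then a j else 0
  have hwν : w ∘ ν i = a := by
    ext j
    simp only [w, Function.comp_apply]
    rw [Finset.sum_eq_single j (fun j' _ hj' => if_neg fun h => hj' (hν.injective i h)) (by simp),
      if_pos rfl]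
  have hw : w ∈ facesRealisation K := by
    obtain ⟨s, hs, hsν⟩ := hν.exists_mem i
    refine ⟨⟨fun x => Finset.sum_nonneg fun j _ => ?_, ?_⟩, s, hs,
      support_subset_of_forall fun x hx => Finset.sum_eq_zero fun j _ => if_neg ?_⟩
    · split_ifs
      · exact ha j
      · exact le_rfl
    · simp only [w]
      rw [Finset.sum_comm]
      simpa using hsum
    · rintro rfl
      exact hx (hsν j)
  refine ⟨⟨w, hw⟩, Subtype.ext ?_, ?_⟩
  · change sphereVec (w ∘ ν i) = _
    rw [hwν, haz]
  · change 0 < minCoord (w ∘ ν i)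
    rwa [hwν]

end IsFacetFamily

end SphereMap

section FacetHomotopy

open unitInterval

variable {V ι : Type*} {d : ℕ} [Fintype V] [Fintype ι] [Nonempty ι] {K : Set (Finset V)}
  {ν : ι → Fin (d + 1) → V}

namespace IsFacetFamily

/-- A contraction of the complex without the facets `ν` extends to a homotopy of the whole
complex. In each of these facets, an inner part is stretched over the facet, while a growing
collar of the boundary follows the contraction. -/
theorem exists_homotopy_extension (hν : IsFacetFamily K ν)
    [ContractibleSpace (facesRealisation (removeFacets K ν))] :
    ∃ (H : C(I × facesRealisation K, facesRealisation K))
      (y₀ : facesRealisation K), (∀ w, H (0, w) = w) ∧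
      (∀ t w, (∀ i, depth ν i w.1 = 0) → ∀ i, depth ν i (H (t, w)).1 = 0) ∧
      ∀ w, (∀ i, depth ν i w.1 = 0) → H (1, w) = y₀ := by
  classical
  obtain ⟨y₀, ⟨h⟩⟩ := id_nullhomotopic (facesRealisation (removeFacets K ν))
  let g : ℝ × (V → ℝ) → V → ℝ := fun p =>
    if hp : p.2 ∈ facesRealisation (removeFacets K ν) then
      (h (Set.projIcc (0 : ℝ) 1 zero_le_one p.1, ⟨p.2, hp⟩)).1 else 0
  have g_eq : ∀ (t : I) (w : facesRealisation (removeFacets K ν)),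
      g (t, w.1) = (h (t, w)).1 := fun t w => by
    simp only [g]
    rw [dif_pos w.2, Set.projIcc_val]
  have g_cont : ContinuousOn g (Set.univ ×ˢ facesRealisation (removeFacets K ν)) := by
    rw [continuousOn_iff_continuous_domRestrict]
    have : (Set.univ ×ˢ facesRealisation (removeFacets K ν)).domRestrict g = fun p =>
        (h (Set.projIcc (0 : ℝ) 1 zero_le_one p.1.1, ⟨p.1.2, p.2.2⟩)).1 := by
      ext1 p
      exact dif_pos p.2.2
    rw [this]
    have hc : Continuous (Set.projIcc (0 : ℝ) 1 zero_le_one) := continuous_projIcc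
    fun_prop
  -- `r` is a radial coordinate in the facets, zero at the barycentres and one at the boundaries,
  -- and `τ` is this coordinate after the stretching at time `p.1`. Where `τ` exceeds one, the
  -- excess is the time at which the contraction is applied to the radial projection.
  let r : (V → ℝ) → ℝ := fun w => 1 - cellMass ν w
  let τ : ℝ × (V → ℝ) → ℝ := fun p => r p.2 * (1 + p.1)
  have r_cont : Continuous r := continuous_const.sub (continuous_cellMass ν)
  have τ_cont : Continuous τ := (r_cont.comp continuous_snd).mul (by fun_prop)
  have c_cont := continuous_cellPart ν
  let outer : ℝ × (V → ℝ) → V → ℝ := fun p => g (τ p - 1, (r p.2)⁻¹ • (p.2 - cellPart ν p.2))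
  let inner : ℝ × (V → ℝ) → V → ℝ := fun p =>
    ((1 - τ p) / cellMass ν p.2) • cellPart ν p.2 + (1 + p.1) • (p.2 - cellPart ν p.2)
  let F : ℝ × (V → ℝ) → V → ℝ := fun p => if 1 ≤ τ p then outer p else inner p
  have r_pos : ∀ p : ℝ × (V → ℝ), 0 ≤ p.1 → 1 ≤ τ p → 0 < r p.2 := fun p hp hτ => by
    by_contra hr
    have : τ p ≤ 0 := mul_nonpos_of_nonpos_of_nonneg (not_lt.1 hr) (by linarith)
    linarith
  have outer_eq : ∀ p : ℝ × (V → ℝ), ∀ (h1 : τ p - 1 ∈ I)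
      (h2 : (r p.2)⁻¹ • (p.2 - cellPart ν p.2) ∈ facesRealisation (removeFacets K ν)),
      outer p = (h (⟨τ p - 1, h1⟩, ⟨_, h2⟩)).1 := fun p h1 h2 => g_eq ⟨_, h1⟩ ⟨_, h2⟩
  have r_le : ∀ w ∈ facesRealisation K, r w ≤ 1 := fun w hw => by
    have := cellMass_nonneg (ν := ν) hw
    simp only [r]
    linarith
  have τ_le : ∀ p : ℝ × (V → ℝ), p.1 ∈ I → p.2 ∈ facesRealisation K → τ p ≤ 2 :=
    fun p hp hw => by
      have := r_le _ hw
      have h2 := hp.1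
      have h3 := hp.2
      simp only [τ]
      nlinarith
  have proj_mem : ∀ p : ℝ × (V → ℝ), 0 ≤ p.1 → p.2 ∈ facesRealisation K → 1 ≤ τ p →
      (r p.2)⁻¹ • (p.2 - cellPart ν p.2) ∈ facesRealisation (removeFacets K ν) :=
    fun p hp hw hτ => hν.smul_sub_cellPart_mem hw (by
      have := r_pos p hp hτ
      simp only [r] at this
      linarith)
  have F_boundary : ∀ p : ℝ × (V → ℝ), ∀ hp : p.1 ∈ I,
      ∀ hw : p.2 ∈ facesRealisation (removeFacets K ν), F p = (h (⟨p.1, hp⟩, ⟨p.2, hw⟩)).1 := by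
    intro p hp hw
    obtain ⟨hwK, hd⟩ := hν.mem_facesRealisation_removeFacets.1 hw
    have e1 : r p.2 = 1 := by simp [r, (cellMass_eq_zero_iff hwK).2 hd]
    have e2 : τ p - 1 = p.1 := by simp [τ, e1]
    have e3 : (r p.2)⁻¹ • (p.2 - cellPart ν p.2) = p.2 := by simp [e1, cellPart_eq_zero hd]
    have : F p = outer p := if_pos (by linarith [e2, hp.1])
    rw [this]
    simp only [outer]
    rw [e2, e3]
    exact g_eq ⟨p.1, hp⟩ ⟨p.2, hw⟩
  have F_zero : ∀ w ∈ facesRealisation K, F (0, w) = w := by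
    intro w hw
    by_cases hd : ∀ i, depth ν i w = 0
    · rw [F_boundary (0, w) ⟨le_rfl, zero_le_one⟩ (hν.mem_facesRealisation_removeFacets.2 ⟨hw, hd⟩)]
      exact congrArg Subtype.val (h.apply_zero _)
    · have hS : 0 < cellMass ν w := lt_of_le_of_ne (cellMass_nonneg hw) fun h0 =>
        hd ((cellMass_eq_zero_iff hw).1 h0.symm)
      have hτ : τ (0, w) = 1 - cellMass ν w := by simp [τ, r]
      have : F (0, w) = inner (0, w) := if_neg (by rw [hτ]; linarith)
      rw [this]
      simp only [inner, hτ]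
      rw [sub_sub_cancel, div_self hS.ne']
      simp
  have F_mem : ∀ p ∈ I ×ˢ facesRealisation K, F p ∈ facesRealisation K := by
    rintro ⟨t, w⟩ ⟨ht, hw⟩
    have h0 : 0 ≤ t := ht.1
    by_cases hτ : 1 ≤ τ (t, w)
    · have : F (t, w) = outer (t, w) := if_pos hτ
      rw [this, outer_eq (t, w) ⟨by linarith, by linarith [τ_le (t, w) ht hw]⟩
        (proj_mem _ h0 hw hτ)]
      exact (hν.mem_facesRealisation_removeFacets.1 (h _).2).1
    · have : F (t, w) = inner (t, w) := if_neg hτ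
      rw [this]
      have hS : 0 < cellMass ν w := lt_of_le_of_ne (cellMass_nonneg hw) fun hS => hτ (by
        simp only [τ, r]
        rw [← hS]
        linarith)
      refine facesRealisation.of_apply_eq_zero hw ⟨fun x => ?_, ?_⟩ fun x hx => ?_
      · exact add_nonneg (mul_nonneg (div_nonneg (by linarith) hS.le) (cellPart_nonneg hw x))
          (mul_nonneg (by linarith) (sub_nonneg.2 (hν.cellPart_le hw x)))
      · simp only [inner, Pi.add_apply, Pi.smul_apply, Pi.sub_apply, smul_eq_mul]
        rw [Finset.sum_add_distrib, ← Finset.mul_sum, ← Finset.mul_sum, sum_sub_cellPart hw,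
          sum_cellPart, div_mul_cancel₀ _ hS.ne']
        simp only [τ, r]
        ring
      · have hx' : w x = 0 := hx
        simp [inner, hx', hν.cellPart_apply_eq_zero hw hx]
  -- Away from the interiors of all facets but one, the quotient in `inner` can be cleared.
  let bary : ι → V → ℝ := fun i x => if x ∈ Set.range (ν i) then ((d : ℝ) + 1)⁻¹ else 0
  let A : Set (ℝ × (V → ℝ)) := (I ×ˢ facesRealisation K) ∩ {p | 1 ≤ τ p}
  let B : ι → Set (ℝ × (V → ℝ)) := fun i =>
    (I ×ˢ facesRealisation K) ∩ {p | τ p ≤ 1} ∩ {p | ∀ i', i' ≠ i → depth ν i' p.2 = 0}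
  have hIX : IsClosed (I ×ˢ facesRealisation K : Set (ℝ × (V → ℝ))) :=
    isClosed_Icc.prod (isClosed_facesRealisation K)
  have hA : IsClosed A := hIX.inter (isClosed_le continuous_const τ_cont)
  have hB : ∀ i, IsClosed (B i) := fun i => by
    refine (hIX.inter (isClosed_le τ_cont continuous_const)).inter ?_
    simp only [Set.ofPred_forall]
    exact isClosed_iInter fun i' => isClosed_iInter fun _ =>
      isClosed_eq ((continuous_depth ν i').comp continuous_snd) continuous_const
  have hFA : ContinuousOn F A := by
    have h1 : ContinuousOn outer A := by
      refine g_cont.comp (f := fun p => (τ p - 1, (r p.2)⁻¹ • (p.2 - cellPart ν p.2))) ?_ ?_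
      · refine (τ_cont.sub continuous_const).continuousOn.prodMk (ContinuousOn.fun_smul ?_ ?_)
        · exact (r_cont.comp continuous_snd).continuousOn.inv₀ fun p hp =>
            (r_pos p hp.1.1.1 hp.2).ne'
        · exact (continuous_snd.sub (c_cont.comp continuous_snd)).continuousOn
      · exact fun p hp => ⟨trivial, proj_mem p hp.1.1.1 hp.1.2 hp.2⟩
    exact h1.congr fun p hp => if_pos hp.2
  have hFB : ∀ i, ContinuousOn F (B i) := fun i => by
    have h1 : Continuous fun p : ℝ × (V → ℝ) =>
        (1 - τ p) • bary i + (1 + p.1) • (p.2 - cellPart ν p.2) := by fun_prop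
    refine h1.continuousOn.congr fun p hp => ?_
    obtain ⟨⟨⟨ht, hw⟩, hτ : τ p ≤ 1⟩, hi⟩ := hp
    rcases hτ.eq_or_lt with hτ | hτ
    · have e1 : F p = outer p := if_pos hτ.ge
      have e2 : (r p.2)⁻¹ = 1 + p.1 := inv_eq_of_mul_eq_one_right hτ
      rw [e1, outer_eq p (by simp [hτ]) (proj_mem p ht.1 hw hτ.ge)]
      have e3 : (⟨τ p - 1, by simp [hτ]⟩ : I) = 0 := Subtype.ext (by simp [hτ])
      rw [e3, h.apply_zero]
      simp [hτ, e2]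
    · have e1 : F p = inner p := if_neg hτ.not_ge
      have hS : cellMass ν p.2 ≠ 0 := fun hS => by
        have : τ p = 1 + p.1 := by simp [τ, r, hS]
        linarith [ht.1]
      rw [e1]
      ext x
      rw [cellMass_eq hi] at hS
      simp only [inner, Pi.add_apply, Pi.sub_apply, Pi.smul_apply, smul_eq_mul, cellMass_eq hi,
        hν.cellPart_eq hi, bary]
      congr 1
      have hne := right_ne_zero_of_mul hS
      split_ifs
      · field_simp
      · ring
  have hF : ContinuousOn F (I ×ˢ facesRealisation K) := by
    refine (hFA.union_of_isClosed ((locallyFinite_of_finite B).continuousOn_iUnion hB hFB) hA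
      (isClosed_iUnion_of_finite hB)).mono fun p hp => ?_
    rcases le_total 1 (τ p) with h1 | h1
    · exact Or.inl ⟨hp, h1⟩
    · obtain ⟨i, hi⟩ := hν.exists_depth_eq_zero hp.2
      exact Or.inr (Set.mem_iUnion.2 ⟨i, ⟨hp, h1⟩, hi⟩)
  refine ⟨⟨fun p => ⟨F (p.1.1, p.2.1), F_mem _ ⟨p.1.2, p.2.2⟩⟩, ?_⟩,
    ⟨y₀.1, (hν.mem_facesRealisation_removeFacets.1 y₀.2).1⟩, ?_, ?_, ?_⟩
  · refine Continuous.subtype_mk (hF.comp_continuous ?_ fun p => ⟨p.1.2, p.2.2⟩) _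
    fun_prop
  · exact fun w => Subtype.ext (F_zero w.1 w.2)
  · intro t w hw
    refine (hν.mem_facesRealisation_removeFacets.1 ?_).2
    change F (t.1, w.1) ∈ _
    rw [F_boundary (t.1, w.1) t.2 (hν.mem_facesRealisation_removeFacets.2 ⟨w.2, hw⟩)]
    exact (h _).2
  · intro w hw
    refine Subtype.ext ?_
    change F ((1 : I).1, w.1) = _
    rw [F_boundary ((1 : I).1, w.1) (1 : I).2 (hν.mem_facesRealisation_removeFacets.2 ⟨w.2, hw⟩)]
    exact congrArg Subtype.val (h.apply_one _)

/-- A complex that becomes contractible when some facets of dimension `d` are removed is homotopy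
equivalent to a wedge of `d`-spheres, one for each of these facets. -/
theorem nonempty_homotopyEquiv_wedge (hν : IsFacetFamily K ν)
    [ContractibleSpace (facesRealisation (removeFacets K ν))] :
    Nonempty (ContinuousMap.HomotopyEquiv (facesRealisation K)
      (Wedge (fun _ : ι => UnitSphere d) fun _ => UnitSphere.base d)) := by
  have : CompactSpace (facesRealisation K) := isCompact_iff_compactSpace.1
    ((isCompact_stdSimplex ℝ V).of_isClosed_subset (isClosed_facesRealisation K) fun w hw => hw.1)
  obtain ⟨H, y₀, H0, HY, H1⟩ := hν.exists_homotopy_extension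
  obtain ⟨w₀⟩ : Nonempty (facesRealisation (removeFacets K ν)) := inferInstance
  have hw₀ := hν.mem_facesRealisation_removeFacets.1 w₀.2
  have hpos : ∀ (w : facesRealisation K) i, depth ν i w.1 ≠ 0 → 0 < depth ν i w.1 :=
    fun w i h => lt_of_le_of_ne (depth_nonneg w.2 i) h.symm
  have hZ : ∀ (w : facesRealisation K) i, 0 < depth ν i w.1 →
      ∀ i', i' ≠ i → depth ν i' w.1 = 0 := fun w i h i' hi' => by
    by_contra hne
    exact hi' (hν.eq_of_depth_pos w.2 (hpos w i' hne) h)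
  refine _root_.nonempty_homotopyEquiv_wedge (UnitSphere.base d)
    {w : facesRealisation K | ∀ i, depth ν i w.1 = 0}
    (fun i => {w : facesRealisation K | ∀ i', i' ≠ i → depth ν i' w.1 = 0}) ?_ ?_ ?_ hν.sphereMap
    hν.continuous_sphereMap ?_ ?_ ?_ H H0 HY y₀ H1
  · intro i
    simp only [Set.ofPred_forall]
    exact isClosed_iInter fun i' => isClosed_iInter fun _ =>
      isClosed_eq ((continuous_depth ν i').comp continuous_subtype_val) continuous_const
  · exact fun w => hν.exists_depth_eq_zero w.2
  · intro i i' w hi hi' hne j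
    by_cases hj : j = i
    · exact hi' j (hj ▸ hne)
    · exact hi j hj
  · intro i w hw
    rw [hν.sphereMap_eq_base_iff]
    refine ⟨fun h i' => ?_, fun h => h i⟩
    by_cases hi' : i' = i
    · rwa [hi']
    · exact hw i' hi'
  · intro i w hw w' hw' hwY heq
    have hi : 0 < depth ν i w.1 := hpos w i fun h0 => hwY fun i' => by
      by_cases hi' : i' = i
      · rwa [hi']
      · exact hw i' hi'
    have hi2 : 0 < depth ν i w'.1 := hpos w' i fun h0 => hi.ne' (by
      rw [← hν.sphereMap_eq_base_iff, heq, hν.sphereMap_eq_base_iff, h0])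
    have := (hν.isFacetCoord w.2 i).sphereVec_injective (hν.isFacetCoord w'.2 i) hi
      (congrArg Subtype.val heq)
    ext x
    by_cases hx : x ∈ Set.range (ν i)
    · obtain ⟨j, rfl⟩ := hx
      exact congrFun this j
    · rw [hν.apply_eq_zero w.2 hi hx, hν.apply_eq_zero w'.2 hi2 hx]
  · intro i z
    by_cases hz : z = UnitSphere.base d
    · refine ⟨⟨w₀.1, hw₀.1⟩, fun i' _ => hw₀.2 i', ?_⟩
      rw [hz, hν.sphereMap_eq_base_iff]
      exact hw₀.2 i
    · obtain ⟨w, hw, hd⟩ := hν.exists_sphereMap_eq i hz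
      exact ⟨w, hZ w i hd, hw⟩

end IsFacetFamily

end FacetHomotopy

section SphericalRealisation

variable {P : Type*} [PartialOrder P] [Fintype P] {d m : ℕ}

/-- If the order complex of a poset collapses to a point after the removal of `m` simplices of top
dimension, it is homotopy equivalent to a wedge of `m` spheres. -/
theorem IsSpherical.isWedgeOfSpheres (hm : 1 ≤ m)
    (h : IsSpherical (d + 1) m (Finset.univ : Finset P)) :
    IsWedgeOfSpheres (facesRealisation (chainFaces P)) d := by
  classical
  obtain ⟨hle, C, hCm, hC, hcoll⟩ := IsSpherical.iff_decidable.1 h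
  have huniv : chainsIn (Finset.univ : Finset P) = chainFaces P := by
    ext s
    exact ⟨fun hs => ⟨hs.1, hs.2.2⟩, fun hs => ⟨hs.1, Finset.subset_univ s, hs.2⟩⟩
  rw [huniv] at hle hC hcoll
  let e : Fin m ≃ C := (C.equivFinOfCardEq hCm).symm
  let ν : Fin m → Fin (d + 1) → P := fun i j =>
    (((e i).1.equivFinOfCardEq (hC _ (e i).2).2).symm j).1
  have hrange : ∀ i x, x ∈ Set.range (ν i) ↔ x ∈ (e i).1 := fun i x => by
    constructor
    · rintro ⟨j, rfl⟩
      exact Subtype.prop _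
    · intro hx
      exact ⟨(e i).1.equivFinOfCardEq (hC _ (e i).2).2 ⟨x, hx⟩, by simp [ν]⟩
  have hmax : ∀ i, ∀ s ∈ chainFaces P, (∀ j, ν i j ∈ s) → (e i).1 = s := fun i s hs h => by
    refine Finset.eq_of_subset_of_card_le (fun x hx => ?_) ?_
    · obtain ⟨j, rfl⟩ := (hrange i x).2 hx
      exact h j
    · rw [(hC _ (e i).2).2]
      exact hle s hs
  have hmem : ∀ i j, ν i j ∈ (e i).1 := fun i j => (hrange i _).1 ⟨j, rfl⟩
  have hν : IsFacetFamily (chainFaces P) ν :=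
    { mem_of_subset := fun s hs t hts ht => ⟨ht, hs.2.mono (Finset.coe_subset.2 hts)⟩
      injective := fun i => Subtype.val_injective.comp (Equiv.injective _)
      exists_mem := fun i => ⟨_, (hC _ (e i).2).1, hmem i⟩
      maximal := fun i s hs h x hx => (hrange i x).2 (hmax i s hs h ▸ hx)
      eq_of_subset := fun i i' h => e.injective (Subtype.ext
        (hmax i _ (hC _ (e i').2).1 fun j => (hrange i' _).1 (h ⟨j, rfl⟩))) }
  have hremove : removeFacets (chainFaces P) ν = chainFaces P \ C := by
    ext s
    refine and_congr_right fun hs => ⟨fun h hsC => ?_, fun h i => ?_⟩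
    · obtain ⟨j, hj⟩ := h (e.symm ⟨s, hsC⟩)
      refine hj ?_
      have := hmem (e.symm ⟨s, hsC⟩) j
      rwa [e.apply_symm_apply] at this
    · by_contra! hi
      exact h (hmax i s hs hi ▸ (e i).2)
  have : ContractibleSpace (facesRealisation (removeFacets (chainFaces P) ν)) := by
    rw [hremove]
    exact hcoll.contractibleSpace
  have : Nonempty (Fin m) := ⟨⟨0, hm⟩⟩
  exact ⟨m, hm, hν.nonempty_homotopyEquiv_wedge⟩

end SphericalRealisation

/-! ### Subgraphs and edge sets -/

namespace Graph

variable {α β : Type*} (G : Graph α β)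

/-- The edges of `G` that belong to `H`. -/
noncomputable def edgesOf [Fintype E(G)] (H : Graph α β) : Finset E(G) :=
  open Classical in Finset.univ.filter fun e => e.1 ∈ E(H)

/-- The subgraph consisting of a set of edges and their ends. -/
def edgeSubgraph [DecidableEq α] (S : Finset E(G)) : Graph α β where
  vertexSet := edgeVerts G.edgeSource G.edgeTarget S
  IsLink e x y := G.IsLink e x y ∧ ∃ f ∈ S, f.1 = e
  isLink_symm := fun _ _ => ⟨fun _ _ h => ⟨h.1.symm, h.2⟩⟩
  eq_or_eq_of_isLink_of_isLink := fun _ _ _ _ _ h h' => h.1.left_eq_or_eq h'.1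
  left_mem_of_isLink := by
    rintro _ x y ⟨h, f, hf, rfl⟩
    rcases (G.isLink_edgeSource_edgeTarget f).eq_and_eq_or_eq_and_eq h with h | h
    · exact h.1 ▸ source_mem_edgeVerts hf
    · exact h.2 ▸ target_mem_edgeVerts hf

variable {G} {H : Graph α β} {S T : Finset E(G)}

/-- The chosen orientation does not matter for the invariance of a property along an edge. -/
theorem IsLink.apply_iff {e : E(G)} {x y : α} (h : G.IsLink e x y) {f : α → Prop}
    (hf : f (G.edgeSource e) ↔ f (G.edgeTarget e)) : f x ↔ f y := by
  rcases (G.isLink_edgeSource_edgeTarget e).eq_and_eq_or_eq_and_eq h with ⟨h1, h2⟩ | ⟨h1, h2⟩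
  · rwa [h1, h2] at hf
  · rw [h1, h2] at hf
    exact hf.symm

section Fintype

variable [Fintype E(G)]

theorem mem_edgesOf {e : E(G)} : e ∈ G.edgesOf H ↔ e.1 ∈ E(H) := by simp [edgesOf]

theorem isLink_of_mem_edgesOf (hHG : H ≤ G) {e : E(G)} (he : e ∈ G.edgesOf H) :
    H.IsLink e (G.edgeSource e) (G.edgeTarget e) :=
  (IsSubgraph.isLink_iff hHG (mem_edgesOf.1 he)).2 (G.isLink_edgeSource_edgeTarget e)

theorem IsConnected.edgeConnected (hH : H.IsConnected) (hHG : H ≤ G) :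
    EdgeConnected G.edgeSource G.edgeTarget (G.edgesOf H) := by
  intro f hf e he e' he' hfe
  have key : ∀ y, Relation.ReflTransGen H.Adj (G.edgeSource e) y → f y := fun y hy => by
    induction hy with
    | refl => exact hfe
    | tail _ hbc ih =>
      obtain ⟨d, hd⟩ := hbc
      have hdG := hd.mono hHG
      exact (IsLink.apply_iff (e := ⟨d, hdG.edge_mem⟩) hdG (hf _ (mem_edgesOf.2 hd.edge_mem))).1 ih
  exact key _ (hH.2 _ (isLink_of_mem_edgesOf hHG he).left_mem _
    (isLink_of_mem_edgesOf hHG he').left_mem)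

theorem edgesOf_self : G.edgesOf G = Finset.univ := by
  ext e
  simp [mem_edgesOf]

variable [DecidableEq α]

theorem edgeSubgraph_le_of_subset (hHG : H ≤ G) (hS : S ⊆ G.edgesOf H) : G.edgeSubgraph S ≤ H := by
  refine ⟨fun x hx => ?_, ?_⟩
  · obtain ⟨e, he, rfl | rfl⟩ := mem_edgeVerts.1 (Finset.mem_coe.1 hx)
    · exact (isLink_of_mem_edgesOf hHG (hS he)).left_mem
    · exact (isLink_of_mem_edgesOf hHG (hS he)).right_mem
  · rintro _ x y ⟨h, f, hf, rfl⟩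
    exact (IsSubgraph.isLink_iff hHG (mem_edgesOf.1 (hS hf))).2 h

theorem edgesOf_edgeSubgraph : G.edgesOf (G.edgeSubgraph S) = S := by
  ext e
  rw [mem_edgesOf]
  constructor
  · rintro ⟨x, y, -, f, hf, hfe⟩
    rwa [← Subtype.ext hfe]
  · exact fun he => ⟨_, _, G.isLink_edgeSource_edgeTarget e, e, he, rfl⟩

theorem edgeSubgraph_le : G.edgeSubgraph S ≤ G :=
  edgeSubgraph_le_of_subset le_rfl (by simp [edgesOf_self])

end Fintype

section Connected

variable [DecidableEq α]

theorem isConnected_edgeSubgraph (hS : EdgeConnected G.edgeSource G.edgeTarget S)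
    (hne : S.Nonempty) : (G.edgeSubgraph S).IsConnected := by
  obtain ⟨e, he⟩ := hne
  refine ⟨⟨_, source_mem_edgeVerts he⟩, fun x hx y hy => ?_⟩
  refine hS.of_mem_edgeVerts (f := Relation.ReflTransGen (G.edgeSubgraph S).Adj x) (fun f hf => ?_)
    hx hy .refl
  have h : (G.edgeSubgraph S).IsLink f (G.edgeSource f) (G.edgeTarget f) :=
    ⟨G.isLink_edgeSource_edgeTarget f, f, hf, rfl⟩
  exact ⟨fun h' => h'.tail ⟨_, h⟩, fun h' => h'.tail ⟨_, h.symm⟩⟩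

/-- A graph without leaves has at least as many edges as vertices, so that it is not a tree. -/
theorem nontrivial_fundamentalGroup_edgeSubgraph (hS : IsCore G.edgeSource G.edgeTarget S)
    (v : V(G.edgeSubgraph S)) : Nontrivial ((G.edgeSubgraph S).FundamentalGroup v) := by
  have hE : E(G.edgeSubgraph S) = Subtype.val '' (S : Set E(G)) := by
    ext e
    constructor
    · rintro ⟨x, y, -, f, hf, rfl⟩
      exact ⟨f, hf, rfl⟩
    · rintro ⟨f, hf, rfl⟩
      exact ⟨_, _, G.isLink_edgeSource_edgeTarget f, f, hf, rfl⟩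
  have h1 : Nat.card E(G.edgeSubgraph S) = S.card := by
    rw [Nat.card_coe_set_eq, hE, Set.ncard_image_of_injective _ Subtype.val_injective,
      Set.ncard_coe_finset]
  have h2 : Nat.card V(G.edgeSubgraph S) = (edgeVerts G.edgeSource G.edgeTarget S).card := by
    rw [Nat.card_coe_set_eq]
    exact Set.ncard_coe_finset _
  have : Finite V(G.edgeSubgraph S) := Finset.finite_toSet _
  have : Finite E(G.edgeSubgraph S) := by
    rw [hE]
    exact (Finset.finite_toSet S).image _
  refine (isConnected_edgeSubgraph hS.connected hS.nonempty).nontrivial_fundamentalGroup ?_ v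
  have := hS.leafless.excess_nonneg
  unfold edgeExcess at this
  omega

variable [DecidableEq E(G)] [Fintype E(G)]

/-- A connected subgraph whose core is empty is a tree: pruning its leaves shows that all labellings
of its edges are coboundaries. -/
theorem IsConnected.edgeCore_nonempty (hH : H.IsConnected) (hHG : H ≤ G) (v : V(H))
    [Nontrivial (H.FundamentalGroup v)] :
    (edgeCore G.edgeSource G.edgeTarget (G.edgesOf H)).Nonempty := by
  classical
  rw [Finset.nonempty_iff_ne_empty]
  intro hempty
  refine not_subsingleton (H.FundamentalGroup v) (hH.subsingleton_fundamentalGroup v fun lab => ?_)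
  -- The orientations of an edge as an edge of `G` and as an edge of `H` need not agree.
  let lab' : E(G) → H.FundamentalGroup v := fun e =>
    if he : e.1 ∈ E(H) then
      if H.edgeSource ⟨e, he⟩ = G.edgeSource e ∧ H.edgeTarget ⟨e, he⟩ = G.edgeTarget e then
        (lab ⟨e, he⟩)⁻¹ else lab ⟨e, he⟩
    else 1
  obtain ⟨c, hc⟩ := exists_coboundary_of_edgeCore_eq_empty lab' hempty
  refine ⟨fun x => (c x)⁻¹, fun e => ?_⟩
  have heG : e.1 ∈ E(G) := IsSubgraph.edgeSet_mono hHG e.2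
  have h := hc ⟨e, heG⟩ (mem_edgesOf.2 e.2)
  simp only [lab'] at h
  rw [dif_pos e.2] at h
  split_ifs at h with h1
  · rw [h1.1, h1.2, inv_inv, ← inv_inv (lab e)]
    rw [h]
    group
  · obtain ⟨h2, h3⟩ := (((H.isLink_edgeSource_edgeTarget e).mono hHG).eq_and_eq_or_eq_and_eq
      (G.isLink_edgeSource_edgeTarget ⟨e, heG⟩)).resolve_left h1
    rw [h2, h3, inv_inv]
    exact h

end Connected

end Graph

/-! ### The poset of subgraphs and the poset of cores -/

namespace Graph

variable {α β : Type*} {G : Graph α β} [Fintype E(G)]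

theorem edgesOf_mono {H K : Graph α β} (h : H ≤ K) : G.edgesOf H ⊆ G.edgesOf K := fun _ he =>
  mem_edgesOf.2 (IsSubgraph.edgeSet_mono h (mem_edgesOf.1 he))

variable [DecidableEq α]

/-- Inclusion and exclusion: the edges with both ends at `x` are the loops at `x`. -/
theorem valence_eq_edgeValence (x : α) :
    G.valence x = edgeValence G.edgeSource G.edgeTarget Finset.univ x := by
  classical
  have h1 : G.incidenceSet x = Subtype.val '' (((Finset.univ.filter fun e => G.edgeSource e = x) ∪
      Finset.univ.filter fun e => G.edgeTarget e = x : Finset E(G)) : Set E(G)) := by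
    ext e
    constructor
    · rintro ⟨y, h⟩
      refine ⟨⟨e, h.edge_mem⟩, ?_, rfl⟩
      rcases (G.isLink_edgeSource_edgeTarget ⟨e, h.edge_mem⟩).eq_and_eq_or_eq_and_eq h with h | h
      · simp [h.1]
      · simp [h.2]
    · rintro ⟨f, hf, rfl⟩
      rcases Finset.mem_union.1 (Finset.mem_coe.1 hf) with h | h
      · exact (Finset.mem_filter.1 h).2 ▸ (G.isLink_edgeSource_edgeTarget f).inc_left
      · exact (Finset.mem_filter.1 h).2 ▸ (G.isLink_edgeSource_edgeTarget f).inc_right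
  have h2 : G.loopSet x = Subtype.val '' (((Finset.univ.filter fun e => G.edgeSource e = x) ∩
      Finset.univ.filter fun e => G.edgeTarget e = x : Finset E(G)) : Set E(G)) := by
    ext e
    constructor
    · intro h
      refine ⟨⟨e, IsLoopAt.edge_mem h⟩, ?_, rfl⟩
      rcases (G.isLink_edgeSource_edgeTarget ⟨e, IsLoopAt.edge_mem h⟩).eq_and_eq_or_eq_and_eq h with
        h | h <;> simp [h.1, h.2]
    · rintro ⟨f, hf, rfl⟩
      obtain ⟨h, h'⟩ := Finset.mem_inter.1 (Finset.mem_coe.1 hf)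
      have hl := G.isLink_edgeSource_edgeTarget f
      rwa [(Finset.mem_filter.1 h).2, (Finset.mem_filter.1 h').2] at hl
  rw [valence, h1, h2, Set.ncard_image_of_injective _ Subtype.val_injective,
    Set.ncard_image_of_injective _ Subtype.val_injective, Set.ncard_coe_finset,
    Set.ncard_coe_finset, Finset.card_union_add_card_inter]
  rfl

theorem edgeVerts_univ_subset :
    (edgeVerts G.edgeSource G.edgeTarget Finset.univ : Set α) ⊆ V(G) := fun x hx => by
  obtain ⟨e, -, rfl | rfl⟩ := mem_edgeVerts.1 (Finset.mem_coe.1 hx)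
  · exact (G.isLink_edgeSource_edgeTarget e).left_mem
  · exact (G.isLink_edgeSource_edgeTarget e).right_mem

theorem coe_edgeVerts_univ (hval : ∀ x ∈ V(G), 3 ≤ G.valence x) :
    (edgeVerts G.edgeSource G.edgeTarget Finset.univ : Set α) = V(G) := by
  refine edgeVerts_univ_subset.antisymm fun x hx => ?_
  by_contra h
  have := hval x hx
  rw [valence_eq_edgeValence, edgeValence_eq_zero_iff.2 h] at this
  omega

theorem IsConnected.isCore_univ (hG : G.IsConnected) (hval : ∀ x ∈ V(G), 3 ≤ G.valence x) :
    IsCore G.edgeSource G.edgeTarget Finset.univ where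
  nonempty := by
    obtain ⟨x, hx⟩ := hG.1
    rw [← coe_edgeVerts_univ hval] at hx
    obtain ⟨e, he, -⟩ := mem_edgeVerts.1 (Finset.mem_coe.1 hx)
    exact ⟨e, he⟩
  connected := edgesOf_self (G := G) ▸ hG.edgeConnected le_rfl
  leafless x hx := by
    have hmem : x ∈ edgeVerts G.edgeSource G.edgeTarget Finset.univ := by
      by_contra h
      rw [edgeValence_eq_zero_iff.2 h] at hx
      exact zero_ne_one hx
    have := hval x (edgeVerts_univ_subset hmem)
    rw [valence_eq_edgeValence] at this
    omega

/-- As there are no isolated vertices, a subgraph that contains all edges is the whole graph. -/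
theorem eq_of_edgesOf_eq_univ (hval : ∀ x ∈ V(G), 3 ≤ G.valence x) {H : Graph α β} (hHG : H ≤ G)
    (h : G.edgesOf H = Finset.univ) : H = G := by
  refine Compatible.ext (Set.Subset.antisymm hHG.vertexSet_mono fun x hx => ?_)
    (Set.Subset.antisymm (IsSubgraph.edgeSet_mono hHG) fun e he => ?_) (Compatible.of_le hHG)
  · rw [← coe_edgeVerts_univ hval] at hx
    obtain ⟨e, -, rfl | rfl⟩ := mem_edgeVerts.1 (Finset.mem_coe.1 hx)
    · exact (isLink_of_mem_edgesOf hHG (h ▸ Finset.mem_univ e)).left_mem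
    · exact (isLink_of_mem_edgesOf hHG (h ▸ Finset.mem_univ e)).right_mem
  · exact mem_edgesOf.1 (h ▸ Finset.mem_univ (⟨e, he⟩ : E(G)))

variable [DecidableEq E(G)]

/-- The core of a proper connected subgraph that is not a tree. -/
noncomputable def coreMap (hval : ∀ x ∈ V(G), 3 ≤ G.valence x) :
    G.cX →o properCores G.edgeSource G.edgeTarget Finset.univ where
  toFun H := ⟨edgeCore G.edgeSource G.edgeTarget (G.edgesOf H.1), mem_properCores.2
    ⟨Finset.subset_univ _, fun h => H.2.2.1 (eq_of_edgesOf_eq_univ hval H.2.1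
      (Finset.univ_subset_iff.1 (h ▸ edgeCore_subset))), by
        obtain ⟨H, hHG, -, hH, v, hv⟩ := H
        exact hH.edgeCore_nonempty hHG v, (H.2.2.2.1.edgeConnected H.2.1).edgeCore,
      leafless_edgeCore⟩⟩
  monotone' _ _ h := edgeCore_mono (edgesOf_mono h)

/-- The subgraph formed by the edges of a proper connected core. -/
noncomputable def coreSubgraph (G : Graph α β) [Fintype E(G)] :
    properCores G.edgeSource G.edgeTarget Finset.univ →o G.cX where
  toFun S := ⟨G.edgeSubgraph S.1, edgeSubgraph_le, fun h => (mem_properCores.1 S.2).2.1 (by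
      rw [← edgesOf_edgeSubgraph (S := S.1), h, edgesOf_self]), by
    obtain ⟨-, -, hS⟩ := mem_properCores.1 S.2
    have hc := isConnected_edgeSubgraph hS.connected hS.nonempty
    exact ⟨hc, ⟨_, hc.1.some_mem⟩, nontrivial_fundamentalGroup_edgeSubgraph hS _⟩⟩
  monotone' S T h := edgeSubgraph_le_of_subset edgeSubgraph_le (by
    rw [edgesOf_edgeSubgraph]
    exact h)

theorem coreSubgraph_coreMap_le (hval : ∀ x ∈ V(G), 3 ≤ G.valence x) (H : G.cX) :
    G.coreSubgraph (coreMap hval H) ≤ H :=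
  edgeSubgraph_le_of_subset H.2.1 edgeCore_subset

theorem coreMap_coreSubgraph (hval : ∀ x ∈ V(G), 3 ≤ G.valence x)
    (S : properCores G.edgeSource G.edgeTarget Finset.univ) :
    coreMap hval (G.coreSubgraph S) = S := by
  refine Subtype.ext ?_
  change edgeCore G.edgeSource G.edgeTarget (G.edgesOf (G.edgeSubgraph S.1)) = S.1
  rw [edgesOf_edgeSubgraph, edgeCore_eq_self (mem_properCores.1 S.2).2.2.leafless]

end Graph

theorem mainTheorem9 {α β : Type*} (G : Graph α β) [Finite V(G)] [Finite E(G)]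
    (hconn : G.IsConnected) (n : ℕ) (hn : 2 ≤ n) (hrank : G.HasRank n)
    (hval : ∀ x ∈ V(G), 3 ≤ G.valence x) :
    IsWedgeOfSpheres (PosetRealisation G.cX) (n - 2) := by
  classical
  have := Fintype.ofFinite E(G)
  have hcore := hconn.isCore_univ hval
  have hexcess : edgeExcess G.edgeSource G.edgeTarget Finset.univ = ((n - 2 + 1 : ℕ) : ℤ) := by
    have h1 := hconn.card_of_hasRank hrank
    rw [Nat.card_eq_fintype_card, ← Finset.card_univ, Nat.card_coe_set_eq,
      ← Graph.coe_edgeVerts_univ hval, Set.ncard_coe_finset] at h1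
    unfold edgeExcess
    omega
  obtain ⟨m, hm, h⟩ := exists_isSpherical_properCores _ _ _ _ _ rfl hcore hexcess
  have hQ : IsSpherical (n - 2 + 1) m
      (Finset.univ : Finset (properCores G.edgeSource G.edgeTarget Finset.univ)) := by
    refine IsSpherical.of_image (f := Subtype.val) (fun _ _ _ _ => Iff.rfl) ?_
    rw [Finset.univ_eq_attach, Finset.attach_image_val]
    exact h
  obtain ⟨k, hk, ⟨e⟩⟩ := hQ.isWedgeOfSpheres hm
  exact ⟨k, hk, ⟨(realisationHomotopyEquiv (Graph.coreMap hval) G.coreSubgraph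
    (Graph.coreSubgraph_coreMap_le hval) (Graph.coreMap_coreSubgraph hval)).trans e⟩⟩
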